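/- Let $\mathfrak g$ be a finite-dimensional real Lie algebra and let $G$ be a connected, simply connected Lie group with an identification of its Lie algebra with $\mathfrak g$. Equip $M=\mathfrak g^*$ with the Kirillov--Kostant Poisson structure, $\langle\zeta,\alpha(x)\beta\rangle=\langle x,[\zeta,\beta]\rangle$ for $x\in\mathfrak g^*$ and $\zeta,\beta\in\mathfrak g=T^*_x\mathfrak g^*$. Let $\mathcal C$ be the set of pairs $(X,\eta)$ with $X\in C^1([0,1],\mathfrak g^*)$ and $\eta=\eta_u\,du$, $\eta_u\in C^0([0,1],\mathfrak g)$, such that $dX+\alpha(X)\eta=0$. It is a Banach manifold with global chart $(X,\eta)\mapsto(X(0),\eta_u)\in\mathfrak g^*\times C^0([0,1],\mathfrak g)$. For a $C^1$ path $u\mapsto\beta(\cdot,u)$ of smooth one-forms on $\mathfrak g^*$ with $\beta(\cdot,0)=\beta(\cdot,1)=0$, let $\xi_\beta$ be the vector field on $\mathcal C$ given by $$\delta X=-\alpha(X)\beta,\qquad \delta\eta=d_u\beta+[\eta,\beta],\qquad \beta=\beta(X(u),u).$$ The phase space is $\mathcal G=\mathcal C/H$, the set of orbits generated by the flows of all the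 $\xi_\beta$, with the quotient map $\pi:\mathcal C\to\mathcal G$, the projections $l[(X,\eta)]=X(0)$ and $r[(X,\eta)]=X(1)$, the units $j(x)=[(x,0)]$, the composition $[(X_1,\eta_1)]\bullet[(X_2,\eta_2)]$, defined when $X_1(1)=X_2(0)$ by concatenating (as paths on the two halves of $[0,1]$) representatives with $\eta_i(0)=\eta_i(1)=0$, the inverse $[(X,\eta)]^{-1}=[(X\circ\theta,\theta^*\eta)]$, $\theta(u)=1-u$, and the two-form $\omega_{\mathcal G}$ determined by $\pi^*\omega_{\mathcal G}=\omega|_{\mathcal C}$, where $\omega\big((\delta_1X,\delta_1\eta),(\delta_2X,\delta_2\eta)\big)=\int_0^1\big(\langle\delta_1X,\delta_2\eta\rangle-\langle\delta_2X,\delta_1\eta\rangle\big)$. On $T^*G$ consider $l(g,a)=dR_g(e)^*a$, $r(g,a)=dL_g(e)^*a$, $j(x)=(e,x)$, the product $(g,a)\bullet(h,b)=\big(gh,(dR_h(g)^*)^{-1}a\big)$ if $r(g,a)=l(h,b)$, and the canonical symplectic form $d\theta$, where $\theta_{(g,a)}(v)=\langle a,dp\,v\rangle$ and $p:T^*G\to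 G$ is the projection. For $\eta_u\in C^0([0,1],\mathfrak g)$ let $\mathrm{hol}(\eta)=h(1)\in G$, where $h:[0,1]\to G$ is the solution of $h(0)=e$, $h^{-1}dh=\eta$. **Theorem.** There is a smooth manifold structure on $\mathcal G$ (with its quotient topology) for which $\pi$ is a smooth submersion. The map $$[(X,\eta)]\longmapsto(X(0),\mathrm{hol}(\eta))$$ is well defined and is a diffeomorphism $\mathcal G\to\mathfrak g^*\times G$. Composed with the inverse of the identification $T^*G\cong\mathfrak g^*\times G$, $(g,a)\mapsto(dR_g(e)^*a,g)$, it gives a diffeomorphism $\Phi:\mathcal G\to T^*G$. Under $\Phi$ the maps $l,r,j$, the composition (which is defined on $\mathcal G$ exactly for pairs with $r=l$ and is independent of the representatives) and the inverse of $\mathcal G$ become those of the groupoid $T^*G$, and $\Phi^*(d\theta)=\omega_{\mathcal G}$. -/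

import Mathlib

open scoped Manifold ContDiff Topology
open Set

noncomputable section

/-! ### Finite-dimensional real Lie algebras

A vector space norm is carried along only to have a Banach space of continuous paths.
No compatibility of the norm with the bracket is required. -/

/-- A Lie ring whose additive group carries a norm (not related to the bracket). -/
class NormedLieRing (𝔤 : Type*) extends NormedAddCommGroup 𝔤, LieRing 𝔤

/-- A real Lie algebra carrying a vector space norm (not related to the bracket). -/
class NormedLieAlgebra (𝔤 : Type*) [NormedLieRing 𝔤] extends NormedSpace ℝ 𝔤, LieAlgebra ℝ 𝔤

/-! ### The Banach space of continuous paths -/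

/-- The Banach space of continuous maps `[0,1] → A` with the supremum norm. -/
def PathSpace (A : Type*) [NormedAddCommGroup A] : Type _ := C(unitInterval, A)

namespace PathSpace

variable {A : Type*} [NormedAddCommGroup A]

instance : NormedAddCommGroup (PathSpace A) :=
  inferInstanceAs (NormedAddCommGroup C(unitInterval, A))

instance [NormedSpace ℝ A] : NormedSpace ℝ (PathSpace A) :=
  inferInstanceAs (NormedSpace ℝ C(unitInterval, A))

instance [CompleteSpace A] : CompleteSpace (PathSpace A) :=
  inferInstanceAs (CompleteSpace C(unitInterval, A))

instance : FunLike (PathSpace A) unitInterval A :=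
  inferInstanceAs (FunLike C(unitInterval, A) unitInterval A)

instance : ContinuousMapClass (PathSpace A) unitInterval A :=
  inferInstanceAs (ContinuousMapClass C(unitInterval, A) unitInterval A)

/-- A continuous map as an element of the path space. -/
def mk (f : unitInterval → A) (hf : Continuous f) : PathSpace A :=
  (⟨f, hf⟩ : C(unitInterval, A))

@[simp] theorem mk_apply (f : unitInterval → A) (hf : Continuous f) (u : unitInterval) :
    mk f hf u = f u := rfl

@[ext] theorem ext {f g : PathSpace A} (h : ∀ u, f u = g u) : f = g := DFunLike.ext f g h

theorem continuous (f : PathSpace A) : Continuous f := map_continuous f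

@[simp] theorem add_apply (f g : PathSpace A) (u : unitInterval) : (f + g) u = f u + g u := rfl

@[simp] theorem sub_apply (f g : PathSpace A) (u : unitInterval) : (f - g) u = f u - g u := rfl

@[simp] theorem neg_apply (f : PathSpace A) (u : unitInterval) : (-f) u = -(f u) := rfl

@[simp] theorem zero_apply (u : unitInterval) : (0 : PathSpace A) u = 0 := rfl

@[simp] theorem smul_apply [NormedSpace ℝ A] (r : ℝ) (f : PathSpace A) (u : unitInterval) :
    (r • f) u = r • f u := rfl

theorem norm_apply_le (f : PathSpace A) (u : unitInterval) : ‖f u‖ ≤ ‖f‖ :=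
  ContinuousMap.norm_coe_le_norm (f : C(unitInterval, A)) u

theorem norm_le {f : PathSpace A} {C : ℝ} (hC : 0 ≤ C) (h : ∀ u, ‖f u‖ ≤ C) : ‖f‖ ≤ C :=
  (ContinuousMap.norm_le (f : C(unitInterval, A)) hC).2 h

theorem continuous_ext (f : PathSpace A) :
    Continuous fun t : ℝ => f (projIcc 0 1 zero_le_one t) :=
  f.continuous.comp continuous_projIcc

variable [NormedSpace ℝ A]

variable (A) in
/-- Evaluation at a point of `[0,1]`. -/
def evalL (u : unitInterval) : PathSpace A →L[ℝ] A :=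
  LinearMap.mkContinuous
    { toFun := fun f => f u
      map_add' := fun _ _ => rfl
      map_smul' := fun _ _ => rfl } 1
    (fun f => by
      rw [one_mul]
      exact norm_apply_le f u)

@[simp] theorem evalL_apply (u : unitInterval) (f : PathSpace A) : evalL A u f = f u := rfl

variable (A) in
/-- The constant paths. -/
def constL : A →L[ℝ] PathSpace A :=
  LinearMap.mkContinuous
    { toFun := fun a => mk (fun _ => a) continuous_const
      map_add' := fun _ _ => rfl
      map_smul' := fun _ _ => rfl } 1
    (fun a => by
      rw [one_mul]
      exact norm_le (norm_nonneg _) fun u => le_rfl)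

@[simp] theorem constL_apply (a : A) (u : unitInterval) : constL A a u = a := rfl

variable (A) in
/-- Integration from `0`. -/
def integrateL : PathSpace A →L[ℝ] PathSpace A :=
  LinearMap.mkContinuous
    { toFun := fun f => mk (fun t => ∫ s in (0 : ℝ)..t, f (projIcc 0 1 zero_le_one s)) (by
        have := intervalIntegral.continuous_primitive (μ := MeasureTheory.volume)
          (fun a b => f.continuous_ext.intervalIntegrable a b) 0
        exact this.comp continuous_subtype_val)
      map_add' := by
        intro f g
        ext t
        exact intervalIntegral.integral_add (f.continuous_ext.intervalIntegrable _ _)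
          (g.continuous_ext.intervalIntegrable _ _)
      map_smul' := by
        intro r f
        ext t
        exact intervalIntegral.integral_smul _ _ }
    1
    (by
      intro f
      refine norm_le (by positivity) fun t => ?_
      have h := intervalIntegral.norm_integral_le_of_norm_le_const (a := 0) (b := (t : ℝ))
        (f := fun s => f (projIcc 0 1 zero_le_one s)) (C := ‖f‖)
        (fun s _ => f.norm_apply_le _)
      refine h.trans ?_
      rw [sub_zero, abs_of_nonneg t.2.1, one_mul]
      exact mul_le_of_le_one_right (norm_nonneg _) t.2.2)

theorem integrateL_apply (f : PathSpace A) (t : unitInterval) :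
    integrateL A f t = ∫ s in (0 : ℝ)..t, f (projIcc 0 1 zero_le_one s) := rfl

end PathSpace

section Algebra

variable (𝔤 : Type*) [NormedLieRing 𝔤] [NormedLieAlgebra 𝔤] [FiniteDimensional ℝ 𝔤]

/-- The bracket of a finite-dimensional Lie algebra as a continuous bilinear map. -/
def lieBracketL : 𝔤 →L[ℝ] 𝔤 →L[ℝ] 𝔤 :=
  LinearMap.toContinuousLinearMap
    ((LinearMap.toContinuousLinearMap : (𝔤 →ₗ[ℝ] 𝔤) ≃ₗ[ℝ] (𝔤 →L[ℝ] 𝔤)).toLinearMap ∘ₗ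
      (LieAlgebra.ad ℝ 𝔤 : 𝔤 →ₗ[ℝ] Module.End ℝ 𝔤))

@[simp] theorem lieBracketL_apply (a b : 𝔤) : lieBracketL 𝔤 a b = ⁅a, b⁆ := rfl

variable {𝔤}

/-- The Kirillov--Kostant bivector on `𝔤*` at the point `x`, viewed as a map
`T*ₓ𝔤* = 𝔤 → Tₓ𝔤* = 𝔤*`. It is determined by `⟨ζ, α(x) β⟩ = ⟨x, [ζ, β]⟩`, that is, the Poisson
bracket of the linear functions `ζ` and `β` is the linear function `[ζ, β]`. -/
def kirillovKostant (x : StrongDual ℝ 𝔤) (β : 𝔤) : StrongDual ℝ 𝔤 :=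
  x ∘L ((lieBracketL 𝔤).flip β)

@[simp] theorem kirillovKostant_apply (x : StrongDual ℝ 𝔤) (β ζ : 𝔤) :
    kirillovKostant x β ζ = x ⁅ζ, β⁆ := rfl

end Algebra

/-! ### The constraint manifold

The fields are a path `X : [0,1] → 𝔤*` and a one-form `η = η_u du` on `[0,1]` with values in
`T*𝔤* = 𝔤`, identified with the function `η_u`. -/

section Constraint

variable (𝔤 : Type*) [NormedLieRing 𝔤] [NormedLieAlgebra 𝔤] [FiniteDimensional ℝ 𝔤]

/-- The Banach space of pairs `(X, η)`. -/
abbrev FieldSpace : Type _ := PathSpace (StrongDual ℝ 𝔤) × PathSpace 𝔤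

/-- The solutions `(X, η)`, with `η` continuous and `X` (necessarily continuously) differentiable,
of the constraint equation `dX + α(X) η = 0` for the Kirillov--Kostant structure. The topology is
the one of uniform convergence of `X` and `η`, which on solutions agrees with the
`C¹ × C⁰`-topology. -/
def ConstraintManifold : Type _ :=
  {p : FieldSpace 𝔤 // ∀ u : unitInterval,
    HasDerivWithinAt (fun t : ℝ => p.1 (projIcc 0 1 zero_le_one t))
      (-(kirillovKostant (p.1 u) (p.2 u))) (Icc 0 1) (u : ℝ)}

instance : TopologicalSpace (ConstraintManifold 𝔤) := instTopologicalSpaceSubtype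

variable {𝔤}

namespace ConstraintManifold

/-- The inclusion of the constraint manifold into the space of all fields. -/
def incl (c : ConstraintManifold 𝔤) : FieldSpace 𝔤 := c.1

/-- The base path `X`. -/
def X (c : ConstraintManifold 𝔤) : PathSpace (StrongDual ℝ 𝔤) := c.1.1

/-- The one-form `η`. -/
def η (c : ConstraintManifold 𝔤) : PathSpace 𝔤 := c.1.2

end ConstraintManifold

/-! The chart `(X, η) ↦ (X(0), η)` of the constraint manifold, with values in the Banach space
`𝔤* × C([0,1], 𝔤)`. Its inverse solves the linear equation `X' = - α(X) η`. -/

variable (𝔤) in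
/-- The product `(η, X) ↦ α(X) η` of fields. -/
def fieldMul : PathSpace 𝔤 →L[ℝ]
    PathSpace (StrongDual ℝ 𝔤) →L[ℝ] PathSpace (StrongDual ℝ 𝔤) :=
  LinearMap.mkContinuous₂
    (LinearMap.mk₂ ℝ
      (fun (η : PathSpace 𝔤) (X : PathSpace (StrongDual ℝ 𝔤)) =>
        PathSpace.mk (fun u => kirillovKostant (X u) (η u)) (by
          have h1 := X.continuous
          have h2 := η.continuous
          unfold kirillovKostant
          fun_prop))
      (by intros; ext; simp) (by intros; ext; simp)
      (by intros; ext; simp) (by intros; ext; simp))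
    ‖(lieBracketL 𝔤).flip‖
    (by
      intro η X
      refine PathSpace.norm_le (by positivity) fun u => ?_
      calc ‖X u ∘L ((lieBracketL 𝔤).flip (η u))‖
          ≤ ‖X u‖ * (‖(lieBracketL 𝔤).flip‖ * ‖η u‖) :=
            (ContinuousLinearMap.opNorm_comp_le _ _).trans
              (by gcongr; exact ContinuousLinearMap.le_opNorm _ _)
        _ ≤ ‖X‖ * (‖(lieBracketL 𝔤).flip‖ * ‖η‖) := by
            gcongr
            · exact X.norm_apply_le u
            · exact η.norm_apply_le u
        _ = _ := by ring)

theorem fieldMul_apply (η : PathSpace 𝔤) (X : PathSpace (StrongDual ℝ 𝔤))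
    (u : unitInterval) : fieldMul 𝔤 η X u = kirillovKostant (X u) (η u) := rfl

theorem norm_kirillovKostant_le (x : StrongDual ℝ 𝔤) (β : 𝔤) :
    ‖kirillovKostant x β‖ ≤ ‖(lieBracketL 𝔤).flip‖ * ‖β‖ * ‖x‖ := by
  calc ‖x ∘L ((lieBracketL 𝔤).flip β)‖
      ≤ ‖x‖ * (‖(lieBracketL 𝔤).flip‖ * ‖β‖) :=
        (ContinuousLinearMap.opNorm_comp_le _ _).trans
          (by gcongr; exact ContinuousLinearMap.le_opNorm _ _)
    _ = _ := by ring

variable (𝔤) in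
/-- The Volterra operator `X ↦ ∫₀ α(X) η`, depending linearly on `η`. -/
def volterra : PathSpace 𝔤 →L[ℝ]
    PathSpace (StrongDual ℝ 𝔤) →L[ℝ] PathSpace (StrongDual ℝ 𝔤) :=
  (ContinuousLinearMap.compL ℝ _ _ _ (PathSpace.integrateL (StrongDual ℝ 𝔤))) ∘L fieldMul 𝔤

theorem volterra_apply (η : PathSpace 𝔤) (X : PathSpace (StrongDual ℝ 𝔤)) :
    volterra 𝔤 η X = PathSpace.integrateL _ (fieldMul 𝔤 η X) := rfl

theorem norm_volterra_pow_apply_le (η : PathSpace 𝔤) (n : ℕ)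
    (X : PathSpace (StrongDual ℝ 𝔤)) (t : unitInterval) :
    ‖((volterra 𝔤 η) ^ n) X t‖ ≤
      (‖(lieBracketL 𝔤).flip‖ * ‖η‖) ^ n * ‖X‖ * ((t : ℝ) ^ n / n.factorial) := by
  induction n generalizing t with
  | zero => simpa using X.norm_apply_le t
  | succ n ih =>
    set K := ‖(lieBracketL 𝔤).flip‖ * ‖η‖ with hK
    have hK0 : 0 ≤ K := by positivity
    rw [pow_succ', mul_apply_eq_comp, volterra_apply, PathSpace.integrateL_apply]
    have hb : ∀ s ∈ Ioc (0 : ℝ) t,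
        ‖fieldMul 𝔤 η ((volterra 𝔤 η ^ n) X) (projIcc 0 1 zero_le_one s)‖ ≤
          K ^ (n + 1) * ‖X‖ * (s ^ n / n.factorial) := by
      intro s hs
      have hs1 : s ∈ Icc (0 : ℝ) 1 := ⟨hs.1.le, hs.2.trans t.2.2⟩
      rw [projIcc_of_mem zero_le_one hs1, fieldMul_apply]
      refine (norm_kirillovKostant_le _ _).trans ?_
      have h1 := ih ⟨s, hs1⟩
      calc ‖(lieBracketL 𝔤).flip‖ * ‖η ⟨s, hs1⟩‖ * ‖((volterra 𝔤 η) ^ n) X ⟨s, hs1⟩‖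
          ≤ K * (K ^ n * ‖X‖ * (s ^ n / n.factorial)) := by
            gcongr
            rw [hK]
            gcongr
            exact η.norm_apply_le _
        _ = _ := by ring
    have h2 := intervalIntegral.norm_integral_le_of_norm_le (μ := MeasureTheory.volume)
      (f := fun s => fieldMul 𝔤 η ((volterra 𝔤 η ^ n) X) (projIcc 0 1 zero_le_one s))
      t.2.1 (Filter.Eventually.of_forall hb)
      (Continuous.intervalIntegrable (by fun_prop) _ _)
    refine h2.trans (le_of_eq ?_)
    rw [intervalIntegral.integral_const_mul, intervalIntegral.integral_div, integral_pow,
      Nat.factorial_succ]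
    push_cast
    simp only [ne_eq, Nat.add_eq_zero_iff, one_ne_zero, and_false, not_false_eq_true, zero_pow,
      sub_zero]
    field_simp

theorem isUnit_one_add_volterra (η : PathSpace 𝔤) : IsUnit (1 + volterra 𝔤 η) := by
  set K := ‖(lieBracketL 𝔤).flip‖ * ‖η‖ with hK
  have hK0 : 0 ≤ K := by positivity
  set T := -volterra 𝔤 η with hT
  obtain ⟨n, hn⟩ : ∃ n : ℕ, K ^ n / n.factorial < 1 :=
    ((FloorSemiring.tendsto_pow_div_factorial_atTop K).eventually_lt_const zero_lt_one).exists
  have hnorm : ‖T ^ n‖ < 1 := by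
    refine lt_of_le_of_lt ?_ hn
    refine ContinuousLinearMap.opNorm_le_bound _ (by positivity) fun X => ?_
    refine PathSpace.norm_le (by positivity) fun t => ?_
    have h1 : ‖(T ^ n) X t‖ = ‖((volterra 𝔤 η) ^ n) X t‖ := by
      rcases Nat.even_or_odd n with h | h
      · rw [hT, h.neg_pow]
      · rw [hT, h.neg_pow, neg_apply, PathSpace.neg_apply, norm_neg]
    rw [h1]
    refine (norm_volterra_pow_apply_le η n X t).trans ?_
    rw [← hK]
    have ht : (t : ℝ) ^ n ≤ 1 := pow_le_one₀ t.2.1 t.2.2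
    calc K ^ n * ‖X‖ * ((t : ℝ) ^ n / n.factorial)
        ≤ K ^ n * ‖X‖ * (1 / n.factorial) := by gcongr
      _ = _ := by ring
  have hunit : IsUnit (1 - T ^ n) := isUnit_one_sub_of_norm_lt_one hnorm
  have hcomm : Commute (1 - T) (∑ i ∈ Finset.range n, T ^ i) :=
    (Commute.one_left _).sub_left
      (Commute.sum_right _ _ _ fun i _ => (Commute.refl T).pow_right i)
  rw [← mul_neg_geom_sum T n] at hunit
  have h := (hcomm.isUnit_mul_iff.1 hunit).1
  simpa [hT] using h

/-- The solution of `X' = - α(X) η` with `X(0) = ξ`. -/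
def solvePath (ξ : StrongDual ℝ 𝔤) (η : PathSpace 𝔤) : PathSpace (StrongDual ℝ 𝔤) :=
  Ring.inverse (1 + volterra 𝔤 η) (PathSpace.constL _ ξ)

theorem eq_solvePath_iff (ξ : StrongDual ℝ 𝔤) (η : PathSpace 𝔤)
    (X : PathSpace (StrongDual ℝ 𝔤)) :
    X = solvePath ξ η ↔ X + volterra 𝔤 η X = PathSpace.constL _ ξ := by
  have hu := isUnit_one_add_volterra η
  constructor
  · rintro rfl
    have := congrArg (fun L => L (PathSpace.constL _ ξ)) (Ring.mul_inverse_cancel _ hu)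
    simpa [solvePath] using this
  · intro h
    have := congrArg (fun L => L X) (Ring.inverse_mul_cancel _ hu)
    simp only [mul_apply_eq_comp, add_apply,
      one_apply_eq_self] at this
    rw [h] at this
    exact this.symm

/-- The constraint equation in integral form. -/
theorem constraint_iff (X : PathSpace (StrongDual ℝ 𝔤)) (η : PathSpace 𝔤) :
    (∀ u : unitInterval, HasDerivWithinAt (fun t : ℝ => X (projIcc 0 1 zero_le_one t))
      (-(kirillovKostant (X u) (η u))) (Icc 0 1) (u : ℝ)) ↔
      X + volterra 𝔤 η X = PathSpace.constL _ (X 0) := by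
  have hcont := (fieldMul 𝔤 η X).continuous_ext
  have hint : ∀ u : unitInterval, HasDerivWithinAt
      (fun t : ℝ => ∫ s in (0 : ℝ)..t, fieldMul 𝔤 η X (projIcc 0 1 zero_le_one s))
      (kirillovKostant (X u) (η u)) (Icc 0 1) (u : ℝ) := by
    intro u
    have := intervalIntegral.integral_hasDerivAt_right (hcont.intervalIntegrable 0 (u : ℝ))
      (hcont.stronglyMeasurableAtFilter _ _) hcont.continuousAt
    rw [projIcc_val, fieldMul_apply] at this
    exact this.hasDerivWithinAt
  constructor
  · intro h
    set F : ℝ → StrongDual ℝ 𝔤 := fun t => X (projIcc 0 1 zero_le_one t) +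
      ∫ s in (0 : ℝ)..t, fieldMul 𝔤 η X (projIcc 0 1 zero_le_one s) with hF
    have hd : ∀ t ∈ Icc (0 : ℝ) 1, HasDerivWithinAt F 0 (Icc 0 1) t := by
      intro t ht
      have := (h ⟨t, ht⟩).add (hint ⟨t, ht⟩)
      rwa [neg_add_cancel] at this
    have hc := constant_of_has_deriv_right_zero (f := F) (a := 0) (b := 1)
      (fun t ht => (hd t ht).continuousWithinAt)
      (fun t ht => ((hd t ⟨ht.1, ht.2.le⟩).mono_of_mem_nhdsWithin
        (Icc_mem_nhdsGE_of_mem ht)))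
    ext1 u
    have hu := hc u u.2
    simp only [hF, projIcc_val, intervalIntegral.integral_same, add_zero, projIcc_left] at hu
    exact hu
  · intro h u
    have hX : ∀ t ∈ Icc (0 : ℝ) 1, X (projIcc 0 1 zero_le_one t) = X 0 -
        ∫ s in (0 : ℝ)..t, fieldMul 𝔤 η X (projIcc 0 1 zero_le_one s) := by
      intro t ht
      have h1 := congrArg (fun f => f (⟨t, ht⟩ : unitInterval)) h
      simp only [PathSpace.add_apply, PathSpace.constL_apply] at h1
      rw [projIcc_of_mem zero_le_one ht, ← h1]
      exact (add_sub_cancel_right _ _).symm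
    have h2 := ((hint u).const_sub (X 0))
    exact h2.congr (fun t ht => hX t ht) (hX u u.2)

theorem solvePath_zero (ξ : StrongDual ℝ 𝔤) (η : PathSpace 𝔤) : solvePath ξ η 0 = ξ := by
  have h := (eq_solvePath_iff ξ η _).1 rfl
  have h0 := congrArg (fun f => f (0 : unitInterval)) h
  simpa [volterra_apply, PathSpace.integrateL_apply] using h0

theorem contDiff_solvePath :
    ContDiff ℝ ∞ fun p : StrongDual ℝ 𝔤 × PathSpace 𝔤 => solvePath p.1 p.2 := by
  have h1 : ContDiff ℝ ∞ fun p : StrongDual ℝ 𝔤 × PathSpace 𝔤 =>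
      Ring.inverse (1 + volterra 𝔤 p.2) := by
    rw [contDiff_iff_contDiffAt]
    intro p
    obtain ⟨w, hw⟩ := isUnit_one_add_volterra p.2
    have h2 : ContDiffAt ℝ ∞ (Ring.inverse :
        (PathSpace (StrongDual ℝ 𝔤) →L[ℝ] PathSpace (StrongDual ℝ 𝔤)) → _)
        (1 + volterra 𝔤 p.2) := by
      rw [← hw]
      exact contDiffAt_ringInverse ℝ w
    have h3 : ContDiff ℝ ∞ fun q : StrongDual ℝ 𝔤 × PathSpace 𝔤 => 1 + volterra 𝔤 q.2 :=
      contDiff_const.add ((volterra 𝔤).contDiff.comp contDiff_snd)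
    exact ContDiffAt.comp p h2 h3.contDiffAt
  exact h1.clm_apply ((PathSpace.constL (StrongDual ℝ 𝔤)).contDiff.comp contDiff_fst)

/-- The solution of the constraint equation with initial point `p.1` and one-form `p.2`. -/
def solveConstraint (p : StrongDual ℝ 𝔤 × PathSpace 𝔤) : ConstraintManifold 𝔤 :=
  ⟨(solvePath p.1 p.2, p.2), by
    rw [constraint_iff, solvePath_zero]
    exact (eq_solvePath_iff _ _ _).1 rfl⟩

theorem solveConstraint_eq (c : ConstraintManifold 𝔤) : solveConstraint (c.X 0, c.η) = c :=
  Subtype.ext (Prod.ext ((eq_solvePath_iff _ _ _).2 ((constraint_iff _ _).1 c.2)).symm rfl)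

theorem continuous_coords : Continuous fun c : ConstraintManifold 𝔤 => (c.X 0, c.η) := by
  have h1 : Continuous fun c : ConstraintManifold 𝔤 => c.1 := continuous_subtype_val
  exact ((PathSpace.evalL (StrongDual ℝ 𝔤) 0).continuous.comp h1.fst).prodMk h1.snd

theorem continuous_solveConstraint : Continuous (solveConstraint (𝔤 := 𝔤)) :=
  (contDiff_solvePath.continuous.prodMk continuous_snd).subtype_mk _

variable (𝔤) in
/-- The global chart `(X, η) ↦ (X(0), η)` of the constraint manifold. -/
def constraintChart : ConstraintManifold 𝔤 ≃ₜ StrongDual ℝ 𝔤 × PathSpace 𝔤 where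
  toFun c := (c.X 0, c.η)
  invFun := solveConstraint
  left_inv := solveConstraint_eq
  right_inv p := Prod.ext (solvePath_zero p.1 p.2) rfl
  continuous_toFun := continuous_coords
  continuous_invFun := continuous_solveConstraint

instance : ChartedSpace (StrongDual ℝ 𝔤 × PathSpace 𝔤) (ConstraintManifold 𝔤) :=
  (constraintChart 𝔤).toOpenPartialHomeomorph.singletonChartedSpace rfl

instance : IsManifold 𝓘(ℝ, StrongDual ℝ 𝔤 × PathSpace 𝔤) ∞ (ConstraintManifold 𝔤) :=
  (constraintChart 𝔤).toOpenPartialHomeomorph.isManifold_singleton rfl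

theorem contMDiff_incl : ContMDiff 𝓘(ℝ, StrongDual ℝ 𝔤 × PathSpace 𝔤) 𝓘(ℝ, FieldSpace 𝔤) ∞
    (ConstraintManifold.incl (𝔤 := 𝔤)) := by
  have h : ContDiff ℝ ∞ fun p : StrongDual ℝ 𝔤 × PathSpace 𝔤 =>
      ((solvePath p.1 p.2, p.2) : FieldSpace 𝔤) := contDiff_solvePath.prodMk contDiff_snd
  intro c
  rw [contMDiffAt_iff]
  refine ⟨continuous_subtype_val.continuousAt, ?_⟩
  exact h.contDiffAt.contDiffWithinAt

/-- The canonical symplectic form on the space of fields,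
`ω((δ₁X, δ₁η), (δ₂X, δ₂η)) = ∫₀¹ ⟨δ₁X, δ₂η⟩ - ⟨δ₂X, δ₁η⟩`. -/
def fieldForm (V W : FieldSpace 𝔤) : ℝ :=
  ∫ u in (0 : ℝ)..1, (V.1 (projIcc 0 1 zero_le_one u) (W.2 (projIcc 0 1 zero_le_one u)) -
    W.1 (projIcc 0 1 zero_le_one u) (V.2 (projIcc 0 1 zero_le_one u)))

/-- The restriction of the form `ω` to the constraint manifold. -/
def constraintForm (c : ConstraintManifold 𝔤)
    (v w : TangentSpace 𝓘(ℝ, StrongDual ℝ 𝔤 × PathSpace 𝔤) c) : ℝ :=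
  fieldForm (𝔤 := 𝔤)
    (mfderiv 𝓘(ℝ, StrongDual ℝ 𝔤 × PathSpace 𝔤) 𝓘(ℝ, FieldSpace 𝔤) ConstraintManifold.incl c v)
    (mfderiv 𝓘(ℝ, StrongDual ℝ 𝔤 × PathSpace 𝔤) 𝓘(ℝ, FieldSpace 𝔤) ConstraintManifold.incl c w)

end Constraint

/-! ### Gauge transformations and the phase space -/

section Gauge

variable (𝔤 : Type*) [NormedLieRing 𝔤] [NormedLieAlgebra 𝔤] [FiniteDimensional ℝ 𝔤]

/-- A gauge parameter: a continuously differentiable path `u ↦ β(u)` in the Fréchet space of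
smooth one-forms on `𝔤*` with `β(0) = β(1) = 0`. A one-form on `𝔤*` is a map `𝔤* → 𝔤`.
The field `deriv` is `∂β/∂u`; continuity of a path of smooth one-forms means that all derivatives
in the direction of `𝔤*` are jointly continuous. -/
structure GaugeParameter where
  /-- The value `β(x, u)`. -/
  toFun : unitInterval → StrongDual ℝ 𝔤 → 𝔤
  /-- The value of `∂β/∂u`. -/
  deriv : unitInterval → StrongDual ℝ 𝔤 → 𝔤
  contDiff_toFun : ∀ u, ContDiff ℝ ∞ (toFun u)
  contDiff_deriv : ∀ u, ContDiff ℝ ∞ (deriv u)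
  continuous_toFun : ∀ k : ℕ, Continuous fun p : unitInterval × StrongDual ℝ 𝔤 =>
    iteratedFDeriv ℝ k (toFun p.1) p.2
  continuous_deriv : ∀ k : ℕ, Continuous fun p : unitInterval × StrongDual ℝ 𝔤 =>
    iteratedFDeriv ℝ k (deriv p.1) p.2
  hasDeriv : ∀ (u : unitInterval) (x : StrongDual ℝ 𝔤),
    HasDerivWithinAt (fun t : ℝ => toFun (projIcc 0 1 zero_le_one t) x) (deriv u x)
      (Icc 0 1) (u : ℝ)
  map_zero : ∀ x, toFun 0 x = 0
  map_one : ∀ x, toFun 1 x = 0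

variable {𝔤}

/-- `V = (δX, δη)` is the value at `(X, η)` of the Hamiltonian vector field `ξ_β` on the constraint
manifold: `δX = - α(X) β` and `δη = d_u β + [η, β]`, where `β` stands for `b(u) = β(X(u), u)` and
`d_u` is the total derivative. (In linear coordinates `[η, β]ᵢ = ∂ᵢ αʲᵏ ηⱼ βₖ`.) -/
def IsGaugeVector (β : GaugeParameter 𝔤) (c : ConstraintManifold 𝔤) (V : FieldSpace 𝔤) : Prop :=
  ∀ u : unitInterval,
    V.1 u = -(kirillovKostant (c.X u) (β.toFun u (c.X u))) ∧
    HasDerivWithinAt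
      (fun t : ℝ => β.toFun (projIcc 0 1 zero_le_one t) (c.X (projIcc 0 1 zero_le_one t)))
      (V.2 u - ⁅c.η u, β.toFun u (c.X u)⁆) (Icc 0 1) (u : ℝ)

/-- The flow of some Hamiltonian vector field `ξ_β` carries `c` to `c'` in time `1`. -/
def GaugeFlow (c c' : ConstraintManifold 𝔤) : Prop :=
  ∃ (β : GaugeParameter 𝔤) (γ : ℝ → ConstraintManifold 𝔤), γ 0 = c ∧ γ 1 = c' ∧
    ∀ s ∈ Icc (0 : ℝ) 1, ∃ V : FieldSpace 𝔤, IsGaugeVector β (γ s) V ∧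
      HasDerivWithinAt (fun s => (γ s).incl) V (Icc 0 1) s

variable (𝔤) in
/-- Two solutions are equivalent when they are in the same orbit of the gauge group, which is
generated by the flows of the vector fields `ξ_β`. -/
def gaugeSetoid : Setoid (ConstraintManifold 𝔤) := Relation.EqvGen.setoid GaugeFlow

variable (𝔤) in
/-- The phase space: the space of gauge orbits in the constraint manifold, with the quotient
topology. -/
def PhaseSpace : Type _ := Quotient (gaugeSetoid 𝔤)

instance : TopologicalSpace (PhaseSpace 𝔤) :=
  inferInstanceAs (TopologicalSpace (Quotient (gaugeSetoid 𝔤)))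

/-- The orbit of a solution. -/
def phaseClass (c : ConstraintManifold 𝔤) : PhaseSpace 𝔤 := Quotient.mk (gaugeSetoid 𝔤) c

/-! ### The groupoid structure of the phase space -/

theorem GaugeFlow.endpoint_eq {c c' : ConstraintManifold 𝔤} (h : GaugeFlow c c')
    (u : unitInterval) (hu : ∀ (β : GaugeParameter 𝔤) x, β.toFun u x = 0) : c.X u = c'.X u := by
  obtain ⟨β, γ, rfl, rfl, h⟩ := h
  have hd : ∀ s ∈ Icc (0 : ℝ) 1, HasDerivWithinAt (fun s => (γ s).X u) 0 (Icc 0 1) s := by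
    intro s hs
    obtain ⟨V, hV, hγ⟩ := h s hs
    have h0 : V.1 u = 0 := by
      rw [(hV u).1, hu]
      ext ζ
      simp
    have h1 := ((PathSpace.evalL (StrongDual ℝ 𝔤) u).comp
      (ContinuousLinearMap.fst ℝ _ (PathSpace 𝔤))).hasFDerivAt.comp_hasDerivWithinAt s hγ
    have h2 : (((PathSpace.evalL (StrongDual ℝ 𝔤) u).comp
      (ContinuousLinearMap.fst ℝ _ (PathSpace 𝔤))) V) = 0 := h0
    rw [h2] at h1
    exact h1
  exact (constant_of_has_deriv_right_zero (fun s hs => (hd s hs).continuousWithinAt)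
    (fun s hs => (hd s ⟨hs.1, hs.2.le⟩).mono_of_mem_nhdsWithin
      (Icc_mem_nhdsGE_of_mem hs)) 1 ⟨zero_le_one, le_rfl⟩).symm

theorem endpoint_eq_of_rel (u : unitInterval)
    (hu : ∀ (β : GaugeParameter 𝔤) x, β.toFun u x = 0) (c c' : ConstraintManifold 𝔤)
    (h : Relation.EqvGen GaugeFlow c c') : c.X u = c'.X u := by
  induction h with
  | rel _ _ h => exact h.endpoint_eq u hu
  | refl _ => rfl
  | symm _ _ _ ih => exact ih.symm
  | trans _ _ _ _ _ ih₁ ih₂ => exact ih₁.trans ih₂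

/-- The left projection `l[(X, η)] = X(0)`. -/
def phaseLeft : PhaseSpace 𝔤 → StrongDual ℝ 𝔤 :=
  Quotient.lift (fun c : ConstraintManifold 𝔤 => c.X 0)
    (endpoint_eq_of_rel 0 fun β => β.map_zero)

/-- The right projection `r[(X, η)] = X(1)`. -/
def phaseRight : PhaseSpace 𝔤 → StrongDual ℝ 𝔤 :=
  Quotient.lift (fun c : ConstraintManifold 𝔤 => c.X 1)
    (endpoint_eq_of_rel 1 fun β => β.map_one)

/-- The constant solution `X = x`, `η = 0`. -/
def constSolution (x : StrongDual ℝ 𝔤) : ConstraintManifold 𝔤 :=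
  ⟨(PathSpace.constL _ x, 0), by
    intro u
    have h : -(kirillovKostant x (0 : 𝔤)) = 0 := by
      ext ζ
      simp
    simp only [PathSpace.constL_apply, PathSpace.zero_apply, h]
    exact hasDerivWithinAt_const _ _ _⟩

/-- The identity `j(x)` of the groupoid at `x`. -/
def phaseUnit (x : StrongDual ℝ 𝔤) : PhaseSpace 𝔤 := phaseClass (constSolution x)

/-- `c` is the concatenation of `c₁` and `c₂`. -/
def IsConcatenation (c₁ c₂ c : ConstraintManifold 𝔤) : Prop :=
  ∀ u v : unitInterval,
    ((v : ℝ) = 2 * u → c.X u = c₁.X v ∧ c.η u = (2 : ℝ) • c₁.η v) ∧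
    ((v : ℝ) = 2 * u - 1 → c.X u = c₂.X v ∧ c.η u = (2 : ℝ) • c₂.η v)

/-- `a • b = d` in the phase space: there are representatives of `a` and `b` with `η` vanishing at
the end points whose concatenation is a solution representing `d`. -/
def PhaseComp (a b d : PhaseSpace 𝔤) : Prop :=
  ∃ c₁ c₂ c : ConstraintManifold 𝔤, phaseClass c₁ = a ∧ phaseClass c₂ = b ∧ phaseClass c = d ∧
    c₁.η 0 = 0 ∧ c₁.η 1 = 0 ∧ c₂.η 0 = 0 ∧ c₂.η 1 = 0 ∧ IsConcatenation c₁ c₂ c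

/-- `b = a⁻¹` in the phase space: `b` is represented by the pull-back of a representative of `a`
under `θ(u) = 1 - u`. -/
def PhaseInv (a b : PhaseSpace 𝔤) : Prop :=
  ∃ c c' : ConstraintManifold 𝔤, phaseClass c = a ∧ phaseClass c' = b ∧
    ∀ u : unitInterval, c'.X u = c.X (unitInterval.symm u) ∧ c'.η u = -(c.η (unitInterval.symm u))

end Gauge

/-! ### The cotangent bundle of a Lie group -/

/-- The Lie algebra of a smooth Lie group is defined using that the group is of class `C³`. -/
instance : ENat.LEInfty (minSmoothness ℝ 3) := ⟨by
  rw [minSmoothness_of_isRCLikeNormedField]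
  exact ENat.LEInfty.out⟩

/-- The exterior derivative of a one-form `θ` on a manifold, at `p` and evaluated on `v, w`,
computed in the chart `extChartAt I p`. -/
def extDerivOneForm {F H N : Type*} [NormedAddCommGroup F] [NormedSpace ℝ F] [TopologicalSpace H]
    (I : ModelWithCorners ℝ F H) [TopologicalSpace N] [ChartedSpace H N]
    (θ : ∀ p : N, TangentSpace I p →L[ℝ] ℝ) (p : N) (v w : TangentSpace I p) : ℝ :=
  let θloc : F → F →L[ℝ] ℝ := fun y =>
    (θ ((extChartAt I p).symm y)).comp
      (mfderivWithin 𝓘(ℝ, F) I (extChartAt I p).symm (range I) y)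
  let v' : F := mfderiv I 𝓘(ℝ, F) (extChartAt I p) p v
  let w' : F := mfderiv I 𝓘(ℝ, F) (extChartAt I p) p w
  fderivWithin ℝ θloc (range I) (extChartAt I p p) v' w' -
    fderivWithin ℝ θloc (range I) (extChartAt I p p) w' v'

section Cotangent

variable (E G : Type*) [NormedAddCommGroup E] [NormedSpace ℝ E]
  [TopologicalSpace G] [ChartedSpace E G]

/-- The cotangent bundle `T*G`, with points `⟨g, a⟩`, `g ∈ G`, `a ∈ T*_g G`. -/
abbrev CotangentBundle : Type _ :=
  Bundle.TotalSpace (E →L[ℝ] ℝ)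
    (fun g : G => TangentSpace 𝓘(ℝ, E) g →L[ℝ] Bundle.Trivial G ℝ g)

/-- The model with corners of the cotangent bundle. -/
abbrev cotangentModel : ModelWithCorners ℝ (E × (E →L[ℝ] ℝ)) (ModelProd E (E →L[ℝ] ℝ)) :=
  𝓘(ℝ, E).prod 𝓘(ℝ, E →L[ℝ] ℝ)

variable {E G} [IsManifold 𝓘(ℝ, E) 1 G]

/-- The Liouville one-form `θ_{(g,a)}(v) = ⟨a, dπ v⟩` of the cotangent bundle. -/
def liouvilleForm (p : CotangentBundle E G) : TangentSpace (cotangentModel E) p →L[ℝ] ℝ :=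
  ContinuousLinearMap.comp (p.2 : TangentSpace 𝓘(ℝ, E) p.1 →L[ℝ] ℝ)
    (mfderiv (cotangentModel E) 𝓘(ℝ, E) (fun q : CotangentBundle E G => q.1) p)

/-- The canonical symplectic form `dθ` of the cotangent bundle. -/
def cotangentForm (p : CotangentBundle E G) (v w : TangentSpace (cotangentModel E) p) : ℝ :=
  extDerivOneForm (cotangentModel E) (liouvilleForm (E := E) (G := G)) p v w

end Cotangent

section CotangentGroupoid

variable {𝔤 : Type*} [NormedLieRing 𝔤] [NormedLieAlgebra 𝔤] [FiniteDimensional ℝ 𝔤]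
  {E G : Type*} [NormedAddCommGroup E] [NormedSpace ℝ E] [FiniteDimensional ℝ E]
  [TopologicalSpace G] [ChartedSpace E G] [Group G] [LieGroup 𝓘(ℝ, E) ∞ G]

/-- The element `g` is the holonomy of `η`: the path `h` in `G` with `h(0) = 1` and
`dh/du = dL_h η` (that is, `h⁻¹ dh = η`) ends at `h(1) = g`. -/
def IsHolonomy (φ : 𝔤 ≃ₗ⁅ℝ⁆ GroupLieAlgebra 𝓘(ℝ, E) G) (η : PathSpace 𝔤) (g : G) : Prop :=
  ∃ h : ℝ → G, h 0 = 1 ∧ h 1 = g ∧ ∀ u : unitInterval,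
    HasMFDerivWithinAt 𝓘(ℝ, ℝ) 𝓘(ℝ, E) h (Icc 0 1) (u : ℝ)
      (ContinuousLinearMap.toSpanSingleton ℝ (mulInvariantVectorField (φ (η u)) (h u)))

/-- The left projection `l(g, a) = dR_g(e)^* a` of `T*G`, where `R_g` is right translation. -/
def cotangentLeft (φ : 𝔤 ≃ₗ⁅ℝ⁆ GroupLieAlgebra 𝓘(ℝ, E) G) (p : CotangentBundle E G) :
    StrongDual ℝ 𝔤 :=
  LinearMap.toContinuousLinearMap
    { toFun := fun ζ => p.2 (mfderiv 𝓘(ℝ, E) 𝓘(ℝ, E) (fun x : G => x * p.1) 1 (φ ζ))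
      map_add' := fun a b => by
        rw [map_add, map_add]
        exact map_add p.2 _ _
      map_smul' := fun r a => by
        rw [map_smul, map_smul]
        exact map_smul p.2 _ _ }

/-- The right projection `r(g, a) = dL_g(e)^* a` of `T*G`, where `L_g` is left translation. -/
def cotangentRight (φ : 𝔤 ≃ₗ⁅ℝ⁆ GroupLieAlgebra 𝓘(ℝ, E) G) (p : CotangentBundle E G) :
    StrongDual ℝ 𝔤 :=
  LinearMap.toContinuousLinearMap
    { toFun := fun ζ => p.2 (mfderiv 𝓘(ℝ, E) 𝓘(ℝ, E) (fun x : G => p.1 * x) 1 (φ ζ))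
      map_add' := fun a b => by
        rw [map_add, map_add]
        exact map_add p.2 _ _
      map_smul' := fun r a => by
        rw [map_smul, map_smul]
        exact map_smul p.2 _ _ }

/-- The identity `j(x)` of `T*G` at `x ∈ 𝔤*`: the covector `x` at the neutral element. -/
def cotangentUnit (φ : 𝔤 ≃ₗ⁅ℝ⁆ GroupLieAlgebra 𝓘(ℝ, E) G) (x : StrongDual ℝ 𝔤) :
    CotangentBundle E G :=
  ⟨1, (LinearMap.toContinuousLinearMap
    ((x : 𝔤 →ₗ[ℝ] ℝ) ∘ₗ (φ.symm : GroupLieAlgebra 𝓘(ℝ, E) G →ₗ[ℝ] 𝔤) : E →ₗ[ℝ] ℝ) :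
      E →L[ℝ] ℝ)⟩

/-- The product `(g, a) • (h, b) = (g h, (dR_h(g)^*)⁻¹ a)` of `T*G`, to be used only if
`r(g, a) = l(h, b)`. -/
def cotangentMul (p q : CotangentBundle E G) : CotangentBundle E G :=
  ⟨p.1 * q.1, ContinuousLinearMap.comp (p.2 : TangentSpace 𝓘(ℝ, E) p.1 →L[ℝ] ℝ)
    (mfderiv 𝓘(ℝ, E) 𝓘(ℝ, E) (fun x : G => x * q.1) p.1).inverse⟩

end CotangentGroupoid

end

/-! Parallel transport trivializes the constraint. For a path `η` in the Lie algebra let h be the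
curve with h(0) = 1 and h⁻¹dh = η, and hol(η) = h(1). Then X(u) = Ad*(h(u)) X(0) solves dX + α(X)η =
0 (`solvePath_eq`). A solution is thus a point X(0) together with an arbitrary path `η`, and the
quotient is known once gauge equivalence is shown to be equality of X(0) and of the holonomy
(`phaseClass_eq_iff`).

Invariance of the holonomy: if δη = db + [η, b], then d(Ad(h)b) = Ad(h)δη. The left logarithmic
derivative of hol in the direction δη is Ad(hol)⁻¹ ∫ Ad(h)δη, which is therefore b(1) when b(0) = 0,
and vanishes when also b(1) = 0. The same computation on [0,u] shows that the flow of a parameter b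
independent of X multiplies h(u) on the right by exp b(u).

Conversely, let two paths have the same holonomy. Since G is simply connected, their curves in G are
homotopic with fixed ends. An intermediate curve of the homotopy is only continuous, but it is a
uniform limit of gauge transforms: the logarithm of the quotient of neighbouring curves vanishes at
both ends, and its Bernstein polynomials are admissible gauge parameters. Small steps along the
homotopy lead close to the final curve, where the logarithm of the quotient is itself continuously
differentiable and one more gauge step is exact (`reflTransGen_gaugeStep`).

Smoothness: near 0 the curve h depends smoothly on `η` by the inverse function theorem in the space
of paths (`exists_local_logPath`), and hol(ζ + δ) = hol(Ad(h)δ) hol(ζ) moves any base point to 0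
(`hol_add`). The map from solutions to T*G has smooth local sections
(`exists_section_cotangentOfPath`). Hence the bijection of the quotient with T*G is a homeomorphism,
the manifold structure can be transported along it, and the projection is a submersion.

A point of T*G is determined by its left projection and its base point, so the groupoid operations
are compared on these two data; holonomies multiply under concatenation. The Liouville form pulls
back to ∫⟨X, δη⟩, because the right-translated derivative of hol is ∫ Ad(h)δη and ⟨X(0), Ad(h)δη⟩ =
⟨X, δη⟩ (`liouvilleForm_cotangentOfPath`). Its exterior derivative is ω.

Calculus in G goes through `HasLogFDerivWithinAt`: translating back to 1 before taking coordinates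
needs a single chart and gives derivatives with values in the fixed space `E`. -/

noncomputable section

set_option linter.unusedSectionVars false

universe u v

/-! ### Calculus on path spaces and the inverse function theorem -/

namespace PathSpace

variable {A B C : Type*} [NormedAddCommGroup A] [NormedSpace ℝ A] [NormedAddCommGroup B]
  [NormedSpace ℝ B] [NormedAddCommGroup C] [NormedSpace ℝ C]

/-- The pointwise application of a continuous bilinear map to two paths. -/
def bilinL (b : A →L[ℝ] B →L[ℝ] C) : PathSpace A →L[ℝ] PathSpace B →L[ℝ] PathSpace C :=
  LinearMap.mkContinuous₂
    (LinearMap.mk₂ ℝ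
      (fun (f : PathSpace A) (g : PathSpace B) =>
        PathSpace.mk (fun u => b (f u) (g u)) (by
          have h1 := f.continuous
          have h2 := g.continuous
          fun_prop))
      (by intros; ext; simp) (by intros; ext; simp)
      (by intros; ext; simp) (by intros; ext; simp))
    ‖b‖
    (by
      intro f g
      refine PathSpace.norm_le (by positivity) fun u => (b.le_opNorm₂ _ _).trans ?_
      gcongr
      · exact f.norm_apply_le u
      · exact g.norm_apply_le u)

@[simp] theorem bilinL_apply (b : A →L[ℝ] B →L[ℝ] C) (f : PathSpace A) (g : PathSpace B)
    (u : unitInterval) : bilinL b f g u = b (f u) (g u) := rfl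

/-- The pointwise application of a continuous linear map to a path. -/
def mapL (L : A →L[ℝ] B) : PathSpace A →L[ℝ] PathSpace B :=
  LinearMap.mkContinuous
    { toFun := fun f => PathSpace.mk (fun u => L (f u)) (L.continuous.comp f.continuous)
      map_add' := by intros; ext; simp
      map_smul' := by intros; ext; simp }
    ‖L‖
    (by
      intro f
      refine PathSpace.norm_le (by positivity) fun u => (L.le_opNorm _).trans ?_
      gcongr
      exact f.norm_apply_le u)

@[simp] theorem mapL_apply (L : A →L[ℝ] B) (f : PathSpace A) (u : unitInterval) :
    mapL L f u = L (f u) := rfl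

/-- Precomposition of paths with a continuous map of the interval. -/
def reparamL (τ : C(unitInterval, unitInterval)) : PathSpace A →L[ℝ] PathSpace A :=
  LinearMap.mkContinuous
    { toFun := fun f => PathSpace.mk (fun u => f (τ u)) (f.continuous.comp τ.continuous)
      map_add' := by intros; ext; simp
      map_smul' := by intros; ext; simp }
    1
    (by
      intro f
      refine PathSpace.norm_le (by positivity) fun u => ?_
      rw [one_mul]
      exact f.norm_apply_le _)

@[simp] theorem reparamL_apply (τ : C(unitInterval, unitInterval)) (f : PathSpace A)
    (u : unitInterval) : reparamL τ f u = f (τ u) := rfl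

theorem continuous_comp_left {f : A → B} (hf : Continuous f) :
    Continuous fun y : PathSpace A => PathSpace.mk (fun u => f (y u)) (hf.comp y.continuous) :=
  ContinuousMap.continuous_postcomp (⟨f, hf⟩ : C(A, B))

/-- The mean value inequality at each time u. The bound on the variation of `fderiv ℝ f` is uniform
in u because composition with `fderiv ℝ f` is continuous for the supremum norm. -/
theorem hasFDerivAt_comp_left {f : A → B} (hf : ContDiff ℝ 1 f) (y : PathSpace A) :
    HasFDerivAt
      (fun y : PathSpace A => PathSpace.mk (fun u => f (y u)) (hf.continuous.comp y.continuous))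
      (bilinL (ContinuousLinearMap.id ℝ (A →L[ℝ] B))
        (PathSpace.mk (fun u => fderiv ℝ f (y u))
          ((hf.continuous_fderiv one_ne_zero).comp y.continuous))) y := by
  rw [hasFDerivAt_iff_isLittleO, Asymptotics.isLittleO_iff]
  intro ε hε
  have hc := (continuous_comp_left (hf.continuous_fderiv one_ne_zero)).continuousAt (x := y)
  obtain ⟨δ, hδ, h⟩ := Metric.continuousAt_iff.1 hc ε hε
  filter_upwards [Metric.ball_mem_nhds y hδ] with y' hy'
  refine norm_le (by positivity) fun u => ?_
  have h1 : ∀ z ∈ Metric.ball (y u) δ, ‖fderiv ℝ f z - fderiv ℝ f (y u)‖ ≤ ε := by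
    intro z hz
    -- The translate of `y` by a constant that passes through `z` at time `u` is a test path, so `δ`
    -- does not depend on `u`.
    have h2 : dist (y + constL A (z - y u)) y < δ := by
      rw [dist_eq_norm, add_sub_cancel_left]
      refine lt_of_le_of_lt (norm_le (norm_nonneg (z - y u)) fun v => ?_) (mem_ball_iff_norm.1 hz)
      simp
    have h3 := h h2
    rw [dist_eq_norm] at h3
    refine le_trans ?_ h3.le
    refine le_trans (le_of_eq ?_) (norm_apply_le _ u)
    simp
  have h4 := (convex_ball (y u) δ).norm_image_sub_le_of_norm_hasFDerivWithin_le'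
    (f := f) (fun z _ => ((hf.differentiable one_ne_zero) z).hasFDerivAt.hasFDerivWithinAt) h1
    (Metric.mem_ball_self hδ) (y := y' u) (by
      rw [mem_ball_iff_norm]
      exact ((y' - y).norm_apply_le u).trans_lt (mem_ball_iff_norm.1 hy'))
  refine h4.trans ?_
  gcongr
  exact (y' - y).norm_apply_le u

/-- Induction on the order: the derivative is composition with `fderiv ℝ f`, followed by a bounded
linear map. The codomain changes to `A →L[ℝ] B`, so it is quantified inside the induction and lives
in a universe closed under this operation. -/
theorem contDiff_comp_left_nat {A : Type u} [NormedAddCommGroup A] [NormedSpace ℝ A] (n : ℕ) :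
    ∀ {B : Type (max u v)} [NormedAddCommGroup B] [NormedSpace ℝ B] {f : A → B}
      (hf : ContDiff ℝ ∞ f), ContDiff ℝ n (fun y : PathSpace A =>
        PathSpace.mk (fun u => f (y u)) (hf.continuous.comp y.continuous)) := by
  induction n with
  | zero =>
    intro B _ _ f hf
    exact contDiff_zero.2 (continuous_comp_left hf.continuous)
  | succ n ih =>
    intro B _ _ f hf
    have h1 : ContDiff ℝ 1 f := hf.of_le (by exact_mod_cast le_top)
    have hf' : ContDiff ℝ ∞ (fderiv ℝ f) := hf.fderiv_right (m := ∞) (by simp)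
    refine contDiff_succ_iff_hasFDerivAt.2 ⟨_, ?_, fun y => hasFDerivAt_comp_left h1 y⟩
    exact (bilinL (ContinuousLinearMap.id ℝ (A →L[ℝ] B))).contDiff.comp (ih hf')

theorem contDiff_comp_left {A : Type u} [NormedAddCommGroup A] [NormedSpace ℝ A]
    {B : Type (max u v)} [NormedAddCommGroup B] [NormedSpace ℝ B] {f : A → B}
    (hf : ContDiff ℝ ∞ f) : ContDiff ℝ ∞ (fun y : PathSpace A =>
        PathSpace.mk (fun u => f (y u)) (hf.continuous.comp y.continuous)) :=
  contDiff_infty.2 fun n => contDiff_comp_left_nat.{u, v} n hf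

variable [CompleteSpace A]

/-- The primitive of a path is differentiable. -/
theorem hasDerivWithinAt_integrateL (f : PathSpace A) (u : unitInterval) :
    HasDerivWithinAt (fun t : ℝ => ∫ s in (0 : ℝ)..t, f (projIcc 0 1 zero_le_one s)) (f u)
      (Icc 0 1) (u : ℝ) := by
  have hcont := f.continuous_ext
  have := intervalIntegral.integral_hasDerivAt_right (hcont.intervalIntegrable 0 (u : ℝ))
      (hcont.stronglyMeasurableAtFilter _ _) hcont.continuousAt
  rw [projIcc_val] at this
  exact this.hasDerivWithinAt

end PathSpace

/-- The inverse function theorem, with smoothness on the whole domain and range. -/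
theorem exists_openPartialHomeomorph_contDiffOn {V W : Type*} [NormedAddCommGroup V]
    [NormedSpace ℝ V] [CompleteSpace V] [NormedAddCommGroup W] [NormedSpace ℝ W] {f : V → W}
    {a : V} {U : Set V} (hU : IsOpen U) (ha : a ∈ U) (hf : ContDiffOn ℝ ∞ f U) (e : V ≃L[ℝ] W)
    (he : HasFDerivAt f (e : V →L[ℝ] W) a) :
    ∃ Θ : OpenPartialHomeomorph V W, a ∈ Θ.source ∧ Θ.source ⊆ U ∧ (∀ x, Θ x = f x) ∧
      ContDiffOn ℝ ∞ Θ Θ.source ∧ ContDiffOn ℝ ∞ Θ.symm Θ.target := by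
  have hfa : ContDiffAt ℝ ∞ f a := hf.contDiffAt (hU.mem_nhds ha)
  set Θ₀ := hfa.toOpenPartialHomeomorph f he (by simp) with hΘ₀
  have hd : ContinuousOn (fderiv ℝ f) U := hf.continuousOn_fderiv_of_isOpen hU (by simp)
  -- Restricting to the open set where the derivative is invertible makes the inverse smooth on the
  -- whole target, not only near the image of `a`.
  set S : Set V := U ∩ fderiv ℝ f ⁻¹' range ((↑) : (V ≃L[ℝ] W) → V →L[ℝ] W) with hS
  have hSo : IsOpen S := hd.isOpen_inter_preimage hU ContinuousLinearEquiv.isOpen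
  have haS : a ∈ S := ⟨ha, e, he.fderiv.symm⟩
  have hcoe : ∀ x, Θ₀ x = f x := fun x => by
    rw [hΘ₀, ContDiffAt.toOpenPartialHomeomorph_coe]
  refine ⟨Θ₀.restrOpen S hSo, ?_, ?_, ?_, ?_, ?_⟩
  · rw [OpenPartialHomeomorph.restrOpen_source]
    exact ⟨hfa.mem_toOpenPartialHomeomorph_source he (by simp), haS⟩
  · rw [OpenPartialHomeomorph.restrOpen_source]
    exact fun x hx => hx.2.1
  · exact hcoe
  · rw [OpenPartialHomeomorph.restrOpen_source]
    refine (hf.mono fun x hx => hx.2.1).congr fun x _ => hcoe x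
  · intro y hy
    set Θ := Θ₀.restrOpen S hSo with hΘ
    have hx : Θ.symm y ∈ Θ.source := Θ.map_target hy
    rw [hΘ, OpenPartialHomeomorph.restrOpen_source] at hx
    obtain ⟨e', he'⟩ := hx.2.2
    have hUx : U ∈ 𝓝 (Θ.symm y) := hU.mem_nhds hx.2.1
    have hfx : ContDiffAt ℝ ∞ f (Θ.symm y) := hf.contDiffAt hUx
    have hΘf : (Θ : V → W) = f := funext hcoe
    refine (Θ.contDiffAt_symm (f₀' := e') hy ?_ (by rw [hΘf]; exact hfx)).contDiffWithinAt
    rw [hΘf, he']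
    exact (hfx.differentiableAt (by simp)).hasFDerivAt

/-! ### Logarithmic derivatives of maps into a Lie group -/

section LieCalculus

variable {E G : Type*} [NormedAddCommGroup E] [NormedSpace ℝ E]
  [TopologicalSpace G] [ChartedSpace E G] [Group G]
  {V W : Type*} [NormedAddCommGroup V] [NormedSpace ℝ V] [NormedAddCommGroup W] [NormedSpace ℝ W]

local notation "ψ" => chartAt E (1 : G)
local notation "e₀" => chartAt E (1 : G) (1 : G)

variable (E) in
/-- The adjoint action of a Lie group on its tangent space at the neutral element, in the
coordinates of the preferred chart. -/
def groupAd (g : G) : E →L[ℝ] E :=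
  fderiv ℝ (fun y => ψ (g * (ψ).symm y * g⁻¹)) e₀

/-- The map `f` with values in a Lie group has left logarithmic derivative `L` at `x`. -/
structure HasLogFDerivWithinAt (f : V → G) (L : V →L[ℝ] E) (s : Set V) (x : V) : Prop where
  continuousWithinAt : ContinuousWithinAt f s x
  hasFDerivWithinAt : HasFDerivWithinAt (fun y => ψ ((f x)⁻¹ * f y)) L s x

theorem chart_symm_one : (ψ).symm e₀ = 1 := (ψ).left_inv (mem_chart_source E _)

theorem chart_one_mem_target : e₀ ∈ (ψ).target := (ψ).map_source (mem_chart_source E _)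

variable [LieGroup 𝓘(ℝ, E) ∞ G]

theorem contDiffAt_chart_comp {g : V → G} {x : V} (hg : ContMDiffAt 𝓘(ℝ, V) 𝓘(ℝ, E) ∞ g x)
    (hx : g x ∈ (ψ).source) : ContDiffAt ℝ ∞ (fun y => ψ (g y)) x :=
  contMDiffAt_iff_contDiffAt.1 ((contMDiffAt_of_mem_maximalAtlas
    (IsManifold.chart_mem_maximalAtlas (I := 𝓘(ℝ, E)) (n := ∞) (1 : G)) hx).comp x hg)

theorem contMDiffAt_chart_symm {y : E} (hy : y ∈ (ψ).target) :
    ContMDiffAt 𝓘(ℝ, E) 𝓘(ℝ, E) ∞ (ψ).symm y :=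
  contMDiffAt_symm_of_mem_maximalAtlas
    (IsManifold.chart_mem_maximalAtlas (I := 𝓘(ℝ, E)) (n := ∞) (1 : G)) hy

theorem contMDiffAt_chart_symm_one : ContMDiffAt 𝓘(ℝ, E) 𝓘(ℝ, E) ∞ (ψ).symm e₀ :=
  contMDiffAt_chart_symm chart_one_mem_target

/-- Multiplication in coordinates. -/
theorem contDiffAt_chartMul {p : E × E} (h1 : p.1 ∈ (ψ).target) (h2 : p.2 ∈ (ψ).target)
    (h : (ψ).symm p.1 * (ψ).symm p.2 ∈ (ψ).source) :
    ContDiffAt ℝ ∞ (fun p : E × E => ψ ((ψ).symm p.1 * (ψ).symm p.2)) p := by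
  refine contDiffAt_chart_comp ?_ h
  have A := (contMDiffAt_chart_symm h1).comp p
    (contDiffAt_fst (𝕜 := ℝ) (E := E) (F := E) (n := ∞)).contMDiffAt
  have B := (contMDiffAt_chart_symm h2).comp p
    (contDiffAt_snd (𝕜 := ℝ) (E := E) (F := E) (n := ∞)).contMDiffAt
  exact A.mul B

/-- Multiplication restricts to the identity on each factor when the other argument is neutral,
which determines both partial derivatives. -/
theorem hasFDerivAt_chartMul :
    HasFDerivAt (fun p : E × E => ψ ((ψ).symm p.1 * (ψ).symm p.2))
      (ContinuousLinearMap.fst ℝ E E + ContinuousLinearMap.snd ℝ E E) (e₀, e₀) := by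
  have h := ((contDiffAt_chartMul (G := G) (p := (e₀, e₀)) chart_one_mem_target
    chart_one_mem_target (by
      simp only [chart_symm_one, mul_one]
      exact mem_chart_source E _)).differentiableAt (by simp)).hasFDerivAt
  set M := fderiv ℝ (fun p : E × E => ψ ((ψ).symm p.1 * (ψ).symm p.2)) (e₀, e₀)
  have h1 : M.comp (ContinuousLinearMap.inl ℝ E E) = ContinuousLinearMap.id ℝ E := by
    have A := HasFDerivAt.comp (f := fun e => (e, e₀)) e₀ h (hasFDerivAt_prodMk_left (𝕜 := ℝ) (e₀ : E) (e₀ : E))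
    refine A.unique ((hasFDerivAt_id (𝕜 := ℝ) e₀).congr_of_eventuallyEq ?_)
    filter_upwards [chart_target_mem_nhds E (1 : G)] with x hx
    simp [(ψ).right_inv hx]
  have h2 : M.comp (ContinuousLinearMap.inr ℝ E E) = ContinuousLinearMap.id ℝ E := by
    have A := HasFDerivAt.comp (f := fun e => (e₀, e)) e₀ h (hasFDerivAt_prodMk_right (𝕜 := ℝ) (e₀ : E) (e₀ : E))
    refine A.unique ((hasFDerivAt_id (𝕜 := ℝ) e₀).congr_of_eventuallyEq ?_)
    filter_upwards [chart_target_mem_nhds E (1 : G)] with x hx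
    simp [(ψ).right_inv hx]
  refine h.congr_fderiv (ContinuousLinearMap.ext fun p => ?_)
  have h3 : M (p.1, 0) = p.1 := congrArg (fun L => L p.1) h1
  have h4 : M (0, p.2) = p.2 := congrArg (fun L => L p.2) h2
  have h5 : p = (p.1, 0) + (0, p.2) := by simp
  conv_lhs => rw [h5, map_add, h3, h4]
  rfl

theorem contMDiffAt_conj (g : G) {y : E} (hy : y ∈ (ψ).target) :
    ContMDiffAt 𝓘(ℝ, E) 𝓘(ℝ, E) ∞ (fun y => g * (ψ).symm y * g⁻¹) y :=
  ((contMDiffAt_const (c := g)).mul (contMDiffAt_chart_symm hy)).mul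
    (contMDiffAt_const (c := g⁻¹))

theorem hasFDerivAt_groupAd (g : G) :
    HasFDerivAt (fun y => ψ (g * (ψ).symm y * g⁻¹)) (groupAd E g) e₀ :=
  ((contDiffAt_chart_comp (contMDiffAt_conj g chart_one_mem_target) (by
    rw [chart_symm_one, mul_one, mul_inv_cancel]
    exact mem_chart_source E _)).differentiableAt (by simp)).hasFDerivAt

theorem chart_eventually_eq {f : V → G} {s : Set V} {x : V} (hf : ContinuousWithinAt f s x)
    (c : G → G) (hc : Continuous c) (h1 : c (f x) = 1) : ∀ᶠ y in 𝓝[s] x, c (f y) ∈ (ψ).source := by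
  have h : Filter.Tendsto (fun y => c (f y)) (𝓝[s] x) (𝓝 1) := by
    have := hc.continuousAt.comp_continuousWithinAt hf
    rwa [ContinuousWithinAt, Function.comp_apply, h1] at this
  exact h.eventually_mem (chart_source_mem_nhds E (1 : G))

theorem groupAd_one : groupAd E (1 : G) = ContinuousLinearMap.id ℝ E := by
  refine (hasFDerivAt_groupAd (1 : G)).unique
    ((hasFDerivAt_id (𝕜 := ℝ) e₀).congr_of_eventuallyEq ?_)
  filter_upwards [chart_target_mem_nhds E (1 : G)] with x hx
  simp [(ψ).right_inv hx]

theorem groupAd_mul (g h : G) : groupAd E (g * h) = (groupAd E g).comp (groupAd E h) := by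
  have := topologicalGroup_of_lieGroup 𝓘(ℝ, E) ∞ (G := G)
  have h1 : ψ (h * (ψ).symm e₀ * h⁻¹) = e₀ := by rw [chart_symm_one]; simp
  have A := HasFDerivAt.comp e₀ (by rw [h1]; exact hasFDerivAt_groupAd (E := E) g)
    (hasFDerivAt_groupAd (E := E) h)
  refine (hasFDerivAt_groupAd (g * h)).unique (A.congr_of_eventuallyEq ?_)
  have hs : ContinuousAt (ψ).symm e₀ := (ψ).continuousAt_symm chart_one_mem_target
  have := chart_eventually_eq (E := E) (s := univ) hs.continuousWithinAt (fun x => h * x * h⁻¹)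
    (by fun_prop) (by rw [chart_symm_one]; group)
  rw [nhdsWithin_univ] at this
  filter_upwards [this] with y hy
  simp only [Function.comp_apply]
  rw [(ψ).left_inv hy]
  group

theorem groupAd_inv_apply (g : G) (v : E) : groupAd E g⁻¹ (groupAd E g v) = v := by
  have := congrArg (fun L => L v) (groupAd_mul (E := E) g⁻¹ g)
  simpa [groupAd_one] using this.symm

theorem groupAd_apply_inv (g : G) (v : E) : groupAd E g (groupAd E g⁻¹ v) = v := by
  have := congrArg (fun L => L v) (groupAd_mul (E := E) g g⁻¹)
  simpa [groupAd_one] using this.symm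

namespace HasLogFDerivWithinAt

variable {f k : V → G} {L K : V →L[ℝ] E} {s t : Set V} {x : V}

theorem mono (hf : HasLogFDerivWithinAt f L s x) (h : t ⊆ s) : HasLogFDerivWithinAt f L t x :=
  ⟨hf.1.mono h, hf.2.mono h⟩

theorem congr (hf : HasLogFDerivWithinAt f L s x) (h : ∀ y ∈ s, k y = f y) (hx : k x = f x) :
    HasLogFDerivWithinAt k L s x :=
  ⟨hf.1.congr h hx, hf.2.congr (fun y hy => by simp only [h y hy, hx]) (by rw [hx])⟩

theorem const (g : G) : HasLogFDerivWithinAt (fun _ : V => g) (0 : V →L[ℝ] E) s x :=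
  ⟨continuousWithinAt_const, hasFDerivWithinAt_const _ _ _⟩

theorem comp {τ : W → V} {T : W →L[ℝ] V} {t : Set W} {w : W}
    (hf : HasLogFDerivWithinAt f L s (τ w)) (hτ : HasFDerivWithinAt τ T t w)
    (h : MapsTo τ t s) : HasLogFDerivWithinAt (fun w => f (τ w)) (L.comp T) t w :=
  ⟨hf.1.comp hτ.continuousWithinAt h, hf.2.comp w hτ h⟩

/-- With a = f(x)⁻¹f(y) and b = k(x)⁻¹k(y), the quotient (f(x)k(x))⁻¹f(y)k(y) equals (k(x)⁻¹ a k(x))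
b. The conjugation contributes `groupAd`, and the product of two elements near 1 contributes a sum.
-/
theorem mul (hf : HasLogFDerivWithinAt f L s x) (hk : HasLogFDerivWithinAt k K s x) :
    HasLogFDerivWithinAt (fun y => f y * k y) ((groupAd E (k x)⁻¹).comp L + K) s x := by
  have := topologicalGroup_of_lieGroup 𝓘(ℝ, E) ∞ (G := G)
  refine ⟨hf.1.mul hk.1, ?_⟩
  have A : HasFDerivWithinAt (fun y => ψ ((k x)⁻¹ * (ψ).symm (ψ ((f x)⁻¹ * f y)) * (k x)⁻¹⁻¹))
      ((groupAd E (k x)⁻¹).comp L) s x := by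
    refine HasFDerivAt.comp_hasFDerivWithinAt (f := fun y => ψ ((f x)⁻¹ * f y))
      (g := fun y => ψ ((k x)⁻¹ * (ψ).symm y * (k x)⁻¹⁻¹)) x ?_ hf.2
    simp only [inv_mul_cancel]
    exact hasFDerivAt_groupAd (k x)⁻¹
  have B := HasFDerivAt.comp_hasFDerivWithinAt x
    (g := fun p : E × E => ψ ((ψ).symm p.1 * (ψ).symm p.2))
    (g' := ContinuousLinearMap.fst ℝ E E + ContinuousLinearMap.snd ℝ E E) (by
      simp only [inv_mul_cancel, chart_symm_one, mul_one, mul_inv_cancel]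
      exact hasFDerivAt_chartMul) (A.prodMk hk.2)
  have e1 := chart_eventually_eq (E := E) hf.1 (fun z => (f x)⁻¹ * z) (by fun_prop) (by group)
  have e2 := chart_eventually_eq (E := E) hk.1 (fun z => (k x)⁻¹ * z) (by fun_prop) (by group)
  have e3 := chart_eventually_eq (E := E) hf.1 (fun z => (k x)⁻¹ * ((f x)⁻¹ * z) * (k x)⁻¹⁻¹)
    (by fun_prop) (by group)
  have e : (fun y => ψ ((f x * k x)⁻¹ * (f y * k y))) =ᶠ[𝓝[s] x]
      (fun p : E × E => ψ ((ψ).symm p.1 * (ψ).symm p.2)) ∘ fun y =>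
        (ψ ((k x)⁻¹ * (ψ).symm (ψ ((f x)⁻¹ * f y)) * (k x)⁻¹⁻¹), ψ ((k x)⁻¹ * k y)) := by
    filter_upwards [e1, e2, e3] with y h1 h2 h3
    simp only [Function.comp_apply]
    rw [(ψ).left_inv h1, (ψ).left_inv h2, (ψ).left_inv h3]
    group
  refine (B.congr_of_eventuallyEq e ?_).congr_fderiv ?_
  · simp
  · ext v
    simp

theorem const_mul (g : G) (hf : HasLogFDerivWithinAt f L s x) :
    HasLogFDerivWithinAt (fun y => g * f y) L s x := by
  have := (const (E := E) (s := s) (x := x) g).mul hf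
  simpa using this

theorem mul_const (hf : HasLogFDerivWithinAt f L s x) (g : G) :
    HasLogFDerivWithinAt (fun y => f y * g) ((groupAd E g⁻¹).comp L) s x := by
  have := hf.mul (const (E := E) (s := s) (x := x) g)
  simpa using this

theorem unique (hs : UniqueDiffWithinAt ℝ s x) (hf : HasLogFDerivWithinAt f L s x)
    (hk : HasLogFDerivWithinAt f K s x) : L = K := hs.eq hf.2 hk.2

end HasLogFDerivWithinAt

end LieCalculus

/-! ### Translations, the adjoint action and its derivative -/

section LieDerivatives

variable {E G : Type*} [NormedAddCommGroup E] [NormedSpace ℝ E]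
  [TopologicalSpace G] [ChartedSpace E G] [Group G]
  {V W : Type*} [NormedAddCommGroup V] [NormedSpace ℝ V] [NormedAddCommGroup W] [NormedSpace ℝ W]

local notation "ψ" => chartAt E (1 : G)
local notation "e₀" => chartAt E (1 : G) (1 : G)

variable (E) in
/-- The derivative of a left translation at the neutral element. -/
def leftDeriv (g : G) : E →L[ℝ] E := mfderiv 𝓘(ℝ, E) 𝓘(ℝ, E) (fun x : G => g * x) 1

variable (E) in
/-- The derivative of a right translation at the neutral element. -/
def rightDeriv (g : G) : E →L[ℝ] E := mfderiv 𝓘(ℝ, E) 𝓘(ℝ, E) (fun x : G => x * g) 1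

variable [LieGroup 𝓘(ℝ, E) ∞ G]

theorem hasMFDerivAt_leftDeriv (g : G) :
    HasMFDerivAt 𝓘(ℝ, E) 𝓘(ℝ, E) (fun x : G => g * x) 1 (leftDeriv E g) :=
  ((contMDiff_mul_left (I := 𝓘(ℝ, E)) (n := ∞) (a := g)).mdifferentiable (by simp) 1).hasMFDerivAt

theorem hasMFDerivAt_rightDeriv (g : G) :
    HasMFDerivAt 𝓘(ℝ, E) 𝓘(ℝ, E) (fun x : G => x * g) 1 (rightDeriv E g) :=
  ((contMDiff_mul_right (I := 𝓘(ℝ, E)) (n := ∞) (a := g)).mdifferentiable (by simp)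
    1).hasMFDerivAt

theorem hasMFDerivAt_chart_one :
    HasMFDerivAt 𝓘(ℝ, E) 𝓘(ℝ, E) ψ (1 : G) (ContinuousLinearMap.id ℝ E) := by
  have h := hasMFDerivAt_extChartAt (I := 𝓘(ℝ, E)) (mem_chart_source E (1 : G))
  have h1 : mfderiv 𝓘(ℝ, E) 𝓘(ℝ, E) (extChartAt 𝓘(ℝ, E) (1 : G)) 1 = _ := mfderiv_extChartAt_self
  have h2 := (mdifferentiableAt_extChartAt (I := 𝓘(ℝ, E))
    (mem_chart_source E (1 : G))).hasMFDerivAt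
  rw [h1] at h2
  exact h2

theorem hasMFDerivAt_mul_chart_symm (g : G) :
    HasMFDerivAt 𝓘(ℝ, E) 𝓘(ℝ, E) (fun y => g * (ψ).symm y) e₀ (leftDeriv E g) := by
  have h1 : HasMFDerivAt 𝓘(ℝ, E) 𝓘(ℝ, E) (fun y => g * (ψ).symm y) e₀ _ :=
    (((contMDiffAt_const (c := g)).mul contMDiffAt_chart_symm_one).mdifferentiableAt
      (by simp)).hasMFDerivAt
  refine h1.congr_mfderiv ?_
  have h2 := HasMFDerivAt.comp (1 : G) h1 hasMFDerivAt_chart_one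
  have h3 : (fun x : G => g * x) =ᶠ[𝓝 1] (fun y => g * (ψ).symm y) ∘ ψ := by
    filter_upwards [chart_source_mem_nhds E (1 : G)] with x hx
    simp [(ψ).left_inv hx]
  have h4 := hasMFDerivAt_unique (h2.congr_of_eventuallyEq h3) (hasMFDerivAt_leftDeriv g)
  exact h4

/-- The maps z ↦ ψ(g⁻¹z) and y ↦ g ψ⁻¹(y) are mutually inverse near `g` and its image, so their
derivatives are inverse to each other. -/
theorem hasFDerivAt_chart_inv_mul (g : G) :
    HasMFDerivAt 𝓘(ℝ, E) 𝓘(ℝ, E) (fun z : G => ψ (g⁻¹ * z)) g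
      (leftDeriv E g).inverse ∧ (leftDeriv E g).IsInvertible := by
  have h0 : ContMDiffAt 𝓘(ℝ, E) 𝓘(ℝ, E) ∞ (fun z : G => ψ (g⁻¹ * z)) g := by
    refine ContMDiffAt.comp (I' := 𝓘(ℝ, E)) (g := ψ) (f := fun z => g⁻¹ * z) g ?_
      (contMDiff_mul_left (a := g⁻¹)).contMDiffAt
    rw [inv_mul_cancel]
    exact contMDiffAt_of_mem_maximalAtlas
      (IsManifold.chart_mem_maximalAtlas (I := 𝓘(ℝ, E)) (n := ∞) (1 : G)) (mem_chart_source E _)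
  have h1 := (h0.mdifferentiableAt (by simp)).hasMFDerivAt
  set D : E →L[ℝ] E := mfderiv 𝓘(ℝ, E) 𝓘(ℝ, E) (fun z : G => ψ (g⁻¹ * z)) g with hD
  have h1' : HasMFDerivAt 𝓘(ℝ, E) 𝓘(ℝ, E) (fun z : G => ψ (g⁻¹ * z)) (g * (ψ).symm e₀) D := by
    rw [chart_symm_one, mul_one]
    exact h1
  have h2 : HasMFDerivAt 𝓘(ℝ, E) 𝓘(ℝ, E)
      ((fun z : G => ψ (g⁻¹ * z)) ∘ fun y => g * (ψ).symm y) e₀ (D.comp (leftDeriv E g)) :=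
    HasMFDerivAt.comp e₀ h1' (hasMFDerivAt_mul_chart_symm g)
  have h3 : D.comp (leftDeriv E g) = ContinuousLinearMap.id ℝ E := by
    have h5 : ((fun z : G => ψ (g⁻¹ * z)) ∘ fun y => g * (ψ).symm y) =ᶠ[𝓝 e₀] id := by
      filter_upwards [chart_target_mem_nhds E (1 : G)] with x hx
      simp [(ψ).right_inv hx]
    have h6 := hasMFDerivAt_unique h2 ((hasMFDerivAt_id e₀).congr_of_eventuallyEq h5)
    exact h6
  have h4 : (leftDeriv E g).comp D = ContinuousLinearMap.id ℝ E := by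
    have hk : HasMFDerivAt 𝓘(ℝ, E) 𝓘(ℝ, E) (fun y => g * (ψ).symm y) (ψ (g⁻¹ * g))
        (leftDeriv E g) := by
      rw [inv_mul_cancel]
      exact hasMFDerivAt_mul_chart_symm g
    have h5 := HasMFDerivAt.comp g hk h1
    have := topologicalGroup_of_lieGroup 𝓘(ℝ, E) ∞ (G := G)
    have h6 : (fun y => g * (ψ).symm y) ∘ (fun z : G => ψ (g⁻¹ * z)) =ᶠ[𝓝 g] id := by
      have hc : Filter.Tendsto (fun z : G => g⁻¹ * z) (𝓝 g) (𝓝 1) := by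
        have : Continuous fun z : G => g⁻¹ * z := by fun_prop
        simpa using this.tendsto g
      filter_upwards [hc.eventually_mem (chart_source_mem_nhds E (1 : G))] with z hz
      simp [(ψ).left_inv hz]
    have h7 := hasMFDerivAt_unique (h5.congr_of_eventuallyEq h6.symm) (hasMFDerivAt_id g)
    exact h7
  have h5 : (leftDeriv E g).inverse = D := ContinuousLinearMap.inverse_eq h4 h3
  rw [h5]
  exact ⟨h1, ContinuousLinearMap.IsInvertible.of_inverse h4 h3⟩

/-- The bridge to derivatives on manifolds: left translation by `f x` is invertible, so no
information is lost by translating back to 1. -/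
theorem hasLogFDerivWithinAt_iff {f : V → G} {L : V →L[ℝ] E} {s : Set V} {x : V} :
    HasLogFDerivWithinAt f L s x ↔
      HasMFDerivWithinAt 𝓘(ℝ, V) 𝓘(ℝ, E) f s x ((leftDeriv E (f x)).comp L) := by
  have := topologicalGroup_of_lieGroup 𝓘(ℝ, E) ∞ (G := G)
  constructor
  · intro h
    have h1 : HasMFDerivAt 𝓘(ℝ, E) 𝓘(ℝ, E) (fun y => f x * (ψ).symm y) (ψ ((f x)⁻¹ * f x))
        (leftDeriv E (f x)) := by
      rw [inv_mul_cancel]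
      exact hasMFDerivAt_mul_chart_symm (f x)
    have h2 := HasMFDerivAt.comp_hasMFDerivWithinAt x h1 h.2.hasMFDerivWithinAt
    refine h2.congr_of_eventuallyEq ?_ (by simp)
    filter_upwards [chart_eventually_eq (E := E) h.1 (fun z => (f x)⁻¹ * z) (by fun_prop)
      (by group)] with y hy
    simp [(ψ).left_inv hy]
  · intro h
    refine ⟨h.1, ?_⟩
    obtain ⟨h1, h2⟩ := hasFDerivAt_chart_inv_mul (E := E) (f x)
    have h3 := (HasMFDerivAt.comp_hasMFDerivWithinAt x h1 h).hasFDerivWithinAt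
    refine h3.congr_fderiv (ContinuousLinearMap.ext fun v => ?_)
    exact h2.inverse_apply_eq.2 rfl

theorem HasLogFDerivWithinAt.hasMFDerivAt {f : V → G} {L : V →L[ℝ] E} {x : V}
    (h : HasLogFDerivWithinAt f L univ x) :
    HasMFDerivAt 𝓘(ℝ, V) 𝓘(ℝ, E) f x ((leftDeriv E (f x)).comp L) :=
  hasMFDerivWithinAt_univ.1 (hasLogFDerivWithinAt_iff.1 h)

/-- Infinitesimal form of xg = g(g⁻¹xg). -/
theorem rightDeriv_eq (g : G) : rightDeriv E g = (leftDeriv E g).comp (groupAd E g⁻¹) := by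
  have h1 : HasLogFDerivWithinAt (ψ).symm (ContinuousLinearMap.id ℝ E) univ e₀ := by
    refine ⟨contMDiffAt_chart_symm_one.continuousAt.continuousWithinAt, ?_⟩
    refine (hasFDerivWithinAt_id (𝕜 := ℝ) e₀ univ).congr_of_eventuallyEq ?_ ?_
    · rw [nhdsWithin_univ]
      filter_upwards [chart_target_mem_nhds E (1 : G)] with x hx
      simp [(ψ).right_inv hx]
    · simp
  have h2 := (h1.mul_const g).hasMFDerivAt
  have h2' : HasMFDerivAt 𝓘(ℝ, E) 𝓘(ℝ, E) (fun y => (ψ).symm y * g) e₀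
      ((leftDeriv E g).comp (groupAd E g⁻¹)) := by
    rw [chart_symm_one, one_mul] at h2
    exact h2
  have h3 := HasMFDerivAt.comp (1 : G) h2' hasMFDerivAt_chart_one
  refine hasMFDerivAt_unique (hasMFDerivAt_rightDeriv g) (h3.congr_of_eventuallyEq ?_)
  filter_upwards [chart_source_mem_nhds E (1 : G)] with x hx
  simp [(ψ).left_inv hx]

/-! ### The derivative of the adjoint action -/

theorem contDiffAt_groupAd_chart_symm :
    ContDiffAt ℝ ∞ (fun x => groupAd E ((ψ).symm x)) e₀ := by
  refine ContDiffAt.fderiv (n := ∞) (m := ∞)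
    (f := fun x y => ψ ((ψ).symm x * (ψ).symm y * ((ψ).symm x)⁻¹)) (g := fun _ => e₀)
    (contDiffAt_chart_comp ?_ ?_) contDiffAt_const (by simp)
  · have A := ContMDiffAt.comp (I' := 𝓘(ℝ, E)) (e₀, e₀) (contMDiffAt_chart_symm_one (G := G))
      (contDiffAt_fst (𝕜 := ℝ) (E := E) (F := E) (n := ∞)).contMDiffAt
    have B := ContMDiffAt.comp (I' := 𝓘(ℝ, E)) (e₀, e₀) (contMDiffAt_chart_symm_one (G := G))
      (contDiffAt_snd (𝕜 := ℝ) (E := E) (F := E) (n := ∞)).contMDiffAt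
    exact (A.mul B).mul A.inv
  · simp only [chart_symm_one, mul_one, inv_one]
    exact mem_chart_source E _

variable (E G) in
/-- The derivative of the adjoint action at the neutral element. -/
def groupad : E →L[ℝ] E →L[ℝ] E := fderiv ℝ (fun x => groupAd E ((ψ).symm x)) e₀

/-- Since Ad is multiplicative, Ad(f(y)) = Ad(f(x)) Ad(f(x)⁻¹f(y)), and only the derivative of Ad at
1 is needed. -/
theorem HasLogFDerivWithinAt.groupAd_comp {f : V → G} {L : V →L[ℝ] E} {s : Set V} {x : V}
    (h : HasLogFDerivWithinAt f L s x) :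
    HasFDerivWithinAt (fun y => groupAd E (f y))
      ((ContinuousLinearMap.compL ℝ E E E (groupAd E (f x))).comp ((groupad E G).comp L)) s x := by
  have := topologicalGroup_of_lieGroup 𝓘(ℝ, E) ∞ (G := G)
  have h1 := (contDiffAt_groupAd_chart_symm (E := E) (G := G)).differentiableAt
    (by simp) |>.hasFDerivAt
  have h2 : HasFDerivWithinAt (fun y => groupAd E ((ψ).symm (ψ ((f x)⁻¹ * f y))))
      ((groupad E G).comp L) s x := by
    refine HasFDerivAt.comp_hasFDerivWithinAt (f := fun y => ψ ((f x)⁻¹ * f y))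
      (g := fun x => groupAd E ((ψ).symm x)) x ?_ h.2
    simp only [inv_mul_cancel]
    exact h1
  have h3 := (ContinuousLinearMap.compL ℝ E E E
    (groupAd E (f x))).hasFDerivAt.comp_hasFDerivWithinAt x h2
  refine h3.congr_of_eventuallyEq ?_ ?_
  · filter_upwards [chart_eventually_eq (E := E) h.1 (fun z => (f x)⁻¹ * z) (by fun_prop)
      (by group)] with y hy
    simp only [Function.comp_apply, ContinuousLinearMap.compL_apply]
    rw [(ψ).left_inv hy, ← groupAd_mul]
    group
  · simp [groupAd_one]

/-! ### The bracket in coordinates -/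

variable (E G) in
/-- The left-invariant vector fields in coordinates. -/
def chartInvField (x : E) : E →L[ℝ] E := fderiv ℝ (fun z => ψ ((ψ).symm x * (ψ).symm z)) e₀

theorem hasFDerivAt_chartInvField {x : E} (hx : x ∈ (ψ).target) :
    HasFDerivAt (fun z => ψ ((ψ).symm x * (ψ).symm z)) (chartInvField E G x) e₀ := by
  have h : ContDiffAt ℝ ∞ (fun z => ψ ((ψ).symm x * (ψ).symm z)) e₀ := by
    refine contDiffAt_chart_comp ?_ ?_
    · exact (contMDiffAt_const (c := (ψ).symm x)).mul contMDiffAt_chart_symm_one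
    · rw [chart_symm_one, mul_one]
      exact (ψ).map_target hx
  exact (h.differentiableAt (by simp)).hasFDerivAt

theorem contDiffOn_chartInvField : ContDiffOn ℝ ∞ (chartInvField E G) (ψ).target := by
  intro x hx
  refine ContDiffAt.contDiffWithinAt ?_
  refine ContDiffAt.fderiv (n := ∞) (m := ∞)
    (f := fun x z => ψ ((ψ).symm x * (ψ).symm z)) (g := fun _ => e₀) ?_ contDiffAt_const (by simp)
  exact contDiffAt_chartMul hx chart_one_mem_target (by
    simp only [chart_symm_one, mul_one]
    exact (ψ).map_target hx)

theorem chartInvField_one : chartInvField E G e₀ = ContinuousLinearMap.id ℝ E := by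
  refine (hasFDerivAt_chartInvField (E := E) (G := G) chart_one_mem_target).unique
    ((hasFDerivAt_id (𝕜 := ℝ) e₀).congr_of_eventuallyEq ?_)
  filter_upwards [chart_target_mem_nhds E (1 : G)] with x hx
  simp [(ψ).right_inv hx]

/-- Let m be multiplication in coordinates, Q(x) = ∂₂m(x, e₀) and P(x) = ∂₁m(e₀, x). The identity xy
= (xyx⁻¹)x gives P(x) Ad(x) = Q(x). Differentiating at e₀ yields P'(v)w + ad(v)w = Q'(v)w, and
symmetry of the second derivative of m gives P'(v)w = Q'(w)v. Here Q is `chartInvField`. -/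
theorem groupad_apply_eq (v w : E) : groupad E G v w =
    fderiv ℝ (chartInvField E G) e₀ v w - fderiv ℝ (chartInvField E G) e₀ w v := by
  set m : E × E → E := fun p => ψ ((ψ).symm p.1 * (ψ).symm p.2) with hm
  have hmC : ContDiffAt ℝ ∞ m (e₀, e₀) := contDiffAt_chartMul (G := G) (p := (e₀, e₀))
    chart_one_mem_target chart_one_mem_target (by
      simp only [chart_symm_one, mul_one]
      exact mem_chart_source E _)
  have hmev : ∀ᶠ p in 𝓝 (e₀, e₀), HasFDerivAt m (fderiv ℝ m p) p := by
    filter_upwards [(hmC.of_le (by exact_mod_cast le_top : (1 : WithTop ℕ∞) ≤ ∞)).eventually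
      (by simp)] with p hp
    exact (hp.differentiableAt one_ne_zero).hasFDerivAt
  have hD2 : HasFDerivAt (fderiv ℝ m) (fderiv ℝ (fderiv ℝ m) (e₀, e₀)) (e₀, e₀) :=
    ((hmC.fderiv_right (m := ∞) (by simp)).differentiableAt (by simp)).hasFDerivAt
  have hsymm : IsSymmSndFDerivAt ℝ m (e₀, e₀) := hmC.isSymmSndFDerivAt (by
    simp only [minSmoothness_of_isRCLikeNormedField]
    exact WithTop.coe_le_coe.2 le_top)
  set D2 := fderiv ℝ (fderiv ℝ m) (e₀, e₀) with hD2def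
  have cl : Filter.Tendsto (fun x : E => (x, e₀)) (𝓝 e₀) (𝓝 (e₀, e₀)) :=
    (Continuous.prodMk_left e₀).tendsto e₀
  have cr : Filter.Tendsto (fun x : E => (e₀, x)) (𝓝 e₀) (𝓝 (e₀, e₀)) :=
    (Continuous.prodMk_right e₀).tendsto e₀
  -- the derivatives in the first and in the second variable
  have hQ : ∀ᶠ x in 𝓝 e₀, chartInvField E G x =
      (fderiv ℝ m (x, e₀)).comp (ContinuousLinearMap.inr ℝ E E) := by
    filter_upwards [cl.eventually hmev, chart_target_mem_nhds E (1 : G)] with x hx hxt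
    exact (hasFDerivAt_chartInvField hxt).unique (HasFDerivAt.comp (g := m) (f := fun z => (x, z))
      e₀ hx (hasFDerivAt_prodMk_right x e₀))
  have hP : ∀ᶠ x in 𝓝 e₀, ((fderiv ℝ m (e₀, x)).comp (ContinuousLinearMap.inl ℝ E E)).comp
      (groupAd E ((ψ).symm x)) = chartInvField E G x := by
    filter_upwards [cr.eventually hmev, chart_target_mem_nhds E (1 : G)] with x hx hxt
    have h1 : HasFDerivAt (fun z => m (z, x))
        ((fderiv ℝ m (e₀, x)).comp (ContinuousLinearMap.inl ℝ E E))
        (ψ ((ψ).symm x * (ψ).symm e₀ * ((ψ).symm x)⁻¹)) := by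
      rw [chart_symm_one, mul_one, mul_inv_cancel]
      exact HasFDerivAt.comp (g := m) (f := fun z => (z, x)) e₀ hx (hasFDerivAt_prodMk_left e₀ x)
    have h2 := HasFDerivAt.comp e₀ h1 (hasFDerivAt_groupAd ((ψ).symm x))
    refine h2.unique ((hasFDerivAt_chartInvField hxt).congr_of_eventuallyEq ?_)
    have hc : ContinuousAt (fun y => (ψ).symm x * (ψ).symm y * ((ψ).symm x)⁻¹) e₀ :=
      (contMDiffAt_conj ((ψ).symm x) chart_one_mem_target).continuousAt
    have hc' : Filter.Tendsto (fun y => (ψ).symm x * (ψ).symm y * ((ψ).symm x)⁻¹) (𝓝 e₀)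
        (𝓝 1) := by
      have := hc.tendsto
      rwa [chart_symm_one, mul_one, mul_inv_cancel] at this
    filter_upwards [hc'.eventually_mem (chart_source_mem_nhds E (1 : G))] with y hy
    simp [hm, (ψ).left_inv hy]
  have hQ' : HasFDerivAt (chartInvField E G) (((ContinuousLinearMap.compL ℝ E (E × E) E).flip
      (ContinuousLinearMap.inr ℝ E E)).comp (D2.comp (ContinuousLinearMap.inl ℝ E E))) e₀ := by
    refine HasFDerivAt.congr_of_eventuallyEq ?_ hQ
    exact ((ContinuousLinearMap.compL ℝ E (E × E) E).flip
      (ContinuousLinearMap.inr ℝ E E)).hasFDerivAt.comp e₀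
      (HasFDerivAt.comp (g := fderiv ℝ m) (f := fun x => (x, e₀)) e₀ hD2
        (hasFDerivAt_prodMk_left e₀ e₀))
  have hP' : HasFDerivAt (fun x => (fderiv ℝ m (e₀, x)).comp (ContinuousLinearMap.inl ℝ E E))
      (((ContinuousLinearMap.compL ℝ E (E × E) E).flip
      (ContinuousLinearMap.inl ℝ E E)).comp (D2.comp (ContinuousLinearMap.inr ℝ E E))) e₀ :=
    ((ContinuousLinearMap.compL ℝ E (E × E) E).flip
      (ContinuousLinearMap.inl ℝ E E)).hasFDerivAt.comp e₀
      (HasFDerivAt.comp (g := fderiv ℝ m) (f := fun x => (e₀, x)) e₀ hD2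
        (hasFDerivAt_prodMk_right e₀ e₀))
  have hA : HasFDerivAt (fun x => groupAd E ((ψ).symm x)) (groupad E G) e₀ :=
    ((contDiffAt_groupAd_chart_symm (E := E) (G := G)).differentiableAt (by simp)).hasFDerivAt
  have h1 := (hP'.clm_comp hA).unique (hQ'.congr_of_eventuallyEq hP)
  have h2 : (fderiv ℝ m (e₀, e₀)).comp (ContinuousLinearMap.inl ℝ E E) =
      ContinuousLinearMap.id ℝ E := by
    rw [(hasFDerivAt_chartMul (E := E) (G := G)).fderiv]
    ext x
    simp
  have h3 := congrArg (fun L => L v w) h1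
  simp only [chart_symm_one, groupAd_one, h2, add_apply,
    ContinuousLinearMap.coe_comp, Function.comp_apply, ContinuousLinearMap.compL_apply,
    ContinuousLinearMap.flip_apply, ContinuousLinearMap.inl_apply, ContinuousLinearMap.inr_apply,
    ContinuousLinearMap.comp_id, ContinuousLinearMap.id_comp] at h3
  rw [hQ'.fderiv]
  simp only [ContinuousLinearMap.coe_comp, Function.comp_apply, ContinuousLinearMap.compL_apply,
    ContinuousLinearMap.flip_apply, ContinuousLinearMap.inl_apply, ContinuousLinearMap.inr_apply]
  rw [hsymm.eq (w, 0) (0, v), ← h3]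
  abel

end LieDerivatives

/-! ### The Lie bracket in coordinates, and uniqueness of curves with given logarithmic derivative
-/

section LieBracket

variable {E G : Type*} [NormedAddCommGroup E] [NormedSpace ℝ E]
  [TopologicalSpace G] [ChartedSpace E G] [Group G]
  {V W : Type*} [NormedAddCommGroup V] [NormedSpace ℝ V] [NormedAddCommGroup W] [NormedSpace ℝ W]

local notation "ψ" => chartAt E (1 : G)
local notation "e₀" => chartAt E (1 : G) (1 : G)

variable [LieGroup 𝓘(ℝ, E) ∞ G]

theorem tendsto_chartMul_right (x : E) :
    Filter.Tendsto (fun z => (ψ).symm x * (ψ).symm z) (𝓝 e₀) (𝓝 ((ψ).symm x)) := by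
  have h : ContinuousAt (fun z => (ψ).symm x * (ψ).symm z) e₀ :=
    ((contMDiffAt_const (I := 𝓘(ℝ, E)) (I' := 𝓘(ℝ, E)) (n := ∞) (c := (ψ).symm x)).mul
      contMDiffAt_chart_symm_one).continuousAt
  have := h.tendsto
  rwa [chart_symm_one, mul_one] at this

theorem chartMul_symm_eventually {x : E} (hx : x ∈ (ψ).target) :
    ∀ᶠ z in 𝓝 e₀, (ψ).symm (ψ ((ψ).symm x * (ψ).symm z)) = (ψ).symm x * (ψ).symm z := by
  filter_upwards [(tendsto_chartMul_right x).eventually_mem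
    ((ψ).open_source.mem_nhds ((ψ).map_target hx))] with z hz
  exact (ψ).left_inv hz

theorem mfderivWithin_chart_symm_comp {x : E} (hx : x ∈ (ψ).target) :
    HasMFDerivAt 𝓘(ℝ, E) 𝓘(ℝ, E) (ψ).symm x
      (mfderivWithin 𝓘(ℝ, E) 𝓘(ℝ, E) (extChartAt 𝓘(ℝ, E) (1 : G)).symm (range 𝓘(ℝ, E)) x) ∧
    ∀ v : E, (mfderivWithin 𝓘(ℝ, E) 𝓘(ℝ, E) (extChartAt 𝓘(ℝ, E) (1 : G)).symm
      (range 𝓘(ℝ, E)) x : E →L[ℝ] E) (chartInvField E G x v) = leftDeriv E ((ψ).symm x) v := by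
  have h1 := ((contMDiffAt_chart_symm (G := G) hx).mdifferentiableAt (by simp)).hasMFDerivAt
  have h2 : mfderivWithin 𝓘(ℝ, E) 𝓘(ℝ, E) (extChartAt 𝓘(ℝ, E) (1 : G)).symm (range 𝓘(ℝ, E)) x =
      mfderiv 𝓘(ℝ, E) 𝓘(ℝ, E) (ψ).symm x := by
    rw [modelWithCornersSelf_coe, range_id, mfderivWithin_univ]
    rfl
  rw [h2]
  refine ⟨h1, fun v => ?_⟩
  set D : E →L[ℝ] E := mfderiv 𝓘(ℝ, E) 𝓘(ℝ, E) (ψ).symm x with hD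
  have h3 : HasMFDerivAt 𝓘(ℝ, E) 𝓘(ℝ, E) (ψ).symm (ψ ((ψ).symm x * (ψ).symm e₀)) D := by
    rw [chart_symm_one, mul_one, (ψ).right_inv hx]
    exact h1
  have h4 := HasMFDerivAt.comp e₀ h3 (hasFDerivAt_chartInvField hx).hasMFDerivAt
  have h5 := hasMFDerivAt_unique h4
    ((hasMFDerivAt_mul_chart_symm ((ψ).symm x)).congr_of_eventuallyEq (chartMul_symm_eventually hx))
  exact congrArg (fun L : E →L[ℝ] E => L v) h5

theorem mpullbackWithin_mulInvariantVectorField {x : E} (hx : x ∈ (ψ).target) (v : E) :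
    VectorField.mpullbackWithin 𝓘(ℝ, E) 𝓘(ℝ, E) (extChartAt 𝓘(ℝ, E) (1 : G)).symm
      (mulInvariantVectorField (I := 𝓘(ℝ, E)) (G := G) v) (range 𝓘(ℝ, E)) x =
      chartInvField E G x v := by
  have hi := isInvertible_mfderivWithin_extChartAt_symm (I := 𝓘(ℝ, E)) (x := (1 : G)) (y := x)
    (by simpa using hx)
  rw [VectorField.mpullbackWithin_apply]
  exact hi.inverse_apply_eq.2 ((mfderivWithin_chart_symm_comp hx).2 v).symm

variable (E G) in
/-- The left-invariant vector fields, pulled back to the chart. -/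
def chartPullbackField (u x : E) : E :=
  VectorField.mpullbackWithin 𝓘(ℝ, E) 𝓘(ℝ, E) (extChartAt 𝓘(ℝ, E) (1 : G)).symm
    (mulInvariantVectorField (I := 𝓘(ℝ, E)) (G := G) u) (range 𝓘(ℝ, E)) x

theorem groupad_eq_lieBracketWithin (v w : E) :
    groupad E G v w = VectorField.lieBracketWithin ℝ (chartPullbackField E G v)
      (chartPullbackField E G w) univ e₀ := by
  have hd : HasFDerivAt (chartInvField E G) (fderiv ℝ (chartInvField E G) e₀) e₀ :=
    ((contDiffOn_chartInvField.contDiffAt (chart_target_mem_nhds E (1 : G))).differentiableAt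
      (by simp)).hasFDerivAt
  have key : ∀ u : E, chartPullbackField E G u =ᶠ[𝓝 e₀] fun x => chartInvField E G x u := by
    intro u
    filter_upwards [chart_target_mem_nhds E (1 : G)] with x hx
    exact mpullbackWithin_mulInvariantVectorField hx u
  have h1 := Filter.EventuallyEq.lieBracket_vectorField_eq (𝕜 := ℝ) (key v) (key w)
  have h2 : ∀ u : E, fderiv ℝ (fun x => chartInvField E G x u) e₀ =
      (fderiv ℝ (chartInvField E G) e₀).flip u := fun u => by
    refine ((hd.clm_apply (hasFDerivAt_const u e₀)).congr_fderiv ?_).fderiv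
    ext y
    simp
  rw [VectorField.lieBracketWithin_univ, h1, VectorField.lieBracket, h2, h2,
      chartInvField_one, groupad_apply_eq]
  rfl

/-- The bracket of left-invariant fields at 1 is computed in the preferred chart there, whose
derivative at 1 is the identity of `E`. -/
theorem groupad_eq_lie [CompleteSpace E] (v w : GroupLieAlgebra 𝓘(ℝ, E) G) :
    groupad E G v w = (⁅v, w⁆ : GroupLieAlgebra 𝓘(ℝ, E) G) := by
  have hs : (extChartAt 𝓘(ℝ, E) (1 : G)).symm ⁻¹' univ ∩ range 𝓘(ℝ, E) = (univ : Set E) := by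
    simp
  rw [GroupLieAlgebra.bracket_def, ← VectorField.mlieBracketWithin_univ,
    VectorField.mlieBracketWithin_apply, hs]
  have hid : ∀ z : E, (mfderiv 𝓘(ℝ, E) 𝓘(ℝ, E) (extChartAt 𝓘(ℝ, E) (1 : G)) 1 :
      E →L[ℝ] E).inverse z = z := by
    intro z
    have h : (mfderiv 𝓘(ℝ, E) 𝓘(ℝ, E) (extChartAt 𝓘(ℝ, E) (1 : G)) 1 : E →L[ℝ] E) =
      ContinuousLinearMap.id ℝ E := mfderiv_extChartAt_self
    exact (isInvertible_mfderiv_extChartAt (I := 𝓘(ℝ, E)) (x := (1 : G))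
      (mem_extChartAt_source (1 : G))).inverse_apply_eq.2 (congrArg (fun L => L z) h).symm
  exact (groupad_eq_lieBracketWithin (E := E) (G := G) v w).trans (hid _).symm

/-- In coordinates, `h` has logarithmic derivative `ζ` when `y = ψ ∘ h` satisfies
`y' = chartInvField y ζ`. -/
theorem hasLogFDerivWithinAt_chart_symm {y : V → E} {L : V →L[ℝ] E} {s : Set V} {x : V}
    (hx : y x ∈ (ψ).target) (hy : HasFDerivWithinAt y ((chartInvField E G (y x)).comp L) s x) :
    HasLogFDerivWithinAt (fun z => (ψ).symm (y z)) L s x := by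
  rw [hasLogFDerivWithinAt_iff]
  have h1 := HasMFDerivAt.comp_hasMFDerivWithinAt x (mfderivWithin_chart_symm_comp hx).1
    hy.hasMFDerivWithinAt
  refine h1.congr_mfderiv (ContinuousLinearMap.ext fun v => ?_)
  exact (mfderivWithin_chart_symm_comp hx).2 (L v)

/-- A curve in a Lie group with vanishing logarithmic derivative is constant. -/
theorem HasLogFDerivWithinAt.eq_of_zero {f : ℝ → G}
    (hf : ∀ t ∈ Icc (0 : ℝ) 1, HasLogFDerivWithinAt f (0 : ℝ →L[ℝ] E) (Icc 0 1) t) :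
    ∀ t ∈ Icc (0 : ℝ) 1, f t = f 0 := by
  have := topologicalGroup_of_lieGroup 𝓘(ℝ, E) ∞ (G := G)
  have hc : ContinuousOn f (Icc 0 1) := fun t ht => (hf t ht).1
  -- For t' near t the quotient f(t)⁻¹f(t') stays in the chart at 1. There a vanishing derivative on
  -- a convex set forces constancy, and connectedness of [0,1] makes local constancy global.
  have hloc : ∀ t ∈ Icc (0 : ℝ) 1, ∀ᶠ t' in 𝓝[Icc 0 1] t, f t' = f t := by
    intro t ht
    have h1 := chart_eventually_eq (E := E) (hc t ht) (fun z => (f t)⁻¹ * z) (by fun_prop)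
      (by group)
    obtain ⟨ε, hε, h2⟩ := Metric.mem_nhdsWithin_iff.1 h1
    set J := Metric.ball t ε ∩ Icc 0 1 with hJ
    have hJc : Convex ℝ J := (convex_ball t ε).inter (convex_Icc 0 1)
    have hd : ∀ t' ∈ J, HasFDerivWithinAt (fun t' => ψ ((f t)⁻¹ * f t')) (0 : ℝ →L[ℝ] E) J t' := by
      intro t' ht'
      have h3 : HasMFDerivWithinAt 𝓘(ℝ, ℝ) 𝓘(ℝ, E) (fun t' => (f t)⁻¹ * f t') J t' _ :=
        hasLogFDerivWithinAt_iff.1 (((hf t' ht'.2).mono inter_subset_right).const_mul (f t)⁻¹)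
      have h4 := (mdifferentiableAt_extChartAt (I := 𝓘(ℝ, E)) (x := (1 : G))
        (h2 ht')).hasMFDerivAt
      have h5 := (HasMFDerivAt.comp_hasMFDerivWithinAt t' h4 h3).hasFDerivWithinAt
      have h6 : (mfderiv 𝓘(ℝ, E) 𝓘(ℝ, E) (extChartAt 𝓘(ℝ, E) (1 : G)) ((f t)⁻¹ * f t') :
        E →L[ℝ] E).comp ((leftDeriv E ((f t)⁻¹ * f t')).comp (0 : ℝ →L[ℝ] E)) = 0 := by
        rw [ContinuousLinearMap.comp_zero]
        exact ContinuousLinearMap.comp_zero _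
      exact h5.congr_fderiv h6
    have htJ : t ∈ J := ⟨Metric.mem_ball_self hε, ht⟩
    have hconst : ∀ t' ∈ J, f t' = f t := by
      intro t' ht'
      have h3 := hJc.is_const_of_fderivWithin_eq_zero (𝕜 := ℝ)
        (f := fun t' => ψ ((f t)⁻¹ * f t')) (fun t'' h => (hd t'' h).differentiableWithinAt)
        (fun t'' h => by
          -- Where derivatives within `J` are not unique, `fderivWithin` is 0 by default.
          by_cases hu : UniqueDiffWithinAt ℝ J t''
          · exact (hd t'' h).fderivWithin hu
          · exact fderivWithin_zero_of_not_uniqueDiffWithinAt hu) ht' htJ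
      have h4 := (ψ).injOn (h2 ht') (h2 htJ) h3
      exact mul_left_cancel h4
    filter_upwards [inter_mem_nhdsWithin (Icc (0 : ℝ) 1) (Metric.ball_mem_nhds t hε)] with t' h
    exact hconst t' ⟨h.2, h.1⟩
  intro t ht
  have hl : IsLocallyConstant (fun u : Icc (0 : ℝ) 1 => f u) := by
    rw [IsLocallyConstant.iff_eventually_eq]
    intro u
    have := hloc u u.2
    rw [nhdsWithin_eq_map_subtype_coe u.2] at this
    exact this
  have : PreconnectedSpace (Icc (0 : ℝ) 1) := Subtype.preconnectedSpace isPreconnected_Icc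
  exact hl.apply_eq_of_preconnectedSpace ⟨t, ht⟩ ⟨0, by simp⟩

/-- The logarithmic derivative of the inverse. -/
theorem HasLogFDerivWithinAt.inv {k : V → G} {L : V →L[ℝ] E} {s : Set V} {x : V}
    (hs : UniqueDiffWithinAt ℝ s x) (hk : HasLogFDerivWithinAt k L s x) :
    HasLogFDerivWithinAt (fun t => (k t)⁻¹) (-((groupAd E (k x)).comp L)) s x := by
  have h1 := hasLogFDerivWithinAt_iff.1 hk
  have h2 := ((contMDiff_inv 𝓘(ℝ, E) ∞ (G := G)).mdifferentiable (by simp)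
    (k x)).hasMFDerivAt
  have h3 := HasMFDerivAt.comp_hasMFDerivWithinAt x h2 h1
  obtain ⟨e, he⟩ := (hasFDerivAt_chart_inv_mul (E := E) (k x)⁻¹).2
  set D : V →L[ℝ] E := (mfderiv 𝓘(ℝ, E) 𝓘(ℝ, E) (fun x : G => x⁻¹) (k x) : E →L[ℝ] E).comp
    ((leftDeriv E (k x)).comp L) with hD
  have h4 : HasLogFDerivWithinAt (fun t => (k t)⁻¹)
      ((e.symm : E →L[ℝ] E).comp D) s x := by
    rw [hasLogFDerivWithinAt_iff]
    refine h3.congr_mfderiv (ContinuousLinearMap.ext fun v => ?_)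
    rw [← he]
    exact (e.apply_symm_apply _).symm
  -- Smoothness of the inversion gives existence of the derivative; its value follows from the
  -- product rule for k k⁻¹ = 1.
  have h5 := hk.mul h4
  have h6 : HasLogFDerivWithinAt (fun t => k t * (k t)⁻¹) (0 : V →L[ℝ] E) s x := by
    simp only [mul_inv_cancel]
    exact HasLogFDerivWithinAt.const 1
  have h7 := h5.unique hs h6
  rw [inv_inv] at h7
  rw [← eq_neg_of_add_eq_zero_right h7]
  exact h4

/-- The derivative in coordinates of a map with a given logarithmic derivative. -/
theorem HasLogFDerivWithinAt.chart_comp {k : V → G} {L : V →L[ℝ] E} {s : Set V} {x : V}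
    (hk : HasLogFDerivWithinAt k L s x) (hx : k x ∈ (ψ).source) :
    HasFDerivWithinAt (fun t => ψ (k t)) ((chartInvField E G (ψ (k x))).comp L) s x := by
  have := topologicalGroup_of_lieGroup 𝓘(ℝ, E) ∞ (G := G)
  have h1 := HasFDerivAt.comp_hasFDerivWithinAt (f := fun y => ψ ((k x)⁻¹ * k y))
    (g := fun z => ψ ((ψ).symm (ψ (k x)) * (ψ).symm z)) x (by
      simp only [inv_mul_cancel]
      exact hasFDerivAt_chartInvField ((ψ).map_source hx)) hk.2
  refine h1.congr_of_eventuallyEq ?_ ?_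
  · filter_upwards [chart_eventually_eq (E := E) hk.1 (fun z => (k x)⁻¹ * z) (by fun_prop)
      (by group)] with y hy
    simp [(ψ).left_inv hx, (ψ).left_inv hy]
  · simp [(ψ).left_inv hx]

/-- Two curves in a Lie group with the same logarithmic derivative and the same initial point
agree. -/
theorem HasLogFDerivWithinAt.eq_of_eq {f k : ℝ → G} {L : ℝ → ℝ →L[ℝ] E}
    (hf : ∀ t ∈ Icc (0 : ℝ) 1, HasLogFDerivWithinAt f (L t) (Icc 0 1) t)
    (hk : ∀ t ∈ Icc (0 : ℝ) 1, HasLogFDerivWithinAt k (L t) (Icc 0 1) t) (h0 : f 0 = k 0) :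
    ∀ t ∈ Icc (0 : ℝ) 1, f t = k t := by
  have := topologicalGroup_of_lieGroup 𝓘(ℝ, E) ∞ (G := G)
  -- the quotient `q = f k⁻¹` has zero derivative
  have hq := HasLogFDerivWithinAt.eq_of_zero (f := fun t => f t * (k t)⁻¹) (E := E) (by
    intro t ht
    have h1 := (hf t ht).mul ((hk t ht).inv (uniqueDiffOn_Icc_zero_one t ht))
    rw [inv_inv, add_neg_cancel] at h1
    exact h1)
  intro t ht
  have := hq t ht
  rw [h0, mul_inv_cancel] at this
  exact mul_inv_eq_one.1 this

end LieBracket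

/-! ### Smooth dependence of the curve on a small path in the Lie algebra -/

section LocalSolution

variable {E : Type u} {G : Type*} [NormedAddCommGroup E] [NormedSpace ℝ E] [FiniteDimensional ℝ E]
  [TopologicalSpace G] [ChartedSpace E G] [Group G]

local notation "ψ" => chartAt E (1 : G)
local notation "e₀" => chartAt E (1 : G) (1 : G)

/-- `h` is the curve in the Lie group with `h(0) = 1` and logarithmic derivative `ζ`. -/
structure IsLogPath (h : ℝ → G) (ζ : PathSpace E) : Prop where
  map_zero : h 0 = 1
  hasLogFDeriv : ∀ u : unitInterval, HasLogFDerivWithinAt h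
    (ContinuousLinearMap.toSpanSingleton ℝ (ζ u)) (Icc 0 1) (u : ℝ)

/-- The equivalence `(ζ, y) ↦ (ζ, y - J ζ)`. -/
def shearEquiv {A B : Type*} [NormedAddCommGroup A] [NormedSpace ℝ A] [NormedAddCommGroup B]
    [NormedSpace ℝ B] (J : A →L[ℝ] B) : (A × B) ≃L[ℝ] (A × B) :=
  ContinuousLinearEquiv.equivOfInverse
    ((ContinuousLinearMap.fst ℝ A B).prod
      (ContinuousLinearMap.snd ℝ A B - J.comp (ContinuousLinearMap.fst ℝ A B)))
    ((ContinuousLinearMap.fst ℝ A B).prod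
      (ContinuousLinearMap.snd ℝ A B + J.comp (ContinuousLinearMap.fst ℝ A B)))
    (fun p => by ext <;> simp) (fun p => by ext <;> simp)

variable [LieGroup 𝓘(ℝ, E) ∞ G]

variable (E G) in
/-- The left-invariant vector fields in coordinates, cut off outside of a ball. -/
theorem exists_cutoff_chartInvField : ∃ (F : E → E →L[ℝ] E) (r : ℝ), 0 < r ∧ ContDiff ℝ ∞ F ∧
    ∀ x ∈ Metric.ball e₀ r, x ∈ (ψ).target ∧ F x = chartInvField E G x := by
  obtain ⟨R, hR, hRs⟩ := Metric.nhds_basis_closedBall.mem_iff.1 (chart_target_mem_nhds E (1 : G))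
  -- The bump function vanishes outside the ball of radius `R`, whose closure lies in the chart
  -- domain, so the product is smooth on all of `E`; on the half ball nothing is changed.
  let f : ContDiffBump e₀ := ⟨R / 2, R, by positivity, by linarith⟩
  refine ⟨fun x => f x • chartInvField E G x, R / 2, by positivity, ?_, ?_⟩
  · rw [contDiff_iff_contDiffAt]
    intro x
    by_cases hx : x ∈ (ψ).target
    · exact f.contDiffAt.smul
        (contDiffOn_chartInvField.contDiffAt ((ψ).open_target.mem_nhds hx))
    · have h1 : (Metric.closedBall e₀ R)ᶜ ∈ 𝓝 x :=
        Metric.isClosed_closedBall.isOpen_compl.mem_nhds fun h => hx (hRs h)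
      refine (contDiffAt_const (c := 0)).congr_of_eventuallyEq ?_
      filter_upwards [h1] with y hy
      have : f y = 0 := f.zero_of_le_dist (by
        rw [mem_compl_iff, Metric.mem_closedBall, not_le] at hy
        exact hy.le)
      simp [this]
  · intro x hx
    refine ⟨hRs (Metric.ball_subset_closedBall (Metric.ball_subset_ball (by linarith) hx)), ?_⟩
    have : f x = 1 := f.one_of_mem_closedBall (Metric.ball_subset_closedBall hx)
    simp [this]

variable (E G) in
-- In coordinates the equation h⁻¹dh = ζ is y' = F(y)ζ. Its integral form y = e₀ + ∫F(y)ζ is solved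
-- for small ζ by the inverse function theorem in the Banach space of paths, which at once gives
-- smooth dependence on ζ.
theorem exists_local_logPath : ∃ (U : Set (PathSpace E)) (Y : PathSpace E → PathSpace E),
    IsOpen U ∧ 0 ∈ U ∧ ContDiffOn ℝ ∞ Y U ∧ (∀ ζ ∈ U, ∀ u, Y ζ u ∈ (ψ).target) ∧
    (∀ ζ ∈ U, IsLogPath (fun t => (ψ).symm (Y ζ (projIcc 0 1 zero_le_one t))) ζ) ∧
    HasFDerivAt Y (PathSpace.integrateL E) 0 := by
  obtain ⟨F, r, hr, hF, hFr⟩ := exists_cutoff_chartInvField E G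
  set c : PathSpace E := PathSpace.constL E e₀ with hc
  set N : PathSpace E → PathSpace (E →L[ℝ] E) :=
    fun y => PathSpace.mk (fun u => F (y u)) (hF.continuous.comp y.continuous) with hNdef
  have hN : ContDiff ℝ ∞ N := PathSpace.contDiff_comp_left.{u, u} hF
  set B := PathSpace.bilinL (ContinuousLinearMap.id ℝ (E →L[ℝ] E)) with hB
  set J := PathSpace.integrateL E with hJ
  have hNc : B (N c) = ContinuousLinearMap.id ℝ (PathSpace E) := by
    ext ζ u
    have : F e₀ = ContinuousLinearMap.id ℝ E := by
      rw [(hFr e₀ (Metric.mem_ball_self hr)).2, chartInvField_one]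
    simp [hB, hNdef, hc, this]
  -- The integral equation says exactly that 𝓕(ζ, y) = (ζ, c).
  set 𝓕 : PathSpace E × PathSpace E → PathSpace E × PathSpace E :=
    fun p => (p.1, p.2 - J (B (N p.2) p.1)) with h𝓕
  have h𝓕C : ContDiff ℝ ∞ 𝓕 := by
    have : ContDiff ℝ ∞ fun p : PathSpace E × PathSpace E => B (N p.2) p.1 :=
      (B.contDiff.comp (hN.comp contDiff_snd)).clm_apply contDiff_fst
    exact contDiff_fst.prodMk (contDiff_snd.sub (J.contDiff.comp this))
  -- At ζ = 0 the variation of `N y` is applied to 0, so the derivative is a shear, hence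
  -- invertible.
  have hd : HasFDerivAt 𝓕 (shearEquiv J : (PathSpace E × PathSpace E) →L[ℝ] _) (0, c) := by
    have h1 : HasFDerivAt (fun p : PathSpace E × PathSpace E => B (N p.2)) _ (0, c) :=
      ((B.contDiff.comp (hN.comp contDiff_snd)).differentiable (by simp) (0, c)).hasFDerivAt
    have h2 := h1.clm_apply (hasFDerivAt_fst (𝕜 := ℝ) (p := ((0, c) : PathSpace E × PathSpace E)))
    have h3 := hasFDerivAt_fst.prodMk (hasFDerivAt_snd.sub (J.hasFDerivAt.comp _ h2))
    refine h3.congr_fderiv (ContinuousLinearMap.ext fun p => ?_)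
    simp [shearEquiv, hNc]
  obtain ⟨Θ, hΘ0, -, hΘf, -, hΘs⟩ := exists_openPartialHomeomorph_contDiffOn isOpen_univ
    (mem_univ (0, c)) h𝓕C.contDiffOn _ hd
  have hΘc : Θ (0, c) = (0, c) := by
    rw [hΘf]
    simp [h𝓕]
  set ι : PathSpace E → PathSpace E × PathSpace E := fun ζ => (ζ, c) with hι
  have hιC : ContDiff ℝ ∞ ι := contDiff_id.prodMk contDiff_const
  set U₀ := ι ⁻¹' Θ.target with hU₀
  have hU₀o : IsOpen U₀ := Θ.open_target.preimage hιC.continuous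
  have h0U₀ : (0 : PathSpace E) ∈ U₀ := by
    have := Θ.map_source hΘ0
    rwa [hΘc] at this
  set Y : PathSpace E → PathSpace E := fun ζ => (Θ.symm (ι ζ)).2 with hY
  have hYC : ContDiffOn ℝ ∞ Y U₀ :=
    contDiff_snd.comp_contDiffOn (hΘs.comp hιC.contDiffOn fun ζ hζ => hζ)
  have hY0 : Y 0 = c := by
    have : Θ.symm (0, c) = (0, c) := by
      conv_lhs => rw [← hΘc]
      exact Θ.left_inv hΘ0
    simp [hY, hι, this]
  have heq : ∀ ζ ∈ U₀, Y ζ = c + J (B (N (Y ζ)) ζ) := by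
    intro ζ hζ
    have h1 := Θ.right_inv (x := ι ζ) hζ
    rw [hΘf] at h1
    have h2 : (Θ.symm (ι ζ)).1 = ζ := congrArg Prod.fst h1
    have h3 : Y ζ - J (B (N (Y ζ)) (Θ.symm (ι ζ)).1) = c := congrArg Prod.snd h1
    rw [h2] at h3
    exact sub_eq_iff_eq_add.1 h3
  -- On this smaller set the solution stays where the cutoff field is the genuine left-invariant
  -- field.
  set U := U₀ ∩ Y ⁻¹' Metric.ball c r with hU
  have hball : ∀ ζ ∈ U, ∀ u, Y ζ u ∈ Metric.ball e₀ r := by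
    intro ζ hζ u
    rw [mem_ball_iff_norm]
    refine lt_of_le_of_lt ?_ (mem_ball_iff_norm.1 hζ.2)
    exact (Y ζ - c).norm_apply_le u
  refine ⟨U, Y, hYC.continuousOn.isOpen_inter_preimage hU₀o Metric.isOpen_ball, ⟨h0U₀, ?_⟩,
    hYC.mono inter_subset_left, fun ζ hζ u => (hFr _ (hball ζ hζ u)).1, ?_, ?_⟩
  · rw [mem_preimage, hY0]
    exact Metric.mem_ball_self hr
  · intro ζ hζ
    have hval : ∀ t : ℝ, t ∈ Icc (0 : ℝ) 1 → Y ζ (projIcc 0 1 zero_le_one t) = e₀ +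
        ∫ s in (0 : ℝ)..t, B (N (Y ζ)) ζ (projIcc 0 1 zero_le_one s) := by
      intro t ht
      have h1 := congrArg (fun f : PathSpace E => f ⟨t, ht⟩) (heq ζ hζ.1)
      rw [projIcc_of_mem zero_le_one ht]
      exact h1
    constructor
    · rw [hval 0 (by simp), intervalIntegral.integral_same, add_zero, chart_symm_one]
    · intro u
      have h1 : HasDerivWithinAt (fun t => Y ζ (projIcc 0 1 zero_le_one t))
          (B (N (Y ζ)) ζ u) (Icc 0 1) (u : ℝ) :=
        ((PathSpace.hasDerivWithinAt_integrateL (B (N (Y ζ)) ζ) u).const_add e₀).congr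
          (fun t ht => hval t ht) (hval u u.2)
      have hu := hFr _ (hball ζ hζ u)
      refine hasLogFDerivWithinAt_chart_symm (y := fun t => Y ζ (projIcc 0 1 zero_le_one t)) ?_ ?_
      · rw [projIcc_val]
        exact hu.1
      · refine h1.hasFDerivWithinAt.congr_fderiv (ContinuousLinearMap.ext fun t => ?_)
        simp [hB, hNdef, hu.2]
  -- The derivative of `Y` comes from differentiating the integral equation at ζ = 0, where `B (N
  -- c)` is the identity.
  · have h1 : HasFDerivAt (fun ζ => B (N (Y ζ))) _ 0 :=
      ((B.contDiff.comp hN).contDiffAt.comp (0 : PathSpace E)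
        (hYC.contDiffAt (hU₀o.mem_nhds h0U₀))).differentiableAt (by simp) |>.hasFDerivAt
    have h2 := h1.clm_apply (hasFDerivAt_id (𝕜 := ℝ) (0 : PathSpace E))
    have h3 := (J.hasFDerivAt.comp _ h2).const_add c
    refine (h3.congr_of_eventuallyEq ?_).congr_fderiv (ContinuousLinearMap.ext fun p => ?_)
    · filter_upwards [hU₀o.mem_nhds h0U₀] with ζ hζ
      exact heq ζ hζ
    · simp [hY0, hNc]

end LocalSolution

/-! ### The holonomy map: existence, smoothness, derivative -/

section Holonomy

variable {E : Type u} {G : Type*} [NormedAddCommGroup E] [NormedSpace ℝ E] [FiniteDimensional ℝ E]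
  [TopologicalSpace G] [ChartedSpace E G] [Group G]

local notation "ψ" => chartAt E (1 : G)
local notation "e₀" => chartAt E (1 : G) (1 : G)

variable [LieGroup 𝓘(ℝ, E) ∞ G] {h k : ℝ → G} {ζ ζ' δ : PathSpace E}

namespace IsLogPath

theorem continuousOn (hh : IsLogPath h ζ) : ContinuousOn h (Icc 0 1) :=
  fun t ht => (hh.2 ⟨t, ht⟩).1

theorem continuous_restrict (hh : IsLogPath h ζ) : Continuous fun u : unitInterval => h u :=
  continuousOn_iff_continuous_domRestrict.1 hh.continuousOn

theorem eqOn (hh : IsLogPath h ζ) (hk : IsLogPath k ζ) : ∀ t ∈ Icc (0 : ℝ) 1, h t = k t := by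
  refine HasLogFDerivWithinAt.eq_of_eq (E := E)
    (L := fun t => ContinuousLinearMap.toSpanSingleton ℝ (ζ (projIcc 0 1 zero_le_one t)))
    (fun t ht => ?_) (fun t ht => ?_) (hh.1.trans hk.1.symm)
  · rw [projIcc_of_mem zero_le_one ht]
    exact hh.2 ⟨t, ht⟩
  · rw [projIcc_of_mem zero_le_one ht]
    exact hk.2 ⟨t, ht⟩

theorem form_unique (hh : IsLogPath h ζ) (hh' : IsLogPath h ζ') : ζ = ζ' := by
  ext u
  have := (hh.2 u).unique (uniqueDiffOn_Icc_zero_one u u.2) (hh'.2 u)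
  simpa using congrArg (fun L => L 1) this

theorem congr (hh : IsLogPath h ζ) (hk : ∀ t ∈ Icc (0 : ℝ) 1, k t = h t) : IsLogPath k ζ :=
  ⟨(hk 0 (by simp)).trans hh.1, fun u => (hh.2 u).congr hk (hk u u.2)⟩

theorem continuous_groupAd (hh : IsLogPath h ζ) :
    Continuous fun u : unitInterval => groupAd E (h u) := by
  have : ContinuousOn (fun t => groupAd E (h t)) (Icc 0 1) :=
    fun t ht => (hh.2 ⟨t, ht⟩).groupAd_comp.continuousWithinAt
  exact continuousOn_iff_continuous_domRestrict.1 this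

/-- The path of adjoint actions. -/
def adPath (hh : IsLogPath h ζ) : PathSpace (E →L[ℝ] E) :=
  PathSpace.mk (fun u => groupAd E (h u)) hh.continuous_groupAd

/-- Conjugation of a path by `h`. -/
def adL (hh : IsLogPath h ζ) : PathSpace E →L[ℝ] PathSpace E :=
  PathSpace.bilinL (ContinuousLinearMap.id ℝ (E →L[ℝ] E)) hh.adPath

@[simp] theorem adL_apply (hh : IsLogPath h ζ) (δ : PathSpace E) (u : unitInterval) :
    hh.adL δ u = groupAd E (h u) (δ u) := rfl

theorem mul (hh : IsLogPath h ζ) (hk : IsLogPath k (hh.adL δ)) :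
    IsLogPath (fun t => k t * h t) (ζ + δ) := by
  refine ⟨by simp [hh.1, hk.1], fun u => ?_⟩
  have h1 := (hk.2 u).mul (hh.2 u)
  convert h1 using 1
  ext
  simp [groupAd_inv_apply, add_comm]

variable (E G) in
theorem one : IsLogPath (fun _ : ℝ => (1 : G)) (0 : PathSpace E) := by
  refine ⟨rfl, fun u => ?_⟩
  have h1 := HasLogFDerivWithinAt.const (E := E) (V := ℝ) (s := Icc (0 : ℝ) 1) (x := (u : ℝ))
    (1 : G)
  convert h1 using 1
  ext
  simp

/-- Dividing by `h (τ 0)` restores the initial value 1, so `τ` need not fix 0. This covers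
restriction to [0,u], reversal and smoothing at the ends. -/
theorem reparam (hh : IsLogPath h ζ) {τ τ' : ℝ → ℝ} (hτ : MapsTo τ (Icc 0 1) (Icc 0 1))
    (hd : ∀ t ∈ Icc (0 : ℝ) 1, HasDerivWithinAt τ (τ' t) (Icc 0 1) t)
    (hζ : ∀ u : unitInterval, ζ' u = τ' u • ζ (projIcc 0 1 zero_le_one (τ u))) :
    IsLogPath (fun t => (h (τ 0))⁻¹ * h (τ t)) ζ' := by
  refine ⟨inv_mul_cancel _, fun u => ?_⟩
  have h0 := hh.2 ⟨τ u, hτ u.2⟩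
  have h1 := (HasLogFDerivWithinAt.comp (τ := τ) h0 (hd u u.2).hasFDerivWithinAt hτ).const_mul
    (h (τ 0))⁻¹
  convert h1 using 1
  ext
  simp [hζ, projIcc_of_mem zero_le_one (hτ u.2)]

/-- Concatenation. -/
theorem concat {h₁ h₂ : ℝ → G} {ζ₁ ζ₂ : PathSpace E} (hh₁ : IsLogPath h₁ ζ₁)
    (hh₂ : IsLogPath h₂ ζ₂)
    (hz₁ : ∀ u v : unitInterval, (v : ℝ) = 2 * u → ζ u = (2 : ℝ) • ζ₁ v)
    (hz₂ : ∀ u v : unitInterval, (v : ℝ) = 2 * u - 1 → ζ u = (2 : ℝ) • ζ₂ v) :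
    IsLogPath (fun t => if t ≤ 1 / 2 then h₁ (2 * t) else h₁ 1 * h₂ (2 * t - 1)) ζ := by
  set k : ℝ → G := fun t => if t ≤ 1 / 2 then h₁ (2 * t) else h₁ 1 * h₂ (2 * t - 1) with hk
  have hleft : ∀ u : unitInterval, (u : ℝ) ≤ 1 / 2 → HasLogFDerivWithinAt k
      (ContinuousLinearMap.toSpanSingleton ℝ (ζ u)) (Icc 0 (1 / 2)) u := by
    intro u hu
    have hv : 2 * (u : ℝ) ∈ Icc (0 : ℝ) 1 := ⟨by linarith [u.2.1], by linarith⟩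
    have h1 := hh₁.2 ⟨_, hv⟩
    have h2 : HasDerivWithinAt (fun t : ℝ => 2 * t) 2 (Icc 0 (1 / 2)) (u : ℝ) := by
      simpa using ((hasDerivAt_id (u : ℝ)).const_mul 2).hasDerivWithinAt
    have h3 := HasLogFDerivWithinAt.comp (τ := fun t : ℝ => 2 * t) h1 h2.hasFDerivWithinAt
      (fun t ht => ⟨by linarith [ht.1], by linarith [ht.2]⟩)
    have h4 := h3.congr (k := k) (fun t ht => by simp only [hk, if_pos ht.2])
      (by simp only [hk, if_pos hu])
    convert h4 using 1
    ext
    simp [hz₁ u ⟨_, hv⟩ rfl]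
  have hright : ∀ u : unitInterval, 1 / 2 ≤ (u : ℝ) → HasLogFDerivWithinAt k
      (ContinuousLinearMap.toSpanSingleton ℝ (ζ u)) (Icc (1 / 2) 1) u := by
    intro u hu
    have hv : 2 * (u : ℝ) - 1 ∈ Icc (0 : ℝ) 1 := ⟨by linarith, by linarith [u.2.2]⟩
    have h1 := hh₂.2 ⟨_, hv⟩
    have h2 : HasDerivWithinAt (fun t : ℝ => 2 * t - 1) 2 (Icc (1 / 2) 1) (u : ℝ) := by
      simpa using (((hasDerivAt_id (u : ℝ)).const_mul 2).sub_const 1).hasDerivWithinAt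
    have h3 := (HasLogFDerivWithinAt.comp (τ := fun t : ℝ => 2 * t - 1) h1 h2.hasFDerivWithinAt
      (fun t ht => ⟨by linarith [ht.1], by linarith [ht.2]⟩)).const_mul (h₁ 1)
    have hval : ∀ t : ℝ, 1 / 2 ≤ t → k t = h₁ 1 * h₂ (2 * t - 1) := by
      intro t ht
      rcases ht.eq_or_lt with rfl | ht
      · simp [hk, hh₂.1]
      · simp only [hk, if_neg (not_le.2 ht)]
    have h4 := h3.congr (k := k) (fun t ht => hval t ht.1) (hval u hu)
    convert h4 using 1
    ext
    simp [hz₂ u ⟨_, hv⟩ rfl]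
  refine ⟨by simp [hk, hh₁.1], fun u => ?_⟩
  have hun : Icc (0 : ℝ) 1 = Icc 0 (1 / 2) ∪ Icc (1 / 2) 1 := by
    rw [Icc_union_Icc_eq_Icc] <;> norm_num
  rcases lt_trichotomy (u : ℝ) (1 / 2) with hu | hu | hu
  · refine ⟨(hleft u hu.le).1.mono_of_mem_nhdsWithin ?_,
      (hleft u hu.le).2.mono_of_mem_nhdsWithin ?_⟩ <;>
    · filter_upwards [inter_mem_nhdsWithin (Icc (0 : ℝ) 1) (Iio_mem_nhds hu)] with t ht
      exact ⟨ht.1.1, le_of_lt ht.2⟩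
  · rw [hun]
    exact ⟨(hleft u hu.le).1.union (hright u hu.ge).1, (hleft u hu.le).2.union (hright u hu.ge).2⟩
  · refine ⟨(hright u hu.le).1.mono_of_mem_nhdsWithin ?_,
      (hright u hu.le).2.mono_of_mem_nhdsWithin ?_⟩ <;>
    · filter_upwards [inter_mem_nhdsWithin (Icc (0 : ℝ) 1) (Ioi_mem_nhds hu)] with t ht
      exact ⟨le_of_lt ht.2, ht.1.2⟩

end IsLogPath

variable (G) in
-- Small ζ are covered by the local solution. Rescaling each half of [0,1] to the whole interval at
-- least halves the bound on the norm, so finitely many bisections, followed by concatenation, reach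
-- every ζ.
theorem exists_isLogPath (ζ : PathSpace E) : ∃ h : ℝ → G, IsLogPath h ζ := by
  obtain ⟨U, Y, hU, h0, -, -, hY, -⟩ := exists_local_logPath E G
  obtain ⟨r, hr, hrU⟩ := Metric.isOpen_iff.1 hU 0 h0
  have key : ∀ (n : ℕ) (ζ : PathSpace E), ‖ζ‖ < 2 ^ n * r → ∃ h : ℝ → G, IsLogPath h ζ := by
    intro n
    induction n with
    | zero =>
      intro ζ hζ
      exact ⟨_, hY ζ (hrU (by simpa using hζ))⟩
    | succ n ih =>
      intro ζ hζ
      have hhalf : ∀ τ : C(unitInterval, unitInterval), ∃ h : ℝ → G,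
          IsLogPath h ((1 / 2 : ℝ) • PathSpace.reparamL τ ζ) := by
        intro τ
        refine ih _ ?_
        have h1 : ‖PathSpace.reparamL τ ζ‖ ≤ ‖ζ‖ :=
          PathSpace.norm_le (norm_nonneg _) fun u => ζ.norm_apply_le _
        rw [norm_smul, Real.norm_of_nonneg (by norm_num)]
        rw [pow_succ] at hζ
        linarith
      let τ₁ : C(unitInterval, unitInterval) :=
        ⟨fun u => projIcc 0 1 zero_le_one ((u : ℝ) / 2), by fun_prop⟩
      let τ₂ : C(unitInterval, unitInterval) :=
        ⟨fun u => projIcc 0 1 zero_le_one (((u : ℝ) + 1) / 2), by fun_prop⟩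
      obtain ⟨h₁, hh₁⟩ := hhalf τ₁
      obtain ⟨h₂, hh₂⟩ := hhalf τ₂
      refine ⟨_, hh₁.concat hh₂ ?_ ?_⟩
      · intro u v huv
        have : τ₁ v = u := by
          simp only [τ₁, ContinuousMap.coe_mk, huv]
          rw [mul_div_cancel_left₀ _ two_ne_zero, projIcc_val]
        simp [this, smul_smul]
      · intro u v huv
        have : τ₂ v = u := by
          simp only [τ₂, ContinuousMap.coe_mk, huv]
          rw [sub_add_cancel, mul_div_cancel_left₀ _ two_ne_zero, projIcc_val]
        simp [this, smul_smul]
  obtain ⟨n, hn⟩ := pow_unbounded_of_one_lt (‖ζ‖ / r) (one_lt_two : (1 : ℝ) < 2)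
  exact key n ζ (by rwa [div_lt_iff₀ hr] at hn)

variable (G) in
/-- The curve `h` in the Lie group with `h(0) = 1` and `h⁻¹ dh = ζ`. -/
def logPath (ζ : PathSpace E) : ℝ → G := (exists_isLogPath G ζ).choose

variable (G) in
theorem isLogPath_logPath (ζ : PathSpace E) : IsLogPath (logPath G ζ) ζ :=
  (exists_isLogPath G ζ).choose_spec

variable (G) in
/-- The holonomy. -/
def hol (ζ : PathSpace E) : G := logPath G ζ 1

theorem IsLogPath.hol_eq (hh : IsLogPath h ζ) : hol G ζ = h 1 :=
  (isLogPath_logPath G ζ).eqOn hh 1 (by simp)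

variable (E G) in
theorem hol_zero : hol G (0 : PathSpace E) = 1 := (IsLogPath.one E G).hol_eq

variable (G) in
/-- Conjugation of paths by the curve with logarithmic derivative `ζ`. -/
def adPathL (ζ : PathSpace E) : PathSpace E →L[ℝ] PathSpace E := (isLogPath_logPath G ζ).adL

theorem adPathL_apply (ζ δ : PathSpace E) (u : unitInterval) :
    adPathL G ζ δ u = groupAd E (logPath G ζ u) (δ u) := rfl

/-- If k has logarithmic derivative Ad(h)δ, then kh has Ad(h)⁻¹Ad(h)δ + ζ. This reduces the study of
hol at ζ to its study at 0. -/
theorem hol_add (ζ δ : PathSpace E) : hol G (ζ + δ) = hol G (adPathL G ζ δ) * hol G ζ := by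
  rw [((isLogPath_logPath G ζ).mul (isLogPath_logPath G (adPathL G ζ δ))).hol_eq]
  rfl

variable (E) in
/-- The integral over `[0,1]`. -/
def integralL : PathSpace E →L[ℝ] E := (PathSpace.evalL E 1).comp (PathSpace.integrateL E)

theorem integralL_apply (ζ : PathSpace E) :
    integralL E ζ = ∫ s in (0 : ℝ)..1, ζ (projIcc 0 1 zero_le_one s) := rfl

theorem hol_near_zero : ContMDiffAt 𝓘(ℝ, PathSpace E) 𝓘(ℝ, E) ∞ (hol G) (0 : PathSpace E) ∧
    HasLogFDerivWithinAt (hol G) (integralL E) univ (0 : PathSpace E) := by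
  obtain ⟨U, Y, hU, h0, hYC, hYt, hY, hYd⟩ := exists_local_logPath E G
  have hev : hol G =ᶠ[𝓝 (0 : PathSpace E)] fun ζ => (ψ).symm (PathSpace.evalL E 1 (Y ζ)) := by
    filter_upwards [hU.mem_nhds h0] with ζ hζ
    rw [(hY ζ hζ).hol_eq, projIcc_right]
    rfl
  have h1 : ContDiffAt ℝ ∞ (fun ζ => PathSpace.evalL E 1 (Y ζ)) 0 :=
    (PathSpace.evalL E 1).contDiff.contDiffAt.comp 0 (hYC.contDiffAt (hU.mem_nhds h0))
  have ht : PathSpace.evalL E 1 (Y 0) ∈ (ψ).target := hYt 0 h0 1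
  have h2 : ContMDiffAt 𝓘(ℝ, PathSpace E) 𝓘(ℝ, E) ∞ (hol G) (0 : PathSpace E) :=
    (ContMDiffAt.comp (0 : PathSpace E) (contMDiffAt_chart_symm ht)
      h1.contMDiffAt).congr_of_eventuallyEq hev
  refine ⟨h2, h2.continuousAt.continuousWithinAt, ?_⟩
  have h3 := (PathSpace.evalL E 1).hasFDerivAt.comp (0 : PathSpace E) hYd
  rw [hasFDerivWithinAt_univ]
  refine h3.congr_of_eventuallyEq ?_
  filter_upwards [hev, hU.mem_nhds h0] with ζ hζ hζU
  rw [hol_zero, inv_one, one_mul, hζ]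
  exact (ψ).right_inv (hYt ζ hζU 1)

theorem hol_eq_mul (ζ : PathSpace E) :
    hol G = fun ζ' => hol G (adPathL G ζ (ζ' - ζ)) * hol G ζ := by
  funext ζ'
  rw [← hol_add, add_sub_cancel]

variable (E G) in
theorem contMDiff_hol : ContMDiff 𝓘(ℝ, PathSpace E) 𝓘(ℝ, E) ∞ (hol (E := E) G) := by
  intro ζ
  rw [hol_eq_mul ζ]
  refine ContMDiffAt.mul ?_ contMDiffAt_const
  have h1 : ContDiff ℝ ∞ fun ζ' => adPathL G ζ (ζ' - ζ) :=
    (adPathL G ζ).contDiff.comp (contDiff_id.sub contDiff_const)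
  refine ContMDiffAt.comp (I' := 𝓘(ℝ, PathSpace E)) (g := hol G)
    (f := fun ζ' => adPathL G ζ (ζ' - ζ)) ζ ?_ h1.contDiffAt.contMDiffAt
  rw [sub_self, map_zero]
  exact hol_near_zero.1

/-- The derivative at 0 is integration; precomposition with the conjugation of paths and right
multiplication by hol(ζ) account for the other two factors. -/
theorem hasLogFDerivWithinAt_hol (ζ : PathSpace E) : HasLogFDerivWithinAt (hol G)
    ((groupAd E (hol G ζ)⁻¹).comp ((integralL E).comp (adPathL G ζ))) univ ζ := by
  have h1 : HasFDerivWithinAt (fun ζ' => adPathL G ζ (ζ' - ζ)) (adPathL G ζ) univ ζ :=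
    ((adPathL G ζ).hasFDerivAt.comp ζ ((hasFDerivAt_id ζ).sub_const ζ)).hasFDerivWithinAt
  have h2 : HasLogFDerivWithinAt (hol G) (integralL E) univ (adPathL G ζ (ζ - ζ)) := by
    rw [sub_self, map_zero]
    exact hol_near_zero.2
  have h3 := (HasLogFDerivWithinAt.comp (τ := fun ζ' => adPathL G ζ (ζ' - ζ)) h2 h1
    (mapsTo_univ _ _)).mul_const (hol G ζ)
  rw [← hol_eq_mul ζ] at h3
  exact h3

end Holonomy

/-! ### Effect of gauge variations on the holonomy; the exponential map -/

section GaugeVariation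

variable {E : Type u} {G : Type*} [NormedAddCommGroup E] [NormedSpace ℝ E] [FiniteDimensional ℝ E]
  [TopologicalSpace G] [ChartedSpace E G] [Group G]

local notation "ψ" => chartAt E (1 : G)
local notation "e₀" => chartAt E (1 : G) (1 : G)

variable [LieGroup 𝓘(ℝ, E) ∞ G] {h k : ℝ → G} {ζ ζ' δ b : PathSpace E}

variable (G) in
/-- `δ = d_u b + [ζ, b]`. -/
def IsGaugeVariation (ζ δ b : PathSpace E) : Prop :=
  ∀ u : unitInterval, HasDerivWithinAt (fun t : ℝ => b (projIcc 0 1 zero_le_one t))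
    (δ u - groupad E G (ζ u) (b u)) (Icc 0 1) (u : ℝ)

/-- The integrand is a total derivative: (Ad(h)b)' = Ad(h)(b' + [ζ, b]) = Ad(h)δ. -/
theorem IsGaugeVariation.integralL_adPathL (hb : IsGaugeVariation G ζ δ b) :
    integralL E (adPathL G ζ δ) = groupAd E (hol G ζ) (b 1) - b 0 := by
  set f : ℝ → E := fun t => groupAd E (logPath G ζ t) (b (projIcc 0 1 zero_le_one t)) with hf
  have hd : ∀ u : unitInterval, HasDerivWithinAt f (adPathL G ζ δ u) (Icc 0 1) (u : ℝ) := by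
    intro u
    have h1 := (((isLogPath_logPath G ζ).2 u).groupAd_comp).hasDerivWithinAt.clm_apply (hb u)
    refine h1.congr_deriv ?_
    simp [adPathL_apply]
  have h2 := intervalIntegral.integral_eq_sub_of_hasDeriv_right_of_le (zero_le_one (α := ℝ))
    (f := f) (f' := fun t => adPathL G ζ δ (projIcc 0 1 zero_le_one t))
    (fun t ht => (hd ⟨t, ht⟩).continuousWithinAt)
    (fun t ht => by
      have h3 := hd ⟨t, Ioo_subset_Icc_self ht⟩
      rw [projIcc_of_mem zero_le_one (Ioo_subset_Icc_self ht)]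
      exact (h3.hasDerivAt (Icc_mem_nhds ht.1 ht.2)).hasDerivWithinAt)
    ((adPathL G ζ δ).continuous_ext.intervalIntegrable _ _)
  rw [integralL_apply, h2]
  simp only [hf, projIcc_right, projIcc_left, (isLogPath_logPath G ζ).1, groupAd_one]
  rfl

/-- The holonomy along a curve of gauge variations. -/
theorem hasLogFDerivWithinAt_hol_of_isGaugeVariation {γ : ℝ → PathSpace E} {s : ℝ} {S : Set ℝ}
    (hγ : HasDerivWithinAt γ δ S s) (hb : IsGaugeVariation G (γ s) δ b) (h0 : b 0 = 0) :
    HasLogFDerivWithinAt (fun s => hol G (γ s))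
      (ContinuousLinearMap.toSpanSingleton ℝ (b 1)) S s := by
  have h1 := HasLogFDerivWithinAt.comp (hasLogFDerivWithinAt_hol (G := G) (γ s))
    hγ.hasFDerivWithinAt (mapsTo_univ _ _)
  convert h1 using 1
  ext
  simp [hb.integralL_adPathL, h0, groupAd_inv_apply]

/-- Multiplication by `r` on the unit interval. -/
def scaleMap (r : unitInterval) : C(unitInterval, unitInterval) := ⟨fun u => r * u, by fun_prop⟩

/-- The pull-back of a one-form under `u ↦ r u`. -/
def scaleL (r : unitInterval) : PathSpace E →L[ℝ] PathSpace E :=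
  (r : ℝ) • PathSpace.reparamL (scaleMap r)

theorem scaleL_apply (r u : unitInterval) (ζ : PathSpace E) :
    scaleL r ζ u = (r : ℝ) • ζ (r * u) := rfl

theorem hasDerivWithinAt_mul_left (r : unitInterval) (t : ℝ) :
    HasDerivWithinAt (fun t : ℝ => (r : ℝ) * t) (r : ℝ) (Icc 0 1) t := by
  simpa using ((hasDerivAt_id t).const_mul (r : ℝ)).hasDerivWithinAt

theorem mapsTo_mul_left (r : unitInterval) :
    MapsTo (fun t : ℝ => (r : ℝ) * t) (Icc 0 1) (Icc 0 1) :=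
  fun t ht => (r * (⟨t, ht⟩ : unitInterval)).2

/-- Turns statements about the end point of the curve into statements about every intermediate time.
-/
theorem hol_scaleL (r : unitInterval) (ζ : PathSpace E) : hol G (scaleL r ζ) = logPath G ζ r := by
  have h := (isLogPath_logPath G ζ).reparam (ζ' := scaleL r ζ) (mapsTo_mul_left r)
    (fun t _ => hasDerivWithinAt_mul_left r t) (fun u => by
      rw [projIcc_of_mem zero_le_one (mapsTo_mul_left r u.2)]
      rfl)
  rw [h.hol_eq, mul_one, mul_zero, (isLogPath_logPath G ζ).1, inv_one, one_mul]

theorem IsGaugeVariation.scaleL (hb : IsGaugeVariation G ζ δ b) (r : unitInterval) :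
    IsGaugeVariation G (scaleL r ζ) (_root_.scaleL r δ) (PathSpace.reparamL (scaleMap r) b) := by
  intro u
  have h1 := HasDerivWithinAt.scomp (u : ℝ) (h := fun t : ℝ => (r : ℝ) * t) (hb (r * u))
    (hasDerivWithinAt_mul_left r u) (mapsTo_mul_left r)
  refine (h1.congr (fun t ht => ?_) ?_).congr_deriv ?_
  · simp only [Function.comp_apply, PathSpace.reparamL_apply]
    rw [projIcc_of_mem zero_le_one ht, projIcc_of_mem zero_le_one (mapsTo_mul_left r ht)]
    rfl
  · simp only [Function.comp_apply, PathSpace.reparamL_apply]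
    rw [projIcc_val, projIcc_of_mem zero_le_one (mapsTo_mul_left r u.2)]
    rfl
  · simp only [scaleL_apply, PathSpace.reparamL_apply, map_smul, smul_sub]
    rfl

/-- The curve with logarithmic derivative `γ s`, for a curve `γ` of gauge variations. -/
theorem hasLogFDerivWithinAt_logPath_of_isGaugeVariation {γ : ℝ → PathSpace E} {s : ℝ}
    {S : Set ℝ} (hγ : HasDerivWithinAt γ δ S s) (hb : IsGaugeVariation G (γ s) δ b) (h0 : b 0 = 0)
    (u : unitInterval) :
    HasLogFDerivWithinAt (fun s => logPath G (γ s) u)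
      (ContinuousLinearMap.toSpanSingleton ℝ (b u)) S s := by
  have h1 := hasLogFDerivWithinAt_hol_of_isGaugeVariation
    ((scaleL u).hasFDerivAt.comp_hasDerivWithinAt s hγ) (hb.scaleL u) (by
      have : scaleMap u 0 = 0 := mul_zero u
      simp [this, h0])
  have h2 : scaleMap u 1 = u := mul_one u
  simpa [hol_scaleL, h2] using h1

/-! ### The exponential map -/

variable (G) in
/-- The exponential map. -/
def expG (v : E) : G := hol G (PathSpace.constL E v)

variable (E G) in
theorem expG_zero : expG G (0 : E) = 1 := by
  rw [expG, map_zero, hol_zero]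

variable (E G) in
theorem contMDiff_expG : ContMDiff 𝓘(ℝ, E) 𝓘(ℝ, E) ∞ (expG (E := E) G) :=
  (contMDiff_hol E G).comp (PathSpace.constL E).contDiff.contMDiff

variable (E G) in
/-- The exponential map is a local diffeomorphism, in coordinates. -/
theorem exists_expG_chart : ∃ e : OpenPartialHomeomorph E E, (0 : E) ∈ e.source ∧
    (∀ v ∈ e.source, expG G v ∈ (ψ).source) ∧ (∀ v, e v = ψ (expG G v)) ∧
    ContDiffOn ℝ ∞ e e.source ∧ ContDiffOn ℝ ∞ e.symm e.target := by
  set U : Set E := expG G ⁻¹' (ψ).source with hU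
  have hUo : IsOpen U := (ψ).open_source.preimage (contMDiff_expG E G).continuous
  have h0 : (0 : E) ∈ U := by
    rw [hU, mem_preimage, expG_zero]
    exact mem_chart_source E _
  have hC : ContDiffOn ℝ ∞ (fun v => ψ (expG G v)) U := fun v hv =>
    (contDiffAt_chart_comp (contMDiff_expG E G v) hv).contDiffWithinAt
  have h1 : HasFDerivWithinAt (fun v : E => PathSpace.constL E v) (PathSpace.constL E) univ 0 :=
    (PathSpace.constL E).hasFDerivAt.hasFDerivWithinAt
  have h2 : HasLogFDerivWithinAt (hol G) (integralL E) univ (PathSpace.constL E (0 : E)) := by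
    rw [map_zero]
    exact hol_near_zero.2
  have h3 := (HasLogFDerivWithinAt.comp (τ := fun v : E => PathSpace.constL E v) h2 h1
    (mapsTo_univ _ _)).2
  have h4 : HasFDerivAt (fun v => ψ (expG G v))
      ((ContinuousLinearEquiv.refl ℝ E : E ≃L[ℝ] E) : E →L[ℝ] E) 0 := by
    rw [hasFDerivWithinAt_univ, map_zero, hol_zero] at h3
    simp only [inv_one, one_mul] at h3
    refine h3.congr_fderiv (ContinuousLinearMap.ext fun v => ?_)
    simp [integralL_apply]
  obtain ⟨e, he0, heU, hef, heC, heC'⟩ := exists_openPartialHomeomorph_contDiffOn hUo h0 hC _ h4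
  exact ⟨e, he0, heU, hef, heC, heC'⟩

variable (E G) in
-- `ℓ` inverts the exponential map, whose derivative at 0 is the identity. The last clause serves to
-- recognize `ℓ ∘ q` as a gauge parameter: it needs a continuous derivative on [0,1], end points
-- included.
theorem exists_logG : ∃ (N : Set G) (ℓ : G → E), IsOpen N ∧ 1 ∈ N ∧ ℓ 1 = 0 ∧
    ContMDiffOn 𝓘(ℝ, E) 𝓘(ℝ, E) ∞ ℓ N ∧ (∀ g ∈ N, expG G (ℓ g) = g) ∧
    ∀ (q : ℝ → G) (L : PathSpace E),
      (∀ u : unitInterval, HasLogFDerivWithinAt q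
        (ContinuousLinearMap.toSpanSingleton ℝ (L u)) (Icc 0 1) (u : ℝ)) →
      (∀ t ∈ Icc (0 : ℝ) 1, q t ∈ N) →
      ∃ b' : PathSpace E, ∀ u : unitInterval, HasDerivWithinAt (fun t => ℓ (q t)) (b' u)
        (Icc 0 1) (u : ℝ) := by
  obtain ⟨e, he0, heU, hef, heC, heC'⟩ := exists_expG_chart E G
  set N : Set G := (ψ).source ∩ ψ ⁻¹' e.target with hN
  have hNo : IsOpen N := (ψ).isOpen_inter_preimage e.open_target
  have he00 : e 0 = e₀ := by rw [hef, expG_zero]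
  refine ⟨N, fun g => e.symm (ψ g), hNo,
    ⟨mem_chart_source E _, ?_⟩, ?_, ?_, ?_, ?_⟩
  · rw [mem_preimage, ← he00]
    exact e.map_source he0
  · simp only [← he00]
    exact e.left_inv he0
  · intro g hg
    have h1 := contMDiffAt_of_mem_maximalAtlas
      (IsManifold.chart_mem_maximalAtlas (I := 𝓘(ℝ, E)) (n := ∞) (1 : G)) hg.1
    exact (ContMDiffAt.comp g (heC'.contDiffAt (e.open_target.mem_nhds hg.2)).contMDiffAt
      h1).contMDiffWithinAt
  · intro g hg
    have h1 : e (e.symm (ψ g)) = ψ g := e.right_inv hg.2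
    rw [hef] at h1
    exact (ψ).injOn (heU _ (e.map_target hg.2)) hg.1 h1
  · intro q L hq hqN
    have hqc : Continuous fun u : unitInterval => q u :=
      continuousOn_iff_continuous_domRestrict.1 fun t ht => (hq ⟨t, ht⟩).1
    have hψc : Continuous fun u : unitInterval => ψ (q u) :=
      (ψ).continuousOn.comp_continuous hqc fun u => (hqN u u.2).1
    have h1 : Continuous fun u : unitInterval => fderiv ℝ e.symm (ψ (q u)) :=
      (heC'.continuousOn_fderiv_of_isOpen e.open_target (by simp)).comp_continuous hψc
        fun u => (hqN u u.2).2
    have h2 : Continuous fun u : unitInterval => chartInvField E G (ψ (q u)) :=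
      contDiffOn_chartInvField.continuousOn.comp_continuous hψc
        fun u => (ψ).map_source (hqN u u.2).1
    refine ⟨PathSpace.mk (fun u => fderiv ℝ e.symm (ψ (q u)) (chartInvField E G (ψ (q u)) (L u)))
      (h1.clm_apply (h2.clm_apply L.continuous)), fun u => ?_⟩
    have h3 := (hq u).chart_comp (hqN u u.2).1
    have h4 := ((heC'.contDiffAt (e.open_target.mem_nhds (hqN u u.2).2)).differentiableAt
      (by simp)).hasFDerivAt.comp_hasFDerivWithinAt (u : ℝ) h3
    refine h4.hasDerivWithinAt.congr_deriv ?_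
    simp

end GaugeVariation

/-- The flow of an affine vector field on a Banach space. -/
theorem exists_affine_flow {W : Type*} [NormedAddCommGroup W] [NormedSpace ℝ W] [CompleteSpace W]
    (A : W →L[ℝ] W) (c w : W) : ∃ γ : ℝ → W, γ 0 = w ∧ ∀ s, HasDerivAt γ (A (γ s) + c) s := by
  -- An extra coordinate that stays equal to 1 makes the affine equation linear, to be solved by the
  -- operator exponential.
  set M : (W × ℝ) →L[ℝ] (W × ℝ) :=
    (A.comp (ContinuousLinearMap.fst ℝ W ℝ) +
      (ContinuousLinearMap.snd ℝ W ℝ).smulRight c).prod 0 with hM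
  set f : ℝ → W × ℝ := fun s => NormedSpace.exp (s • M) (w, 1) with hf
  have hd : ∀ s, HasDerivAt f (M (f s)) s := fun s => by
    simpa using (hasDerivAt_exp_smul_const' (𝕂 := ℝ) M s).clm_apply (hasDerivAt_const s (w, (1 : ℝ)))
  have h0 : f 0 = (w, 1) := by simp [hf]
  have h2 : ∀ s, (f s).2 = 1 := by
    have h3 : ∀ s, HasDerivAt (fun s => (f s).2) 0 s := fun s =>
      (ContinuousLinearMap.snd ℝ W ℝ).hasFDerivAt.comp_hasDerivAt s (hd s)
    intro s
    rw [is_const_of_deriv_eq_zero (fun s => (h3 s).differentiableAt) (fun s => (h3 s).deriv) s 0, h0]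
  refine ⟨fun s => (f s).1, congrArg Prod.fst h0, fun s => ?_⟩
  refine ((ContinuousLinearMap.fst ℝ W ℝ).hasFDerivAt.comp_hasDerivAt s (hd s)).congr_deriv ?_
  simp [hM, h2]

/-! ### Paths with the same holonomy are gauge equivalent -/

section GaugeEquivalence

variable {E : Type u} {G : Type*} [NormedAddCommGroup E] [NormedSpace ℝ E] [FiniteDimensional ℝ E]
  [TopologicalSpace G] [ChartedSpace E G] [Group G]

variable [LieGroup 𝓘(ℝ, E) ∞ G] {h k : ℝ → G} {ζ ζ' δ b b' : PathSpace E}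

/-! ### The holonomy of all paths -/

theorem IsLogPath.inv (hh : IsLogPath h ζ) : IsLogPath (fun t => (h t)⁻¹) (hh.adL (-ζ)) := by
  refine ⟨by simp [hh.1], fun u => ?_⟩
  have h1 := (hh.2 u).inv (uniqueDiffOn_Icc_zero_one u u.2)
  convert h1 using 1
  ext
  simp

variable (G) in
/-- The inverse of `adPathL G ζ`. -/
def adPathInvL (ζ : PathSpace E) : PathSpace E →L[ℝ] PathSpace E :=
  (isLogPath_logPath G ζ).inv.adL

theorem adPathL_adPathInvL (ζ δ : PathSpace E) : adPathL G ζ (adPathInvL G ζ δ) = δ := by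
  ext u
  exact groupAd_apply_inv _ _

/-- A prescribed left factor of the holonomy can be produced by an explicit change of ζ. This gives
closure of the image under products, and later the local sections. -/
theorem hol_adPathInvL (ζ δ : PathSpace E) :
    hol G (ζ + adPathInvL G ζ δ) = hol G δ * hol G ζ := by
  rw [hol_add, adPathL_adPathInvL]

variable (E) in
-- The image is a subgroup containing a neighbourhood of 1, since exp is locally onto. It is
-- therefore open and closed.
theorem hol_surjective [ConnectedSpace G] : Function.Surjective (hol (E := E) G) := by
  have := topologicalGroup_of_lieGroup 𝓘(ℝ, E) ∞ (G := G)
  let K : Subgroup G :=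
    { carrier := range (hol (E := E) G)
      one_mem' := ⟨0, hol_zero E G⟩
      mul_mem' := by
        rintro _ _ ⟨ζ₁, rfl⟩ ⟨ζ₂, rfl⟩
        exact ⟨_, hol_adPathInvL ζ₂ ζ₁⟩
      inv_mem' := by
        rintro _ ⟨ζ, rfl⟩
        refine ⟨adPathL G ζ (-ζ), ?_⟩
        have h1 := hol_add (G := G) ζ (-ζ)
        rw [add_neg_cancel, hol_zero] at h1
        exact eq_inv_of_mul_eq_one_left h1.symm }
  obtain ⟨N, ℓ, hN, h1, -, -, hℓ, -⟩ := exists_logG E G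
  have hK : IsOpen (K : Set G) := K.isOpen_of_mem_nhds (g := 1)
    (Filter.mem_of_superset (hN.mem_nhds h1) fun g hg => ⟨_, hℓ g hg⟩)
  have h2 : (K : Set G) = univ := IsClopen.eq_univ ⟨K.isClosed_of_isOpen hK, hK⟩ ⟨1, K.one_mem⟩
  intro g
  have : g ∈ (K : Set G) := h2 ▸ mem_univ g
  exact this

/-! ### Gauge transformations of paths in the Lie algebra -/

variable (G) in
/-- The flow of the gauge variation with parameter a continuously differentiable path `b` vanishing
at the end points carries `ζ` to `ζ'`. -/
def GaugeStep (ζ ζ' : PathSpace E) : Prop :=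
  ∃ b b' : PathSpace E, (∀ u : unitInterval, HasDerivWithinAt
      (fun t : ℝ => b (projIcc 0 1 zero_le_one t)) (b' u) (Icc 0 1) (u : ℝ)) ∧
    b 0 = 0 ∧ b 1 = 0 ∧ ∃ γ : ℝ → PathSpace E, γ 0 = ζ ∧ γ 1 = ζ' ∧
      ∀ s, HasDerivAt γ (PathSpace.bilinL (groupad E G) (γ s) b + b') s

theorem isGaugeVariation_of_hasDerivWithinAt (hb : ∀ u : unitInterval, HasDerivWithinAt
      (fun t : ℝ => b (projIcc 0 1 zero_le_one t)) (b' u) (Icc 0 1) (u : ℝ)) (ζ : PathSpace E) :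
    IsGaugeVariation G ζ (PathSpace.bilinL (groupad E G) ζ b + b') b := fun u =>
  (hb u).congr_deriv (by simp)

/-- For fixed u, the curve in flow time s ↦ h_s(u) has constant logarithmic derivative b(u), like
h_0(u) exp(s b(u)); uniqueness identifies the two. -/
theorem exists_gaugeStep (ζ : PathSpace E) (hb : ∀ u : unitInterval, HasDerivWithinAt
      (fun t : ℝ => b (projIcc 0 1 zero_le_one t)) (b' u) (Icc 0 1) (u : ℝ)) (h0 : b 0 = 0)
    (h1 : b 1 = 0) :
    ∃ ζ', GaugeStep G ζ ζ' ∧ ∀ u : unitInterval, logPath G ζ' u = logPath G ζ u * expG G (b u) := by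
  obtain ⟨γ, hγ0, hγ⟩ := exists_affine_flow
    ((PathSpace.bilinL (groupad E G)).flip b) b' ζ
  refine ⟨γ 1, ⟨b, b', hb, h0, h1, γ, hγ0, rfl, hγ⟩, fun u => ?_⟩
  have h2 := HasLogFDerivWithinAt.eq_of_eq (E := E) (f := fun s => logPath G (γ s) u)
    (k := fun s => logPath G ζ u * logPath G (PathSpace.constL E (b u)) s)
    (L := fun _ => ContinuousLinearMap.toSpanSingleton ℝ (b u))
    (fun s _ => hasLogFDerivWithinAt_logPath_of_isGaugeVariation (hγ s).hasDerivWithinAt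
      (isGaugeVariation_of_hasDerivWithinAt hb (γ s)) h0 u)
    (fun s hs => ((isLogPath_logPath G (PathSpace.constL E (b u))).2 ⟨s, hs⟩).const_mul _)
    (by simp only [hγ0, (isLogPath_logPath G _).1, mul_one]) 1 (by simp)
  exact h2

/-- A path in the Lie algebra is determined by its curve in the group, so the relation between
curves already forces ζ' to be the result of the flow. -/
theorem gaugeStep_of_logPath (hb : ∀ u : unitInterval, HasDerivWithinAt
      (fun t : ℝ => b (projIcc 0 1 zero_le_one t)) (b' u) (Icc 0 1) (u : ℝ)) (h0 : b 0 = 0)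
    (h1 : b 1 = 0)
    (h : ∀ u : unitInterval, logPath G ζ' u = logPath G ζ u * expG G (b u)) :
    GaugeStep G ζ ζ' := by
  obtain ⟨ζ'', h2, h3⟩ := exists_gaugeStep (G := G) ζ hb h0 h1
  have : ζ' = ζ'' := (isLogPath_logPath G ζ').form_unique
    ((isLogPath_logPath G ζ'').congr fun t ht => (h ⟨t, ht⟩).trans (h3 ⟨t, ht⟩).symm)
  rwa [this]

theorem GaugeStep.hol_eq (h : GaugeStep G ζ ζ') : hol G ζ' = hol G ζ := by
  obtain ⟨b, b', hb, h0, h1, γ, rfl, rfl, hγ⟩ := h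
  refine HasLogFDerivWithinAt.eq_of_zero (E := E) (G := G) (f := fun s => hol G (γ s)) (fun s _ => ?_) 1
    (by simp)
  have h2 := hasLogFDerivWithinAt_hol_of_isGaugeVariation (G := G) (hγ s).hasDerivWithinAt (S := Icc 0 1)
    (isGaugeVariation_of_hasDerivWithinAt hb (γ s)) h0
  rwa [h1, ContinuousLinearMap.toSpanSingleton_zero] at h2

theorem hol_eq_of_reflTransGen (h : Relation.ReflTransGen (GaugeStep G) ζ ζ') :
    hol G ζ' = hol G ζ := by
  induction h with
  | refl => rfl
  | tail _ h ih => exact h.hol_eq.trans ih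

theorem hasDerivAt_bernstein (n ν : ℕ) (t : ℝ) :
    HasDerivAt (fun t : ℝ => (bernsteinPolynomial ℝ n ν).eval t)
      ((bernsteinPolynomial ℝ n ν).derivative.eval t) t := Polynomial.hasDerivAt _ t

/-- Bernstein approximations are continuously differentiable. -/
theorem exists_deriv_bernsteinApproximation (n : ℕ) (f : C(unitInterval, E)) :
    ∃ b' : PathSpace E, ∀ u : unitInterval, HasDerivWithinAt
      (fun t : ℝ => bernsteinApproximation n f (projIcc 0 1 zero_le_one t)) (b' u) (Icc 0 1)
      (u : ℝ) := by
  refine ⟨PathSpace.mk (fun u => ∑ k : Fin (n + 1),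
    (bernsteinPolynomial ℝ n k).derivative.eval (u : ℝ) • f (bernstein.z k)) ?_, fun u => ?_⟩
  · fun_prop
  · have h1 : HasDerivAt (fun t : ℝ => ∑ k : Fin (n + 1),
        (bernsteinPolynomial ℝ n k).eval t • f (bernstein.z k)) _ (u : ℝ) :=
      HasDerivAt.fun_sum fun k _ =>
        (hasDerivAt_bernstein n k (u : ℝ)).smul_const (f (bernstein.z k))
    refine h1.hasDerivWithinAt.congr (fun t ht => ?_) ?_
    · rw [projIcc_of_mem zero_le_one ht, bernsteinApproximation.apply]
      rfl
    · rw [projIcc_val, bernsteinApproximation.apply]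
      rfl

/-- A continuous path close to a path in the Lie group can be approximated by gauge transforms. -/
theorem exists_gaugeStep_near {N : Set G} {ℓ : G → E} (hℓ : ContinuousOn ℓ N) (hℓ1 : ℓ 1 = 0)
    (hexp : ∀ g ∈ N, expG G (ℓ g) = g) (ζ : PathSpace E) (f : C(unitInterval, G)) (hf0 : f 0 = 1)
    (hf1 : f 1 = hol G ζ) (hf : ∀ u : unitInterval, (logPath G ζ u)⁻¹ * f u ∈ N) {W : Set G}
    (hW : W ∈ 𝓝 (1 : G)) :
    ∃ ζ', GaugeStep G ζ ζ' ∧ ∀ u : unitInterval, (f u)⁻¹ * logPath G ζ' u ∈ W := by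
  have := topologicalGroup_of_lieGroup 𝓘(ℝ, E) ∞ (G := G)
  obtain ⟨W', hW', hWo, hW1⟩ := mem_nhds_iff.1 hW
  have hP := (isLogPath_logPath G ζ).continuous_restrict
  have hexpc : Continuous (expG (E := E) G) := (contMDiff_expG E G).continuous
  -- The ideal parameter: it would carry the curve of ζ exactly to `f`, but it is only continuous.
  let b₀ : C(unitInterval, E) := ⟨fun u => ℓ ((logPath G ζ u)⁻¹ * f u),
    hℓ.comp_continuous (hP.inv.mul f.continuous) hf⟩
  have hb₀ : ∀ u, expG G (b₀ u) = (logPath G ζ u)⁻¹ * f u := fun u => hexp _ (hf u)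
  let c : C(unitInterval, G) := ⟨fun u => (f u)⁻¹ * logPath G ζ u, f.continuous.inv.mul hP⟩
  let F : C(unitInterval, E) → C(unitInterval, G) :=
    fun b => c * (⟨expG G, hexpc⟩ : C(E, G)).comp b
  have hF : Continuous F := continuous_const.mul (ContinuousMap.continuous_postcomp _)
  have hopen : IsOpen (F ⁻¹' {f : C(unitInterval, G) | MapsTo f univ W'}) :=
    (ContinuousMap.isOpen_setOfPred_mapsTo isCompact_univ hWo).preimage hF
  have hmem : b₀ ∈ F ⁻¹' {f : C(unitInterval, G) | MapsTo f univ W'} := fun u _ => by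
    have : F b₀ u = (f u)⁻¹ * logPath G ζ u * expG G (b₀ u) := rfl
    rw [this, hb₀]
    simpa using hW1
  -- Bernstein polynomials keep the values at the end points, hence the vanishing there; for the
  -- value at 1 the degree must be positive.
  obtain ⟨n, hn, hn0⟩ := (((bernsteinApproximation_uniform b₀).eventually_mem
    (hopen.mem_nhds hmem)).and (Filter.eventually_ne_atTop 0)).exists
  obtain ⟨b', hb'⟩ := exists_deriv_bernsteinApproximation n b₀
  obtain ⟨ζ', hζ', h2⟩ := exists_gaugeStep (G := G) ζ (b := bernsteinApproximation n b₀) hb' (by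
      refine (bernsteinApproximation.apply_zero n b₀).trans ?_
      simp [b₀, hf0, (isLogPath_logPath G ζ).1, hℓ1]) (by
      refine (bernsteinApproximation.apply_one hn0 b₀).trans ?_
      have : (logPath G ζ 1)⁻¹ * f 1 = 1 := by rw [hf1]; exact inv_mul_cancel _
      simp [b₀, this, hℓ1])
  refine ⟨ζ', hζ', fun u => hW' ?_⟩
  rw [h2, ← mul_assoc]
  exact hn (mem_univ u)

/-- Paths in the Lie algebra with the same holonomy are gauge equivalent. -/
theorem reflTransGen_gaugeStep [SimplyConnectedSpace G] (hζ : hol G ζ = hol G ζ') :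
    Relation.ReflTransGen (GaugeStep G) ζ ζ' := by
  have := topologicalGroup_of_lieGroup 𝓘(ℝ, E) ∞ (G := G)
  obtain ⟨N, ℓ, hNo, hN1, hℓ1, hℓ, hexp, hlog⟩ := exists_logG E G
  have hNn := hNo.mem_nhds hN1
  let P : ∀ ζ₁ : PathSpace E, hol G ζ₁ = hol G ζ → Path (1 : G) (hol G ζ) := fun ζ₁ h₁ =>
    { toFun := fun u => logPath G ζ₁ u
      continuous_toFun := (isLogPath_logPath G ζ₁).continuous_restrict
      source' := (isLogPath_logPath G ζ₁).1
      target' := h₁ }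
  obtain ⟨H⟩ := SimplyConnectedSpace.paths_homotopic (P ζ rfl) (P ζ' hζ.symm)
  -- `Q s`: the curve `H (s, ·)` of the homotopy is a uniform limit of curves of gauge transforms of
  -- ζ.
  let Q : unitInterval → Prop := fun s => ∀ W ∈ 𝓝 (1 : G), ∃ ζ₁,
    Relation.ReflTransGen (GaugeStep G) ζ ζ₁ ∧ ∀ u : unitInterval, (H (s, u))⁻¹ * logPath G ζ₁ u ∈ W
  -- the neighbourhood of the diagonal which is used
  obtain ⟨W₀, hW₀, hWN⟩ : ∃ W₀ ∈ 𝓝 (1 : G), ∀ x ∈ W₀, ∀ y ∈ W₀, x⁻¹ * y ∈ N := by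
    have hc : ContinuousAt (fun p : G × G => p.1⁻¹ * p.2) (1, 1) := by fun_prop
    have h1 := hc.preimage_mem_nhds (t := N) (by simpa using hNn)
    rw [nhds_prod_eq, Filter.mem_prod_same_iff] at h1
    obtain ⟨W₀, hW₀, h2⟩ := h1
    exact ⟨W₀, hW₀, fun x hx y hy => h2 (mk_mem_prod hx hy)⟩
  -- A gauge transform close to `H (s, ·)` is also close to `H (s', ·)`, within reach of the
  -- logarithm, so one further step approximates the latter as well as desired.
  have step : ∀ s s' : unitInterval, (∀ u, (H (s, u))⁻¹ * H (s', u) ∈ W₀) → Q s → Q s' := by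
    intro s s' hss hQ W hW
    obtain ⟨ζ₁, hζ₁, h1⟩ := hQ W₀ hW₀
    have hhol := hol_eq_of_reflTransGen hζ₁
    obtain ⟨ζ₂, hζ₂, h2⟩ := exists_gaugeStep_near hℓ.continuousOn hℓ1 hexp ζ₁
      ⟨fun u => H (s', u), by fun_prop⟩ (H.source s') ((H.target s').trans hhol.symm)
      (fun u => by
        have := hWN _ (h1 u) _ (hss u)
        simpa [mul_assoc] using this) hW
    exact ⟨ζ₂, hζ₁.tail hζ₂, h2⟩
  -- Compactness in u makes the closeness uniform. Having it in both directions makes `Q` locally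
  -- constant, hence constant on [0,1].
  have hnear : ∀ s : unitInterval, ∀ᶠ s' in 𝓝 s, Q s ↔ Q s' := by
    intro s
    have h1 : ∀ᶠ s' in 𝓝 s, ∀ u ∈ (univ : Set unitInterval),
        (H (s, u))⁻¹ * H (s', u) ∈ W₀ ∧ (H (s', u))⁻¹ * H (s, u) ∈ W₀ := by
      refine isCompact_univ.eventually_forall_of_forall_eventually fun u _ => ?_
      have c1 : Continuous fun p : unitInterval × unitInterval =>
        (H (s, p.2))⁻¹ * H (p.1, p.2) :=
        (H.continuous.comp (by fun_prop)).inv.mul (H.continuous.comp (by fun_prop))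
      have c2 : Continuous fun p : unitInterval × unitInterval =>
        (H (p.1, p.2))⁻¹ * H (s, p.2) :=
        (H.continuous.comp (by fun_prop)).inv.mul (H.continuous.comp (by fun_prop))
      exact (c1.continuousAt.eventually_mem (x := (s, u)) (by simpa using hW₀)).and
        (c2.continuousAt.eventually_mem (x := (s, u)) (by simpa using hW₀))
    filter_upwards [h1] with s' hs'
    exact ⟨step s s' fun u => (hs' u (mem_univ u)).1, step s' s fun u => (hs' u (mem_univ u)).2⟩
  have hQ0 : Q 0 := fun W hW => ⟨ζ, .refl, fun u => by
    have : H (0, u) = logPath G ζ u := H.apply_zero u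
    rw [this, inv_mul_cancel]
    exact mem_of_mem_nhds hW⟩
  have hQ1 : Q 1 := by
    have hl : IsLocallyConstant Q := by
      rw [IsLocallyConstant.iff_eventually_eq]
      intro s
      filter_upwards [hnear s] with s' h
      exact propext h.symm
    exact (hl.apply_eq_of_preconnectedSpace 0 1) ▸ hQ0
  have hWinv : {g : G | g⁻¹ ∈ N} ∈ 𝓝 (1 : G) := continuous_inv.continuousAt.preimage_mem_nhds
    (by simpa using hNn)
  obtain ⟨ζ₁, hζ₁, h1⟩ := hQ1 _ hWinv
  have hhol := hol_eq_of_reflTransGen hζ₁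
  have hmem : ∀ u : unitInterval, (logPath G ζ₁ u)⁻¹ * logPath G ζ' u ∈ N := fun u => by
    have h2 := h1 u
    have : H (1, u) = logPath G ζ' u := H.apply_one u
    rw [this] at h2
    simpa using h2
  -- Now both curves are continuously differentiable, so the logarithm of their quotient is an
  -- admissible parameter and the last step needs no approximation.
  have hq : ∀ u : unitInterval, HasLogFDerivWithinAt
      (fun t => (logPath G ζ₁ t)⁻¹ * logPath G ζ' t) _ (Icc 0 1) (u : ℝ) := fun u =>
    ((isLogPath_logPath G ζ₁).inv.2 u).mul ((isLogPath_logPath G ζ').2 u)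
  obtain ⟨b', hb'⟩ := hlog _ ((isLogPath_logPath G ζ').inv.adL
    ((isLogPath_logPath G ζ₁).adL (-ζ₁)) + ζ') (fun u => by
      convert hq u using 1
      ext
      simp) (fun t ht => hmem ⟨t, ht⟩)
  have hbc : Continuous fun u : unitInterval => ℓ ((logPath G ζ₁ u)⁻¹ * logPath G ζ' u) :=
    hℓ.continuousOn.comp_continuous ((isLogPath_logPath G ζ₁).continuous_restrict.inv.mul
      (isLogPath_logPath G ζ').continuous_restrict) hmem
  refine hζ₁.tail (gaugeStep_of_logPath (b := PathSpace.mk _ hbc) (b' := b') (fun u => ?_) ?_ ?_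
    fun u => ?_)
  · refine (hb' u).congr (fun t ht => ?_) ?_
    · simp [projIcc_of_mem zero_le_one ht]
    · simp
  · simp [(isLogPath_logPath G _).1, hℓ1]
  · have : (logPath G ζ₁ 1)⁻¹ * logPath G ζ' 1 = 1 := by
      have h3 : logPath G ζ₁ 1 = logPath G ζ' 1 := hhol.trans hζ
      rw [h3, inv_mul_cancel]
    simp [this, hℓ1]
  · simp [hexp _ (hmem u)]

end GaugeEquivalence

/-! ### Gauge orbits and the groupoid in terms of initial point and holonomy -/

section LieAlgebraPaths

variable {𝔤 : Type*} [NormedLieRing 𝔤] [NormedLieAlgebra 𝔤] [FiniteDimensional ℝ 𝔤]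
  {E : Type u} {G : Type*} [NormedAddCommGroup E] [NormedSpace ℝ E] [FiniteDimensional ℝ E]
  [TopologicalSpace G] [ChartedSpace E G] [Group G] [LieGroup 𝓘(ℝ, E) ∞ G]
  (φ : 𝔤 ≃ₗ⁅ℝ⁆ GroupLieAlgebra 𝓘(ℝ, E) G)

/-- The identification of the Lie algebra with the model space of the group. -/
def lieEquivL : 𝔤 ≃L[ℝ] E :=
  LinearEquiv.toContinuousLinearEquiv (F := E) φ.toLinearEquiv

theorem groupad_lieEquivL (a b : 𝔤) :
    groupad E G (lieEquivL φ a) (lieEquivL φ b) = lieEquivL φ ⁅a, b⁆ := by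
  have := FiniteDimensional.complete ℝ E
  refine (groupad_eq_lie (E := E) (G := G) (φ a) (φ b)).trans ?_
  exact (LieHom.map_lie φ.toLieHom a b).symm

/-- The identification of paths in the Lie algebra with paths in the model space of the group. -/
def pathEquivL : PathSpace 𝔤 ≃L[ℝ] PathSpace E :=
  ContinuousLinearEquiv.equivOfInverse (PathSpace.mapL (lieEquivL φ : 𝔤 →L[ℝ] E))
    (PathSpace.mapL ((lieEquivL φ).symm : E →L[ℝ] 𝔤)) (fun f => by ext; simp)
    (fun f => by ext; simp)

@[simp] theorem pathEquivL_apply (η : PathSpace 𝔤) (u : unitInterval) :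
    pathEquivL φ η u = lieEquivL φ (η u) := rfl

@[simp] theorem pathEquivL_symm_apply (ζ : PathSpace E) (u : unitInterval) :
    (pathEquivL φ).symm ζ u = (lieEquivL φ).symm (ζ u) := rfl

/-- The holonomy of a path in the Lie algebra. -/
def holonomy (η : PathSpace 𝔤) : G := hol G (pathEquivL φ η)

theorem hasLogFDerivWithinAt_lieEquivL_iff {h : ℝ → G} {a : 𝔤} {s : Set ℝ} {t : ℝ} :
    HasLogFDerivWithinAt h (ContinuousLinearMap.toSpanSingleton ℝ (lieEquivL φ a)) s t ↔
      HasMFDerivWithinAt 𝓘(ℝ, ℝ) 𝓘(ℝ, E) h s t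
        (ContinuousLinearMap.toSpanSingleton ℝ (mulInvariantVectorField (φ a) (h t))) := by
  rw [hasLogFDerivWithinAt_iff]
  have : (leftDeriv E (h t)).comp (ContinuousLinearMap.toSpanSingleton ℝ (lieEquivL φ a)) =
      ContinuousLinearMap.toSpanSingleton ℝ
        (mulInvariantVectorField (I := 𝓘(ℝ, E)) (φ a) (h t) : E) := by
    refine ContinuousLinearMap.ext fun r => ?_
    simp only [ContinuousLinearMap.comp_apply, ContinuousLinearMap.toSpanSingleton_apply, map_smul]
    rfl
  constructor <;> intro h
  · exact h.congr_mfderiv this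
  · exact h.congr_mfderiv this.symm

theorem isHolonomy_iff (η : PathSpace 𝔤) (g : G) : IsHolonomy φ η g ↔ holonomy φ η = g := by
  constructor
  · rintro ⟨h, h0, rfl, hd⟩
    exact IsLogPath.hol_eq (h := h)
      ⟨h0, fun u => (hasLogFDerivWithinAt_lieEquivL_iff φ).2 (hd u)⟩
  · rintro rfl
    exact ⟨logPath G (pathEquivL φ η), (isLogPath_logPath G _).1, rfl, fun u =>
      (hasLogFDerivWithinAt_lieEquivL_iff φ).1 ((isLogPath_logPath G _).2 u)⟩

/-- The coadjoint action (from the right). -/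
def coadjoint (g : G) (ξ : StrongDual ℝ 𝔤) : StrongDual ℝ 𝔤 :=
  ξ.comp (((lieEquivL φ).symm : E →L[ℝ] 𝔤).comp
    ((groupAd E g).comp (lieEquivL φ : 𝔤 →L[ℝ] E)))

theorem coadjoint_apply (g : G) (ξ : StrongDual ℝ 𝔤) (a : 𝔤) :
    coadjoint φ g ξ a = ξ ((lieEquivL φ).symm (groupAd E g (lieEquivL φ a))) := rfl

@[simp] theorem coadjoint_one (ξ : StrongDual ℝ 𝔤) : coadjoint φ (1 : G) ξ = ξ := by
  ext a
  simp [coadjoint_apply, groupAd_one]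

theorem coadjoint_mul (g h : G) (ξ : StrongDual ℝ 𝔤) :
    coadjoint φ (g * h) ξ = coadjoint φ h (coadjoint φ g ξ) := by
  ext a
  simp [coadjoint_apply, groupAd_mul]

/-- Dual of (Ad(h)b)' = Ad(h)[a, b]; the sign comes from [a, b] = -[b, a]. -/
theorem HasLogFDerivWithinAt.coadjoint {h : ℝ → G} {a : 𝔤} {s : Set ℝ} {t : ℝ}
    (hh : HasLogFDerivWithinAt h (ContinuousLinearMap.toSpanSingleton ℝ (lieEquivL φ a)) s t)
    (ξ : StrongDual ℝ 𝔤) :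
    HasDerivWithinAt (fun t => coadjoint φ (h t) ξ)
      (-(kirillovKostant (_root_.coadjoint φ (h t) ξ) a)) s t := by
  have h1 := (hh.groupAd_comp).hasDerivWithinAt.clm_comp
    (hasDerivWithinAt_const t s (lieEquivL φ : 𝔤 →L[ℝ] E))
  have h2 := (hasDerivWithinAt_const t s (ξ.comp ((lieEquivL φ).symm : E →L[ℝ] 𝔤))).clm_comp h1
  refine h2.congr_deriv ?_
  ext b
  simp [coadjoint_apply, groupad_lieEquivL]
  rw [← map_neg, ← map_neg, ← map_neg, ← map_neg, lie_skew]

/-- The coadjoint orbit curve satisfies the constraint with initial point ξ, and the Volterra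
equation has only one solution. -/
theorem solvePath_eq (ξ : StrongDual ℝ 𝔤) (η : PathSpace 𝔤) (u : unitInterval) :
    solvePath ξ η u = coadjoint φ (logPath G (pathEquivL φ η) u) ξ := by
  have hd : ∀ u : unitInterval, HasDerivWithinAt
      (fun t => coadjoint φ (logPath G (pathEquivL φ η) t) ξ)
      (-(kirillovKostant (coadjoint φ (logPath G (pathEquivL φ η) u) ξ) (η u))) (Icc 0 1) (u : ℝ) :=
    fun u => ((isLogPath_logPath G (pathEquivL φ η)).2 u).coadjoint φ ξ
  have hc : Continuous fun u : unitInterval => coadjoint φ (logPath G (pathEquivL φ η) u) ξ :=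
    continuousOn_iff_continuous_domRestrict.1 fun t ht => (hd ⟨t, ht⟩).continuousWithinAt
  have h1 : PathSpace.mk _ hc = solvePath ξ η := by
    rw [eq_solvePath_iff]
    refine ((constraint_iff (PathSpace.mk _ hc) η).1 fun u => ?_).trans ?_
    · refine (hd u).congr (fun t ht => ?_) ?_
      · simp [projIcc_of_mem zero_le_one ht]
      · simp
    · simp [(isLogPath_logPath G _).1]
  rw [← h1]
  rfl

namespace ConstraintManifold

theorem X_eq (c : ConstraintManifold 𝔤) (u : unitInterval) :
    c.X u = coadjoint φ (logPath G (pathEquivL φ c.η) u) (c.X 0) := by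
  conv_lhs => rw [← solveConstraint_eq c]
  exact solvePath_eq φ _ _ u

theorem X_one (c : ConstraintManifold 𝔤) : c.X 1 = coadjoint φ (holonomy φ c.η) (c.X 0) :=
  c.X_eq φ 1

end ConstraintManifold

@[simp] theorem solveConstraint_X_zero (p : StrongDual ℝ 𝔤 × PathSpace 𝔤) :
    (solveConstraint p).X 0 = p.1 := solvePath_zero _ _

@[simp] theorem solveConstraint_η (p : StrongDual ℝ 𝔤 × PathSpace 𝔤) :
    (solveConstraint p).η = p.2 := rfl

/-- Only the composite b(u) = β(X(u), u) enters the variation of η. It vanishes at both ends, so the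
logarithmic derivative of the holonomy in flow time is 0. -/
theorem GaugeFlow.holonomy_eq {c c' : ConstraintManifold 𝔤} (h : GaugeFlow c c') :
    holonomy φ c.η = holonomy φ c'.η := by
  obtain ⟨β, γ, rfl, rfl, h⟩ := h
  refine (HasLogFDerivWithinAt.eq_of_zero (E := E) (G := G)
    (f := fun s => holonomy φ (γ s).η) (fun s hs => ?_) 1 (by simp)).symm
  obtain ⟨V, hV, hγ⟩ := h s hs
  have hc : Continuous fun u => lieEquivL φ (β.toFun u ((γ s).X u)) := by
    have h1 : ContinuousOn (fun t : ℝ => β.toFun (projIcc 0 1 zero_le_one t)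
      ((γ s).X (projIcc 0 1 zero_le_one t))) (Icc 0 1) :=
      fun t ht => (hV ⟨t, ht⟩).2.continuousWithinAt
    have h2 := continuousOn_iff_continuous_domRestrict.1 h1
    refine (lieEquivL φ).continuous.comp (h2.congr fun u => ?_)
    simp
  have h1 : HasDerivWithinAt (fun s => pathEquivL φ (γ s).η) (pathEquivL φ V.2) (Icc 0 1) s :=
    ((pathEquivL φ : PathSpace 𝔤 →L[ℝ] PathSpace E).comp
      (ContinuousLinearMap.snd ℝ (PathSpace (StrongDual ℝ 𝔤)) _)).hasFDerivAt.comp_hasDerivWithinAt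
        s hγ
  have h2 : IsGaugeVariation G (pathEquivL φ (γ s).η) (pathEquivL φ V.2) (PathSpace.mk _ hc) := by
    intro u
    have h3 := (lieEquivL φ : 𝔤 →L[ℝ] E).hasFDerivAt.comp_hasDerivWithinAt (u : ℝ) (hV u).2
    refine h3.congr_deriv ?_
    simp [groupad_lieEquivL]
  have h3 := hasLogFDerivWithinAt_hol_of_isGaugeVariation h1 h2 (by simp [β.map_zero])
  have h4 : PathSpace.mk _ hc 1 = (0 : E) := by simp [β.map_one]
  rwa [h4, ContinuousLinearMap.toSpanSingleton_zero] at h3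

/-- The gauge parameter which does not depend on the point of the Poisson manifold. -/
def constGaugeParameter (b b' : PathSpace 𝔤) (hb : ∀ u : unitInterval, HasDerivWithinAt
    (fun t : ℝ => b (projIcc 0 1 zero_le_one t)) (b' u) (Icc 0 1) (u : ℝ)) (h0 : b 0 = 0)
    (h1 : b 1 = 0) : GaugeParameter 𝔤 where
  toFun u _ := b u
  deriv u _ := b' u
  contDiff_toFun _ := contDiff_const
  contDiff_deriv _ := contDiff_const
  continuous_toFun k := by
    rcases k with _ | k
    · have := b.continuous
      simp only [iteratedFDeriv_zero_eq_comp, Function.comp_def]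
      fun_prop
    · simp only [iteratedFDeriv_succ_const]
      exact continuous_const
  continuous_deriv k := by
    rcases k with _ | k
    · have := b'.continuous
      simp only [iteratedFDeriv_zero_eq_comp, Function.comp_def]
      fun_prop
    · simp only [iteratedFDeriv_succ_const]
      exact continuous_const
  hasDeriv u _ := hb u
  map_zero _ := h0
  map_one _ := h1

/-- Parameters independent of the point of 𝔤* suffice. With X(0) fixed, the induced variation of
X(u) = Ad*(h(u))ξ is -α(X)b, since h(u) has logarithmic derivative b(u) in flow time. -/
theorem GaugeStep.gaugeFlow {ζ ζ' : PathSpace E} (h : GaugeStep G ζ ζ') (ξ : StrongDual ℝ 𝔤) :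
    GaugeFlow (solveConstraint (ξ, (pathEquivL φ).symm ζ))
      (solveConstraint (ξ, (pathEquivL φ).symm ζ')) := by
  obtain ⟨b, b', hb, h0, h1, γ, rfl, rfl, hγ⟩ := h
  have hb2 : ∀ u : unitInterval, HasDerivWithinAt
      (fun t : ℝ => (pathEquivL φ).symm b (projIcc 0 1 zero_le_one t))
      ((pathEquivL φ).symm b' u) (Icc 0 1) (u : ℝ) := fun u =>
    ((lieEquivL φ).symm : E →L[ℝ] 𝔤).hasFDerivAt.comp_hasDerivWithinAt (u : ℝ) (hb u)
  refine ⟨constGaugeParameter ((pathEquivL φ).symm b) ((pathEquivL φ).symm b') hb2 (by simp [h0])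
    (by simp [h1]), fun s => solveConstraint (ξ, (pathEquivL φ).symm (γ s)), rfl, rfl,
    fun s _ => ?_⟩
  set δ := PathSpace.bilinL (groupad E G) (γ s) b + b' with hδ
  have h2 : HasDerivAt (fun s => (ξ, (pathEquivL φ).symm (γ s))) (0, (pathEquivL φ).symm δ) s :=
    (hasDerivAt_const s ξ).prodMk
      (((pathEquivL φ).symm : PathSpace E →L[ℝ] PathSpace 𝔤).hasFDerivAt.comp_hasDerivAt s (hγ s))
  have h3 := ((contDiff_solvePath (𝔤 := 𝔤)).differentiable (by simp)
    (ξ, (pathEquivL φ).symm (γ s))).hasFDerivAt.comp_hasDerivAt s h2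
  refine ⟨_, fun u => ⟨?_, ?_⟩, (h3.prodMk h2.snd).hasDerivWithinAt⟩
  · have h4 := (PathSpace.evalL (StrongDual ℝ 𝔤) u).hasFDerivAt.comp_hasDerivAt s h3
    have h5 := hasLogFDerivWithinAt_logPath_of_isGaugeVariation (hγ s).hasDerivWithinAt
      (isGaugeVariation_of_hasDerivWithinAt hb (γ s)) h0 u (S := univ)
    have h6 := HasLogFDerivWithinAt.coadjoint φ (a := (lieEquivL φ).symm (b u))
      (by simpa using h5) ξ
    rw [hasDerivWithinAt_univ] at h6
    refine (h4.unique (h6.congr_of_eventuallyEq (Filter.Eventually.of_forall fun s' => ?_))).trans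
      ?_
    · simp [solvePath_eq φ]
    · have h7 : (solveConstraint (ξ, (pathEquivL φ).symm (γ s))).X u =
        coadjoint φ (logPath G (γ s) u) ξ := by
        refine (solvePath_eq φ ξ ((pathEquivL φ).symm (γ s)) u).trans ?_
        rw [ContinuousLinearEquiv.apply_symm_apply]
      rw [h7]
      rfl
  · refine (hb2 u).congr_deriv ?_
    have h8 : ⁅(lieEquivL φ).symm (γ s u), (lieEquivL φ).symm (b u)⁆ =
        (lieEquivL φ).symm (groupad E G (γ s u) (b u)) := by
      rw [ContinuousLinearEquiv.eq_symm_apply, ← groupad_lieEquivL]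
      simp
    change _ = (lieEquivL φ).symm (δ u) - ⁅(lieEquivL φ).symm (γ s u), (lieEquivL φ).symm (b u)⁆
    rw [h8, hδ]
    simp

/-- The gauge orbits are the level sets of the initial point and the holonomy. -/
theorem phaseClass_eq_iff [SimplyConnectedSpace G] {c c' : ConstraintManifold 𝔤} :
    phaseClass c = phaseClass c' ↔ c.X 0 = c'.X 0 ∧ holonomy φ c.η = holonomy φ c'.η := by
  constructor
  · intro h
    have h1 : Relation.EqvGen GaugeFlow c c' := Quotient.exact h
    refine ⟨endpoint_eq_of_rel 0 (fun β => β.map_zero) c c' h1, ?_⟩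
    clear h
    induction h1 with
    | rel _ _ h => exact h.holonomy_eq φ
    | refl _ => rfl
    | symm _ _ _ ih => exact ih.symm
    | trans _ _ _ _ _ ih₁ ih₂ => exact ih₁.trans ih₂
  · rintro ⟨h0, h⟩
    have h1 := reflTransGen_gaugeStep (G := G) h
    have key : ∀ ζ', Relation.ReflTransGen (GaugeStep G) (pathEquivL φ c.η) ζ' →
        phaseClass c = phaseClass (solveConstraint (c.X 0, (pathEquivL φ).symm ζ')) := by
      intro ζ' hζ'
      induction hζ' with
      | refl => rw [ContinuousLinearEquiv.symm_apply_apply, solveConstraint_eq]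
      | tail _ h ih =>
        exact ih.trans (Quotient.sound (Relation.EqvGen.rel _ _ (h.gaugeFlow φ (c.X 0))))
    have h2 := key _ h1
    rwa [ContinuousLinearEquiv.symm_apply_apply, h0, solveConstraint_eq] at h2

variable [SimplyConnectedSpace G]

/-- The holonomy of a gauge orbit. -/
def phaseHol : PhaseSpace 𝔤 → G :=
  Quotient.lift (fun c : ConstraintManifold 𝔤 => holonomy φ c.η)
    fun _ _ h => ((phaseClass_eq_iff φ).1 (Quotient.sound h)).2

@[simp] theorem phaseHol_phaseClass (c : ConstraintManifold 𝔤) :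
    phaseHol φ (phaseClass c) = holonomy φ c.η := rfl

@[simp] theorem phaseLeft_phaseClass (c : ConstraintManifold 𝔤) :
    phaseLeft (phaseClass c) = c.X 0 := rfl

theorem phaseRight_eq (x : PhaseSpace 𝔤) :
    phaseRight x = coadjoint φ (phaseHol φ x) (phaseLeft x) := by
  obtain ⟨c, rfl⟩ := Quotient.exists_rep x
  exact c.X_one φ

/-- Initial point and holonomy are complete invariants; identities in the groupoid are checked on
them. -/
theorem phaseSpace_ext {x y : PhaseSpace 𝔤} (h0 : phaseLeft x = phaseLeft y)
    (h : phaseHol φ x = phaseHol φ y) : x = y := by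
  obtain ⟨c, rfl⟩ := Quotient.exists_rep x
  obtain ⟨c', rfl⟩ := Quotient.exists_rep y
  exact (phaseClass_eq_iff φ).2 ⟨h0, h⟩

theorem exists_phaseSpace (ξ : StrongDual ℝ 𝔤) (g : G) :
    ∃ x : PhaseSpace 𝔤, phaseLeft x = ξ ∧ phaseHol φ x = g := by
  obtain ⟨ζ, hζ⟩ := hol_surjective E g
  refine ⟨phaseClass (solveConstraint (ξ, (pathEquivL φ).symm ζ)), by simp, ?_⟩
  simp [holonomy, hζ]

theorem phaseHol_phaseUnit (ξ : StrongDual ℝ 𝔤) : phaseHol φ (phaseUnit ξ) = 1 := by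
  refine Eq.trans ?_ (hol_zero E G)
  have : (constSolution ξ).η = 0 := rfl
  rw [phaseUnit, phaseHol_phaseClass, this, holonomy, map_zero]

/-! ### The groupoid operations -/

theorem isLogPath_holonomy_reparam (η η' : PathSpace 𝔤) {τ τ' : ℝ → ℝ}
    (hτ : MapsTo τ (Icc 0 1) (Icc 0 1))
    (hd : ∀ t ∈ Icc (0 : ℝ) 1, HasDerivWithinAt τ (τ' t) (Icc 0 1) t)
    (hη : ∀ u : unitInterval, η' u = τ' u • η (projIcc 0 1 zero_le_one (τ u))) :
    IsLogPath (fun t => (logPath G (pathEquivL φ η) (τ 0))⁻¹ * logPath G (pathEquivL φ η) (τ t))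
      (pathEquivL φ η') :=
  (isLogPath_logPath G (pathEquivL φ η)).reparam hτ hd fun u => by simp [hη]

theorem IsLogPath.logPath_eq {h : ℝ → G} {ζ : PathSpace E} (hh : IsLogPath h ζ)
    (u : unitInterval) : logPath G ζ u = h u :=
  (isLogPath_logPath G ζ).eqOn hh u u.2

theorem IsConcatenation.holonomy_eq {c₁ c₂ c : ConstraintManifold 𝔤}
    (h : IsConcatenation c₁ c₂ c) :
    holonomy φ c.η = holonomy φ c₁.η * holonomy φ c₂.η := by
  have h1 := (isLogPath_logPath G (pathEquivL φ c₁.η)).concat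
    (isLogPath_logPath G (pathEquivL φ c₂.η)) (ζ := pathEquivL φ c.η)
    (fun u v huv => by simp [((h u v).1 huv).2]) (fun u v huv => by simp [((h u v).2 huv).2])
  refine h1.hol_eq.trans ?_
  norm_num
  rfl

/-- Every gauge orbit has a representative vanishing at the end points. -/
theorem exists_phaseClass_eq (φ : 𝔤 ≃ₗ⁅ℝ⁆ GroupLieAlgebra 𝓘(ℝ, E) G)
    (x : PhaseSpace 𝔤) :
    ∃ c : ConstraintManifold 𝔤, phaseClass c = x ∧ c.η 0 = 0 ∧ c.η 1 = 0 := by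
  obtain ⟨c, rfl⟩ := Quotient.exists_rep x
  -- A reparametrization of [0,1] that fixes the end points and has zero derivative there, so the
  -- pulled-back form vanishes at the ends with unchanged holonomy.
  set τ : ℝ → ℝ := fun t => 3 * t ^ 2 - 2 * t ^ 3 with hτ
  set τ' : ℝ → ℝ := fun t => 6 * t - 6 * t ^ 2 with hτ'
  have hd : ∀ t ∈ Icc (0 : ℝ) 1, HasDerivWithinAt τ (τ' t) (Icc 0 1) t := fun t _ => by
    have := (((hasDerivAt_id t).pow 2).const_mul 3).sub (((hasDerivAt_id t).pow 3).const_mul 2)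
    refine (this.congr_deriv ?_).hasDerivWithinAt
    simp [hτ']
    ring
  have hm : MapsTo τ (Icc 0 1) (Icc 0 1) := fun t ht => by
    have h1 : 0 ≤ 1 - t := by linarith [ht.2]
    constructor
    · have : τ t = t ^ 2 * (1 + 2 * (1 - t)) := by simp only [hτ]; ring
      rw [this]
      positivity
    · have : 1 - τ t = (1 - t) ^ 2 * (1 + 2 * t) := by simp only [hτ]; ring
      have h2 : 0 ≤ 1 - τ t := by
        rw [this]
        have := ht.1
        positivity
      linarith
  have hc : Continuous fun u : unitInterval =>
      τ' u • c.η (projIcc 0 1 zero_le_one (τ u)) := by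
    have := c.η.continuous
    simp only [hτ, hτ']
    fun_prop
  refine ⟨solveConstraint (c.X 0, PathSpace.mk _ hc), ?_, by simp [hτ'], by simp [hτ']⟩
  refine (phaseClass_eq_iff φ).2 ⟨by simp, ?_⟩
  have h1 := isLogPath_holonomy_reparam φ c.η (PathSpace.mk _ hc) hm hd fun u => rfl
  refine h1.hol_eq.trans ?_
  have h2 : τ 0 = 0 := by simp [hτ]
  have h3 : τ 1 = 1 := by norm_num [hτ]
  rw [h2, h3, (isLogPath_logPath G _).1, inv_one, one_mul]
  rfl

/-- The two forms vanish where they are glued, so the result is continuous. On the second half X is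
right because the coadjoint action is multiplicative and c₁ ends where c₂ starts. -/
theorem exists_isConcatenation (φ : 𝔤 ≃ₗ⁅ℝ⁆ GroupLieAlgebra 𝓘(ℝ, E) G)
    {c₁ c₂ : ConstraintManifold 𝔤} (h₁ : c₁.η 1 = 0)
    (h₂ : c₂.η 0 = 0) (h : c₁.X 1 = c₂.X 0) :
    ∃ c : ConstraintManifold 𝔤, c.X 0 = c₁.X 0 ∧ IsConcatenation c₁ c₂ c := by
  have hc : Continuous fun u : unitInterval => if (u : ℝ) ≤ 1 / 2 then
      (2 : ℝ) • c₁.η (projIcc 0 1 zero_le_one (2 * (u : ℝ))) else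
      (2 : ℝ) • c₂.η (projIcc 0 1 zero_le_one (2 * (u : ℝ) - 1)) := by
    have hc1 := c₁.η.continuous
    have hc2 := c₂.η.continuous
    refine Continuous.if_le (by fun_prop) (by fun_prop) (by fun_prop) (by fun_prop) fun u hu => ?_
    rw [hu]
    norm_num [h₁, h₂, projIcc_right, projIcc_left]
  set η := PathSpace.mk _ hc with hη
  have hη₁ : ∀ u v : unitInterval, (v : ℝ) = 2 * u → η u = (2 : ℝ) • c₁.η v := by
    intro u v huv
    have : (u : ℝ) ≤ 1 / 2 := by linarith [v.2.2]
    simp only [hη, PathSpace.mk_apply, if_pos this, ← huv, projIcc_val]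
  have hη₂ : ∀ u v : unitInterval, (v : ℝ) = 2 * u - 1 → η u = (2 : ℝ) • c₂.η v := by
    intro u v huv
    rcases (show (1 : ℝ) / 2 ≤ u by linarith [v.2.1]).eq_or_lt with hu | hu
    · have h3 : v = 0 := Subtype.ext (by rw [huv, ← hu]; norm_num)
      rw [hη₁ u 1 (by rw [← hu]; norm_num), h3, h₁, h₂]
    · simp only [hη, PathSpace.mk_apply, if_neg (not_le.2 hu), ← huv, projIcc_val]
  have h3 := (isLogPath_logPath G (pathEquivL φ c₁.η)).concat
    (isLogPath_logPath G (pathEquivL φ c₂.η)) (ζ := pathEquivL φ η)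
    (fun u v huv => by simp [hη₁ u v huv]) (fun u v huv => by simp [hη₂ u v huv])
  refine ⟨solveConstraint (c₁.X 0, η), by simp, fun u v => ⟨fun huv => ⟨?_, hη₁ u v huv⟩,
    fun huv => ⟨?_, hη₂ u v huv⟩⟩⟩
  · have : (u : ℝ) ≤ 1 / 2 := by linarith [v.2.2]
    rw [ConstraintManifold.X_eq φ, c₁.X_eq φ v, solveConstraint_X_zero, solveConstraint_η,
      h3.logPath_eq, if_pos this, huv]
  · rw [ConstraintManifold.X_eq φ, c₂.X_eq φ v, solveConstraint_X_zero, solveConstraint_η,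
      h3.logPath_eq, ← h, c₁.X_one φ, ← coadjoint_mul, huv]
    rcases (show (1 : ℝ) / 2 ≤ u by linarith [v.2.1]).eq_or_lt with hu | hu
    · rw [← hu, if_pos le_rfl]
      norm_num [(isLogPath_logPath G _).1]
      rfl
    · rw [if_neg (not_le.2 hu)]
      rfl

/-- The right-hand side mentions only invariants of the orbits, so the composition does not depend
on representatives and is defined exactly when the end points match. -/
theorem phaseComp_iff (x y z : PhaseSpace 𝔤) : PhaseComp x y z ↔ phaseRight x = phaseLeft y ∧
    phaseLeft z = phaseLeft x ∧ phaseHol φ z = phaseHol φ x * phaseHol φ y := by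
  constructor
  · rintro ⟨c₁, c₂, c, rfl, rfl, rfl, -, -, -, -, h⟩
    have hm : (2⁻¹ : ℝ) ∈ Icc (0 : ℝ) 1 := by norm_num
    refine ⟨?_, ?_, h.holonomy_eq φ⟩
    · exact (((h ⟨_, hm⟩ 1).1 (by norm_num)).1).symm.trans ((h ⟨_, hm⟩ 0).2 (by norm_num)).1
    · exact ((h 0 0).1 (by simp)).1
  · rintro ⟨h1, h2, h3⟩
    obtain ⟨c₁, rfl, h4, h5⟩ := exists_phaseClass_eq φ x
    obtain ⟨c₂, rfl, h6, h7⟩ := exists_phaseClass_eq φ y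
    obtain ⟨c, hc, hcc⟩ := exists_isConcatenation φ h5 h6 h1
    exact ⟨c₁, c₂, c, rfl, rfl, phaseSpace_ext φ (hc.trans h2.symm)
      ((hcc.holonomy_eq φ).trans h3.symm), h4, h5, h6, h7, hcc⟩

/-- The reversed curve, translated to start at 1, ends at the inverse of the holonomy. -/
theorem isLogPath_symm (η : PathSpace 𝔤) {η' : PathSpace 𝔤}
    (h : ∀ u, η' u = -(η (unitInterval.symm u))) :
    IsLogPath (fun t => (holonomy φ η)⁻¹ * logPath G (pathEquivL φ η) (1 - t))
      (pathEquivL φ η') := by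
  have h1 := isLogPath_holonomy_reparam φ η η' (τ := fun t => 1 - t) (τ' := fun _ => -1)
    (fun t ht => ⟨by linarith [ht.2], by linarith [ht.1]⟩)
    (fun t _ => ((hasDerivAt_id t).const_sub 1).hasDerivWithinAt) (fun u => by
      have : projIcc 0 1 zero_le_one (1 - (u : ℝ)) = unitInterval.symm u :=
        projIcc_val zero_le_one (unitInterval.symm u)
      rw [this, h, neg_one_smul])
  simp only [sub_zero] at h1
  exact h1

theorem phaseInv_iff (x y : PhaseSpace 𝔤) : PhaseInv x y ↔ phaseRight x = phaseLeft y ∧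
    phaseHol φ x * phaseHol φ y = 1 := by
  constructor
  · rintro ⟨c, c', rfl, rfl, h⟩
    refine ⟨?_, ?_⟩
    · have := (h 0).1
      rw [unitInterval.symm_zero] at this
      exact this.symm
    · have h1 : holonomy φ c'.η = _ := (isLogPath_symm φ c.η fun u => (h u).2).hol_eq
      rw [phaseHol_phaseClass, phaseHol_phaseClass, h1, sub_self, (isLogPath_logPath G _).1]
      simp
  · rintro ⟨h1, h2⟩
    obtain ⟨c, rfl⟩ := Quotient.exists_rep x
    have hc : Continuous fun u => -(c.η (unitInterval.symm u)) := by
      have := c.η.continuous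
      fun_prop
    have h3 := isLogPath_symm φ c.η (η' := PathSpace.mk _ hc) fun u => rfl
    refine ⟨c, solveConstraint (c.X 1, PathSpace.mk _ hc), rfl, phaseSpace_ext φ ?_ ?_,
      fun u => ⟨?_, rfl⟩⟩
    · exact (solveConstraint_X_zero _).trans h1
    · have h4 : holonomy φ (PathSpace.mk _ hc) = _ := h3.hol_eq
      rw [phaseHol_phaseClass, solveConstraint_η, h4, sub_self, (isLogPath_logPath G _).1, mul_one]
      exact (eq_inv_of_mul_eq_one_right h2).symm
    · rw [ConstraintManifold.X_eq φ, c.X_eq φ (unitInterval.symm u), solveConstraint_X_zero,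
        solveConstraint_η, h3.logPath_eq, c.X_one φ, ← coadjoint_mul, mul_inv_cancel_left]
      rfl

end LieAlgebraPaths

/-! ### The right trivialization of the cotangent bundle -/

section CotangentTrivialization

variable {E : Type u} {G : Type*} [NormedAddCommGroup E] [NormedSpace ℝ E]
  [TopologicalSpace G] [ChartedSpace E G] [Group G] [LieGroup 𝓘(ℝ, E) ∞ G]

/-- The coordinate change from the tangent space at `g` to the model space, in the preferred chart
at `g₀`. -/
def tangentCoord (g₀ g : G) : E →L[ℝ] E :=
  (trivializationAt E (TangentSpace 𝓘(ℝ, E)) g₀).continuousLinearMapAt ℝ g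

/-- The inverse of `tangentCoord`. -/
def tangentCoordSymm (g₀ g : G) : E →L[ℝ] E :=
  (trivializationAt E (TangentSpace 𝓘(ℝ, E)) g₀).symmL ℝ g

theorem tangentCoordSymm_tangentCoord {g₀ g : G} (hg : g ∈ (chartAt E g₀).source) (v : E) :
    tangentCoordSymm g₀ g (tangentCoord g₀ g v) = v :=
  (trivializationAt E (TangentSpace 𝓘(ℝ, E)) g₀).symmL_continuousLinearMapAt hg v

theorem tangentCoord_tangentCoordSymm {g₀ g : G} (hg : g ∈ (chartAt E g₀).source) (v : E) :
    tangentCoord g₀ g (tangentCoordSymm g₀ g v) = v :=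
  (trivializationAt E (TangentSpace 𝓘(ℝ, E)) g₀).continuousLinearMapAt_symmL hg v

theorem tangentCoordSymm_self (g : G) :
    tangentCoordSymm g g = ContinuousLinearMap.id ℝ E := by
  refine (TangentBundle.symmL_trivializationAt_eq_core (mem_chart_source E g)).trans ?_
  ext v
  exact (tangentBundleCore 𝓘(ℝ, E) G).coordChange_self (achart E g) g
    (mem_chart_source E g) v

theorem inCoordinates_cotangent (g₀ g : G) (b : E →L[ℝ] ℝ) :
    ContinuousLinearMap.inCoordinates E (TangentSpace 𝓘(ℝ, E)) ℝ (Bundle.Trivial G ℝ) g₀ g g₀ g b =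
      b.comp (tangentCoordSymm g₀ g) := by
  have h : (trivializationAt ℝ (Bundle.Trivial G ℝ) g₀).continuousLinearMapAt ℝ g =
      ContinuousLinearMap.id ℝ ℝ := Bundle.Trivial.continuousLinearMapAt_trivialization ℝ G ℝ g
  exact ContinuousLinearMap.ext fun v => congrArg (fun L => L (b (tangentCoordSymm g₀ g v))) h

/-- Partial derivative at x = 1 of the smooth map (g, x) ↦ xg, with g as parameter. -/
theorem contMDiffAt_rightDeriv (g₀ : G) : ContMDiffAt 𝓘(ℝ, E) 𝓘(ℝ, E →L[ℝ] E) ∞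
    (fun g => (tangentCoord g₀ g).comp (rightDeriv E g)) g₀ := by
  have h1 : ContMDiffAt (𝓘(ℝ, E).prod 𝓘(ℝ, E)) 𝓘(ℝ, E) ∞
      (Function.uncurry fun g x : G => x * g) (g₀, 1) :=
    (contMDiff_snd.mul contMDiff_fst).contMDiffAt
  have h2 := ContMDiffAt.mfderiv (fun g x : G => x * g) (fun _ => (1 : G)) h1 contMDiffAt_const
    (m := ∞) (by simp)
  refine h2.congr_of_eventuallyEq ?_
  filter_upwards with g
  -- The parametric derivative is based at `1 * g`, and rewriting inside the fibre types is avoided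
  -- by generalizing the base points.
  have key : ∀ k₀ k : G, k₀ = g₀ → k = g → (tangentCoord g₀ g).comp (rightDeriv E g) =
      (tangentCoord k₀ k).comp ((rightDeriv E g).comp (tangentCoordSymm (1 : G) 1)) := by
    rintro _ _ rfl rfl
    rw [tangentCoordSymm_self, ContinuousLinearMap.comp_id]
  simp only [inTangentCoordinates, ContinuousLinearMap.inCoordinates]
  exact key _ _ (one_mul g₀) (one_mul g)

theorem isInvertible_rightDeriv (g : G) : (rightDeriv E g).IsInvertible := by
  rw [rightDeriv_eq]
  refine (hasFDerivAt_chart_inv_mul g).2.comp ⟨ContinuousLinearEquiv.equivOfInverse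
    (groupAd E g⁻¹) (groupAd E g) (groupAd_apply_inv g) (groupAd_inv_apply g), rfl⟩

theorem isInvertible_tangentCoord {g₀ g : G} (hg : g ∈ (chartAt E g₀).source) :
    (tangentCoord (E := E) g₀ g).IsInvertible :=
  ⟨ContinuousLinearEquiv.equivOfInverse (tangentCoord g₀ g) (tangentCoordSymm g₀ g)
    (tangentCoordSymm_tangentCoord hg) (tangentCoord_tangentCoordSymm hg), rfl⟩

theorem inverse_tangentCoord_comp_rightDeriv {g₀ g : G} (hg : g ∈ (chartAt E g₀).source) :
    ((tangentCoord g₀ g).comp (rightDeriv E g)).inverse =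
      (rightDeriv E g).inverse.comp (tangentCoordSymm g₀ g) := by
  obtain ⟨e, he⟩ := isInvertible_rightDeriv (E := E) g
  let c := ContinuousLinearEquiv.equivOfInverse (tangentCoord g₀ g) (tangentCoordSymm g₀ g)
    (tangentCoordSymm_tangentCoord hg) (tangentCoord_tangentCoordSymm hg)
  have h1 : (tangentCoord g₀ g).comp (rightDeriv E g) = (e.trans c : E →L[ℝ] E) := by
    rw [← he]
    rfl
  rw [h1, ContinuousLinearMap.inverse_equiv, ← he, ContinuousLinearMap.inverse_equiv]
  rfl

end CotangentTrivialization

section CotangentBundle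

variable {𝔤 : Type*} [NormedLieRing 𝔤] [NormedLieAlgebra 𝔤] [FiniteDimensional ℝ 𝔤]
  {E : Type u} {G : Type*} [NormedAddCommGroup E] [NormedSpace ℝ E] [FiniteDimensional ℝ E]
  [TopologicalSpace G] [ChartedSpace E G] [Group G] [LieGroup 𝓘(ℝ, E) ∞ G]
  (φ : 𝔤 ≃ₗ⁅ℝ⁆ GroupLieAlgebra 𝓘(ℝ, E) G)

/-- The covector of a point of the cotangent bundle. -/
def covector (p : CotangentBundle E G) : E →L[ℝ] ℝ := p.2

theorem cotangentLeft_eq (p : CotangentBundle E G) : cotangentLeft φ p =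
    (covector p).comp ((rightDeriv E p.1).comp (lieEquivL φ : 𝔤 →L[ℝ] E)) := rfl

theorem cotangentRight_eq (p : CotangentBundle E G) : cotangentRight φ p =
    (covector p).comp ((leftDeriv E p.1).comp (lieEquivL φ : 𝔤 →L[ℝ] E)) := rfl

theorem contMDiff_cotangentLeft : ContMDiff (cotangentModel E) 𝓘(ℝ, StrongDual ℝ 𝔤) ∞
    (cotangentLeft (E := E) (G := G) φ) := by
  intro p₀
  have h1 := ((contMDiffAt_hom_bundle (IM := cotangentModel E) (IB := 𝓘(ℝ, E)) (n := ∞)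
    (fun p : CotangentBundle E G => p) (x₀ := p₀)).1 contMDiffAt_id)
  have h2 : ContMDiffAt (cotangentModel E) 𝓘(ℝ, E →L[ℝ] ℝ) ∞ (fun p : CotangentBundle E G =>
      (covector p).comp (tangentCoordSymm p₀.1 p.1)) p₀ := by
    refine h1.2.congr_of_eventuallyEq (Filter.Eventually.of_forall fun p => ?_)
    exact (inCoordinates_cotangent p₀.1 p.1 _).symm
  have h3 := ContMDiffAt.comp p₀ (contMDiffAt_rightDeriv p₀.1) h1.1
  have h4 := h2.clm_comp (h3.clm_comp (contMDiffAt_const (c := (lieEquivL φ : 𝔤 →L[ℝ] E))))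
  refine h4.congr_of_eventuallyEq ?_
  filter_upwards [h1.1.continuousAt.preimage_mem_nhds (chart_source_mem_nhds E p₀.1)] with p hp
  rw [cotangentLeft_eq]
  ext a
  exact congrArg (covector p) (tangentCoordSymm_tangentCoord hp _).symm

/-- The inverse of the right trivialization of the cotangent bundle. -/
def cotangentOf (q : StrongDual ℝ 𝔤 × G) : CotangentBundle E G :=
  ⟨q.2, (q.1.comp (((lieEquivL φ).symm : E →L[ℝ] 𝔤).comp (rightDeriv E q.2).inverse) :
    E →L[ℝ] ℝ)⟩

theorem cotangentLeft_cotangentOf (q : StrongDual ℝ 𝔤 × G) :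
    cotangentLeft φ (cotangentOf φ q) = q.1 := by
  rw [cotangentLeft_eq]
  obtain ⟨e, he⟩ := isInvertible_rightDeriv (E := E) q.2
  ext a
  change q.1 ((lieEquivL φ).symm ((rightDeriv E q.2).inverse (rightDeriv E q.2 _))) = q.1 a
  rw [← he, ContinuousLinearMap.inverse_equiv]
  simp

theorem cotangentOf_cotangentLeft (p : CotangentBundle E G) :
    cotangentOf φ (cotangentLeft φ p, p.1) = p := by
  obtain ⟨g, b⟩ := p
  refine congrArg (Bundle.TotalSpace.mk g) ?_
  obtain ⟨e, he⟩ := isInvertible_rightDeriv (E := E) g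
  refine ContinuousLinearMap.ext fun v => ?_
  change covector ⟨g, b⟩ (rightDeriv E g (lieEquivL φ ((lieEquivL φ).symm
    ((rightDeriv E g).inverse v)))) = covector ⟨g, b⟩ v
  rw [← he, ContinuousLinearMap.inverse_equiv]
  simp

theorem contMDiff_cotangentOf : ContMDiff (𝓘(ℝ, StrongDual ℝ 𝔤).prod 𝓘(ℝ, E)) (cotangentModel E) ∞
    (cotangentOf φ) := by
  intro q₀
  have := FiniteDimensional.complete ℝ E
  rw [contMDiffAt_hom_bundle]
  refine ⟨contMDiffAt_snd, ?_⟩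
  have h1 := ContMDiffAt.comp q₀ (contMDiffAt_rightDeriv q₀.2)
    (contMDiffAt_snd (I := 𝓘(ℝ, StrongDual ℝ 𝔤)) (J := 𝓘(ℝ, E)) (n := ∞))
  obtain ⟨e₀, he₀⟩ : ((tangentCoord q₀.2 q₀.2).comp (rightDeriv E q₀.2)).IsInvertible :=
    (isInvertible_tangentCoord (mem_chart_source E q₀.2)).comp (isInvertible_rightDeriv q₀.2)
  have h2 : ContMDiffAt (𝓘(ℝ, StrongDual ℝ 𝔤).prod 𝓘(ℝ, E)) 𝓘(ℝ, E →L[ℝ] E) ∞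
      (fun q : StrongDual ℝ 𝔤 × G =>
        ((tangentCoord q₀.2 q.2).comp (rightDeriv E q.2)).inverse) q₀ := by
    refine ContMDiffAt.comp (g := ContinuousLinearMap.inverse) q₀ ?_ h1
    rw [← he₀]
    exact (contDiffAt_map_inverse e₀).contMDiffAt
  have h3 := (contMDiffAt_fst (I := 𝓘(ℝ, StrongDual ℝ 𝔤)) (J := 𝓘(ℝ, E)) (n := ∞)
    (p := q₀)).clm_comp ((contMDiffAt_const (c := ((lieEquivL φ).symm : E →L[ℝ] 𝔤))).clm_comp h2)
  refine h3.congr_of_eventuallyEq ?_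
  filter_upwards [continuousAt_snd.preimage_mem_nhds (chart_source_mem_nhds E q₀.2)] with q hq
  refine (inCoordinates_cotangent q₀.2 q.2 _).trans ?_
  rw [inverse_tangentCoord_comp_rightDeriv hq]
  rfl

/-- The right trivialization of the cotangent bundle of a Lie group. -/
def cotangentDiffeomorph : Diffeomorph (cotangentModel E) (𝓘(ℝ, StrongDual ℝ 𝔤).prod 𝓘(ℝ, E))
    (CotangentBundle E G) (StrongDual ℝ 𝔤 × G) ∞ where
  toFun p := (cotangentLeft φ p, p.1)
  invFun := cotangentOf φ
  left_inv := cotangentOf_cotangentLeft φ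
  right_inv q := Prod.ext (cotangentLeft_cotangentOf φ q) rfl
  contMDiff_toFun := (contMDiff_cotangentLeft φ).prodMk (Bundle.contMDiff_proj _)
  contMDiff_invFun := contMDiff_cotangentOf φ

theorem cotangentBundle_ext {p q : CotangentBundle E G}
    (h : cotangentLeft φ p = cotangentLeft φ q) (h1 : p.1 = q.1) : p = q := by
  rw [← cotangentOf_cotangentLeft φ p, ← cotangentOf_cotangentLeft φ q, h, h1]

/-- Left translation is right translation after Ad. The same relation links the two projections of
the phase space, so matching the left one suffices. -/
theorem cotangentRight_eq_coadjoint (p : CotangentBundle E G) :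
    cotangentRight φ p = coadjoint φ p.1 (cotangentLeft φ p) := by
  ext a
  rw [coadjoint_apply, cotangentLeft_eq, cotangentRight_eq, rightDeriv_eq]
  simp [groupAd_inv_apply]

theorem cotangentLeft_cotangentUnit (ξ : StrongDual ℝ 𝔤) :
    cotangentLeft φ (cotangentUnit φ ξ) = ξ := by
  ext a
  have h : rightDeriv E (1 : G) = ContinuousLinearMap.id ℝ E := by
    exact hasMFDerivAt_unique (hasMFDerivAt_rightDeriv (1 : G)) ((hasMFDerivAt_id
      (1 : G)).congr_of_eventuallyEq (Filter.Eventually.of_forall fun x => mul_one x))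
  change ξ ((lieEquivL φ).symm (rightDeriv E (1 : G) (lieEquivL φ a))) = ξ a
  rw [h]
  simp

/-- The chain rule for x(gh) = (xg)h: the derivative of right translation by h cancels against its
inverse in the product. -/
theorem cotangentLeft_cotangentMul (p q : CotangentBundle E G) :
    cotangentLeft φ (cotangentMul p q) = cotangentLeft φ p := by
  set D : E →L[ℝ] E := mfderiv 𝓘(ℝ, E) 𝓘(ℝ, E) (fun x : G => x * q.1) p.1 with hD
  have h1 : HasMFDerivAt 𝓘(ℝ, E) 𝓘(ℝ, E) (fun x : G => x * q.1) p.1 D :=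
    ((contMDiff_mul_right (I := 𝓘(ℝ, E)) (n := ∞) (a := q.1)).mdifferentiable (by simp)
      p.1).hasMFDerivAt
  have h2 : rightDeriv E (p.1 * q.1) = D.comp (rightDeriv E p.1) := by
    have h3 : HasMFDerivAt 𝓘(ℝ, E) 𝓘(ℝ, E) (fun x : G => x * q.1) (1 * p.1) D := by
      rw [one_mul]
      exact h1
    have h4 := HasMFDerivAt.comp (1 : G) h3 (hasMFDerivAt_rightDeriv p.1)
    exact hasMFDerivAt_unique (hasMFDerivAt_rightDeriv (p.1 * q.1)) (h4.congr_of_eventuallyEq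
      (Filter.Eventually.of_forall fun x => (mul_assoc x p.1 q.1).symm))
  have h3 : D.IsInvertible := by
    obtain ⟨e, he⟩ := isInvertible_rightDeriv (E := E) p.1
    obtain ⟨e', he'⟩ := isInvertible_rightDeriv (E := E) (p.1 * q.1)
    refine ⟨e.symm.trans e', ContinuousLinearMap.ext fun v => ?_⟩
    have h4 := congrArg (fun L : E →L[ℝ] E => L (e.symm v)) (he'.trans h2)
    simpa [← he] using h4
  ext a
  change covector p (D.inverse (rightDeriv E (p.1 * q.1) (lieEquivL φ a))) =
    covector p (rightDeriv E p.1 (lieEquivL φ a))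
  rw [h2]
  obtain ⟨e, he⟩ := h3
  rw [← he, ContinuousLinearMap.inverse_equiv]
  simp

end CotangentBundle

/-! ### Exterior derivatives under pull-back, and the Liouville form in coordinates -/

theorem ContinuousLinearMap.fderiv_comp_hasFDerivAt {V A W : Type*} [NormedAddCommGroup V]
    [NormedSpace ℝ V] [NormedAddCommGroup A] [NormedSpace ℝ A] [NormedAddCommGroup W]
    [NormedSpace ℝ W] (L : A →L[ℝ] W) {f : V → A} {f' : V →L[ℝ] A} {x : V}
    (hf : HasFDerivAt f f' x) : fderiv ℝ (fun y => L (f y)) x = L.comp f' :=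
  (L.hasFDerivAt.comp x hf).fderiv

/-- The exterior derivative of a one-form commutes with pull-back. -/
theorem extDerivOneForm_mfderiv {V F H N : Type*} [NormedAddCommGroup V] [NormedSpace ℝ V]
    [NormedAddCommGroup F] [NormedSpace ℝ F] [TopologicalSpace H] {I : ModelWithCorners ℝ F H}
    [I.Boundaryless] [TopologicalSpace N] [ChartedSpace H N] [IsManifold I ∞ N]
    (θ : ∀ p : N, TangentSpace I p →L[ℝ] ℝ) {f : V → N} {x : V} (hf : ContMDiff 𝓘(ℝ, V) I ∞ f)
    {θloc : F → F →L[ℝ] ℝ} (hθloc : ∀ᶠ y in 𝓝 (extChartAt I (f x) (f x)),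
      θloc y = (θ ((extChartAt I (f x)).symm y)).comp
        (mfderivWithin 𝓘(ℝ, F) I (extChartAt I (f x)).symm (range I) y))
    (hθ : DifferentiableAt ℝ θloc (extChartAt I (f x) (f x)))
    {Λ : V → V →L[ℝ] ℝ} (hΛ : ∀ y v, Λ y v = θ (f y) (mfderiv 𝓘(ℝ, V) I f y v)) (v w : V) :
    extDerivOneForm I θ (f x) (mfderiv 𝓘(ℝ, V) I f x v) (mfderiv 𝓘(ℝ, V) I f x w) =
      fderiv ℝ Λ x v w - fderiv ℝ Λ x w v := by
  set e := extChartAt I (f x) with he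
  set K : V → F := fun y => e (f y) with hK
  have hmem : ∀ᶠ y in 𝓝 x, f y ∈ e.source :=
    hf.continuous.continuousAt.preimage_mem_nhds (extChartAt_source_mem_nhds (I := I) (f x))
  have he1 : ∀ y, f y ∈ e.source → HasMFDerivAt I 𝓘(ℝ, F) e (f y) (mfderiv I 𝓘(ℝ, F) e (f y)) :=
    fun y hy => (mdifferentiableAt_extChartAt (by simpa [he] using hy)).hasMFDerivAt
  have hfd : ∀ y, HasMFDerivAt 𝓘(ℝ, V) I f y (mfderiv 𝓘(ℝ, V) I f y) := fun y =>
    (hf.mdifferentiable (by simp) y).hasMFDerivAt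
  have hKC : ContDiffAt ℝ ∞ K x := by
    rw [← contMDiffAt_iff_contDiffAt]
    exact ContMDiffAt.comp x (contMDiffAt_extChartAt (I := I)) (hf x)
  let DK : V → V →L[ℝ] F := fun y => (mfderiv I 𝓘(ℝ, F) e (f y)).comp (mfderiv 𝓘(ℝ, V) I f y)
  have hKd : ∀ y, f y ∈ e.source → HasFDerivAt K (DK y) y := fun y hy =>
    (HasMFDerivAt.comp y (he1 y hy) (hfd y)).hasFDerivAt
  have hx : f x ∈ e.source := mem_extChartAt_source (I := I) (f x)
  -- The pulled-back form, computed through the chart.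
  have hΛloc : Λ =ᶠ[𝓝 x] fun y => (θloc (K y)).comp (fderiv ℝ K y) := by
    have hKc : ContinuousAt K x := hKC.continuousAt
    filter_upwards [hmem, hmem.eventually_nhds, hKc.eventually hθloc] with y hy hy' hloc
    rw [hloc]
    have h1 : HasMFDerivAt 𝓘(ℝ, F) I e.symm (K y)
        (mfderivWithin 𝓘(ℝ, F) I e.symm (range I) (K y)) := by
      have h2 := (mdifferentiableWithinAt_extChartAt_symm (I := I) (e.map_source hy)
        ).hasMFDerivWithinAt
      rw [I.range_eq_univ] at h2 ⊢
      exact h2.hasMFDerivAt Filter.univ_mem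
    have h2 := HasMFDerivAt.comp y h1 ((hKd y hy).differentiableAt.hasFDerivAt).hasMFDerivAt
    have h3 : HasMFDerivAt 𝓘(ℝ, V) I f y _ := h2.congr_of_eventuallyEq (by
      filter_upwards [hy'] with z hz
      exact (e.left_inv hz).symm)
    have h4 := hasMFDerivAt_unique (hfd y) h3
    have h5 : e.symm (K y) = f y := e.left_inv hy
    refine ContinuousLinearMap.ext fun v => ?_
    have h6 : ∀ p : N, p = f y → ∀ u : F, (θ p : F →L[ℝ] ℝ) u = (θ (f y) : F →L[ℝ] ℝ) u := by
      rintro _ rfl _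
      rfl
    refine (hΛ y v).trans (Eq.trans ?_ (h6 _ h5 _).symm)
    exact congrArg (fun L : V →L[ℝ] F => (θ (f y) : F →L[ℝ] ℝ) (L v)) h4
  have hD := HasFDerivAt.clm_comp (HasFDerivAt.comp (f := K) x hθ.hasFDerivAt
    (hKC.differentiableAt (by simp)).hasFDerivAt)
    (((hKC.fderiv_right (m := 1) (by norm_cast)).differentiableAt (by simp)).hasFDerivAt)
  have hD' := (hD.congr_of_eventuallyEq hΛloc).fderiv
  -- The terms containing the second derivative of `K` cancel in the antisymmetrization.
  have hsymm := (hKC.isSymmSndFDerivAt (by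
    rw [minSmoothness_of_isRCLikeNormedField]
    exact ENat.LEInfty.out)) v w
  rw [hD']
  have hθ' : fderivWithin ℝ (fun y => ((θ (e.symm y)).comp
      (mfderivWithin 𝓘(ℝ, F) I e.symm (range I) y) : F →L[ℝ] ℝ)) (range I) (e (f x)) =
      fderiv ℝ θloc (e (f x)) := by
    rw [I.range_eq_univ, fderivWithin_univ]
    rw [I.range_eq_univ] at hθloc
    exact (Filter.EventuallyEq.fderiv_eq hθloc).symm
  have hK' : ∀ u : V, fderiv ℝ K x u = mfderiv I 𝓘(ℝ, F) e (f x) (mfderiv 𝓘(ℝ, V) I f x u) := by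
    intro u
    rw [(hKd x hx).fderiv]
    rfl
  unfold extDerivOneForm
  simp only [← he]
  rw [hθ', ← hK', ← hK']
  simp [hsymm]

section Liouville

variable {E : Type u} {G : Type*} [NormedAddCommGroup E] [NormedSpace ℝ E]
  [TopologicalSpace G] [ChartedSpace E G] [Group G] [LieGroup 𝓘(ℝ, E) ∞ G]

theorem extChartAt_cotangentBundle (p q : CotangentBundle E G) :
    extChartAt (cotangentModel E) p q =
      (extChartAt 𝓘(ℝ, E) p.1 q.1, (covector q).comp (tangentCoordSymm p.1 q.1)) := by
  refine (hom_chart p q).trans ?_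
  exact Prod.ext rfl (inCoordinates_cotangent p.1 q.1 _)

/-- The Liouville form in coordinates. -/
theorem liouvilleForm_chart (p : CotangentBundle E G) :
    ∀ᶠ y in 𝓝 (extChartAt (cotangentModel E) p p),
      y.2.comp (ContinuousLinearMap.fst ℝ E (E →L[ℝ] ℝ)) =
        (liouvilleForm ((extChartAt (cotangentModel E) p).symm y)).comp
          (mfderivWithin 𝓘(ℝ, E × (E →L[ℝ] ℝ)) (cotangentModel E)
            (extChartAt (cotangentModel E) p).symm (range (cotangentModel E)) y) := by
  filter_upwards [extChartAt_target_mem_nhds (I := cotangentModel E) p] with y hy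
  set e := extChartAt (cotangentModel E) p with he
  have hq : e.symm y ∈ e.source := e.map_target hy
  have hqy : (extChartAt 𝓘(ℝ, E) p.1 (e.symm y).1,
      (covector (e.symm y)).comp (tangentCoordSymm p.1 (e.symm y).1)) = y :=
    (extChartAt_cotangentBundle p (e.symm y)).symm.trans (e.right_inv hy)
  have hd : HasMFDerivAt 𝓘(ℝ, E × (E →L[ℝ] ℝ)) (cotangentModel E) e.symm y
      (mfderivWithin 𝓘(ℝ, E × (E →L[ℝ] ℝ)) (cotangentModel E) e.symm
        (range (cotangentModel E)) y) := by
    have h2 := (mdifferentiableWithinAt_extChartAt_symm (I := cotangentModel E) hy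
      ).hasMFDerivWithinAt
    rw [ModelWithCorners.range_eq_univ] at h2 ⊢
    exact h2.hasMFDerivAt Filter.univ_mem
  have hπ : HasMFDerivAt (cotangentModel E) 𝓘(ℝ, E) (fun q : CotangentBundle E G => q.1) (e.symm y)
      (mfderiv (cotangentModel E) 𝓘(ℝ, E) (fun q : CotangentBundle E G => q.1) (e.symm y)) :=
    ((Bundle.contMDiff_proj (n := ∞) (IB := 𝓘(ℝ, E)) _).mdifferentiable (by simp)
      (e.symm y)).hasMFDerivAt
  have h1 := HasMFDerivAt.comp y hπ hd
  have hmem : ∀ z ∈ e.target, z.1 ∈ (extChartAt 𝓘(ℝ, E) p.1).target := fun z hz => by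
    rw [he, FiberBundle.extChartAt_target] at hz
    exact hz.1.1
  have hfst : ∀ z ∈ e.target, (e.symm z).1 = (extChartAt 𝓘(ℝ, E) p.1).symm z.1 := fun z hz =>
    FiberBundle.chartedSpace_chartAt_symm_fst p z (by
      rw [he, extChartAt_target] at hz
      exact hz.1)
  have hsrc : (e.symm y).1 ∈ (chartAt E p.1).source := by
    rw [hfst y hy]
    simpa using (extChartAt 𝓘(ℝ, E) p.1).map_target (hmem y hy)
  have hσ : HasMFDerivAt 𝓘(ℝ, E) 𝓘(ℝ, E) (extChartAt 𝓘(ℝ, E) p.1).symm y.1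
      (tangentCoordSymm (E := E) p.1 (e.symm y).1) := by
    have h2 := (mdifferentiableWithinAt_extChartAt_symm (I := 𝓘(ℝ, E)) (hmem y hy)
      ).hasMFDerivWithinAt
    have h3 := TangentBundle.symmL_trivializationAt (I := 𝓘(ℝ, E)) hsrc
    rw [← (congrArg Prod.fst hqy : extChartAt 𝓘(ℝ, E) p.1 (e.symm y).1 = y.1)] at h2 ⊢
    rw [← h3, ModelWithCorners.range_eq_univ] at h2
    exact h2.hasMFDerivAt Filter.univ_mem
  have h4 := (HasMFDerivAt.comp y hσ (hasFDerivAt_fst (𝕜 := ℝ) (p := y)).hasMFDerivAt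
    ).congr_of_eventuallyEq (f₁ := fun z => (e.symm z).1) (by
      filter_upwards [(isOpen_extChartAt_target (I := cotangentModel E) p).mem_nhds hy] with z hz
      exact hfst z hz)
  have h5 := hasMFDerivAt_unique h1 h4
  refine ContinuousLinearMap.ext fun v => ?_
  have h6 := congrArg (fun L : E × (E →L[ℝ] ℝ) →L[ℝ] E => covector (e.symm y) (L v)) h5
  refine Eq.trans ?_ h6.symm
  exact (congrArg (fun z : E × (E →L[ℝ] ℝ) => z.2 v.1) hqy).symm

end Liouville

/-! ### The pull-back of the symplectic form of the cotangent bundle -/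

section PullBack

variable {𝔤 : Type*} [NormedLieRing 𝔤] [NormedLieAlgebra 𝔤] [FiniteDimensional ℝ 𝔤]
  {E : Type u} {G : Type*} [NormedAddCommGroup E] [NormedSpace ℝ E] [FiniteDimensional ℝ E]
  [TopologicalSpace G] [ChartedSpace E G] [Group G] [LieGroup 𝓘(ℝ, E) ∞ G]
  (φ : 𝔤 ≃ₗ⁅ℝ⁆ GroupLieAlgebra 𝓘(ℝ, E) G)

/-- The point of the cotangent bundle given by an initial point and a path in the Lie algebra. -/
def cotangentOfPath (p : StrongDual ℝ 𝔤 × PathSpace 𝔤) : CotangentBundle E G :=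
  cotangentOf φ (p.1, holonomy φ p.2)

theorem contMDiff_holonomy : ContMDiff 𝓘(ℝ, PathSpace 𝔤) 𝓘(ℝ, E) ∞ (holonomy φ) :=
  (contMDiff_hol E G).comp (pathEquivL φ : PathSpace 𝔤 →L[ℝ] PathSpace E).contDiff.contMDiff

theorem contMDiff_cotangentOfPath :
    ContMDiff 𝓘(ℝ, StrongDual ℝ 𝔤 × PathSpace 𝔤) (cotangentModel E) ∞ (cotangentOfPath φ) :=
  (contMDiff_cotangentOf φ).comp (contDiff_fst.contMDiff.prodMk
    ((contMDiff_holonomy φ).comp contDiff_snd.contMDiff))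

/-- The one-form `∫ ⟨X, δη⟩`, in the chart of the constraint manifold. -/
def constraintPotential (p : StrongDual ℝ 𝔤 × PathSpace 𝔤) :
    (StrongDual ℝ 𝔤 × PathSpace 𝔤) →L[ℝ] ℝ :=
  ((integralL ℝ).comp (PathSpace.bilinL (ContinuousLinearMap.id ℝ (StrongDual ℝ 𝔤))
    (solvePath p.1 p.2))).comp (ContinuousLinearMap.snd ℝ _ _)

theorem constraintPotential_apply (p v : StrongDual ℝ 𝔤 × PathSpace 𝔤) :
    constraintPotential p v = ∫ s in (0 : ℝ)..1,
      solvePath p.1 p.2 (projIcc 0 1 zero_le_one s) (v.2 (projIcc 0 1 zero_le_one s)) := rfl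

/-- The covector is X(0) transported by right translation, so it is paired with dhol · hol⁻¹ = ∫
Ad(h)δη. Moving Ad(h) to the other side turns X(0) into X(u). -/
theorem liouvilleForm_cotangentOfPath (p v : StrongDual ℝ 𝔤 × PathSpace 𝔤) :
    constraintPotential p v = liouvilleForm (cotangentOfPath φ p)
      (mfderiv 𝓘(ℝ, StrongDual ℝ 𝔤 × PathSpace 𝔤) (cotangentModel E) (cotangentOfPath φ) p v) := by
  set ζ := pathEquivL φ p.2 with hζ
  set D : (StrongDual ℝ 𝔤 × PathSpace 𝔤) →L[ℝ] E := ((groupAd E (hol G ζ)⁻¹).comp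
    ((integralL E).comp (adPathL G ζ))).comp ((pathEquivL φ : PathSpace 𝔤 →L[ℝ] PathSpace E).comp
      (ContinuousLinearMap.snd ℝ _ _)) with hD
  have hs : HasFDerivWithinAt (fun p : StrongDual ℝ 𝔤 × PathSpace 𝔤 => pathEquivL φ p.2)
      ((pathEquivL φ : PathSpace 𝔤 →L[ℝ] PathSpace E).comp (ContinuousLinearMap.snd ℝ _ _)) univ p :=
    ((pathEquivL φ : PathSpace 𝔤 →L[ℝ] PathSpace E).comp (ContinuousLinearMap.snd ℝ
      (StrongDual ℝ 𝔤) (PathSpace 𝔤))).hasFDerivAt.hasFDerivWithinAt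
  have h1 : HasMFDerivAt 𝓘(ℝ, StrongDual ℝ 𝔤 × PathSpace 𝔤) 𝓘(ℝ, E)
      (fun p : StrongDual ℝ 𝔤 × PathSpace 𝔤 => holonomy φ p.2) p
      ((leftDeriv E (hol G ζ)).comp D) :=
    (HasLogFDerivWithinAt.comp (τ := fun p : StrongDual ℝ 𝔤 × PathSpace 𝔤 => pathEquivL φ p.2)
      (hasLogFDerivWithinAt_hol ζ) hs (mapsTo_univ _ _)).hasMFDerivAt
  have hπ : HasMFDerivAt (cotangentModel E) 𝓘(ℝ, E) (fun q : CotangentBundle E G => q.1)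
      (cotangentOfPath φ p) (mfderiv (cotangentModel E) 𝓘(ℝ, E)
        (fun q : CotangentBundle E G => q.1) (cotangentOfPath φ p)) :=
    ((Bundle.contMDiff_proj (n := ∞) (IB := 𝓘(ℝ, E)) _).mdifferentiable (by simp)
      (cotangentOfPath φ p)).hasMFDerivAt
  have h2 := HasMFDerivAt.comp p hπ
    ((contMDiff_cotangentOfPath φ).mdifferentiable (by simp) p).hasMFDerivAt
  have h3 := hasMFDerivAt_unique h2 h1
  have h4 := congrArg (fun L : (StrongDual ℝ 𝔤 × PathSpace 𝔤) →L[ℝ] E =>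
    covector (cotangentOfPath φ p) (L v)) h3
  refine Eq.trans ?_ h4.symm
  have h5 : ∀ z : E, (rightDeriv E (hol G ζ)).inverse
      (leftDeriv E (hol G ζ) (groupAd E (hol G ζ)⁻¹ z)) = z := fun z => by
    have h6 : leftDeriv E (hol G ζ) (groupAd E (hol G ζ)⁻¹ z) = rightDeriv E (hol G ζ) z := by
      rw [rightDeriv_eq]
      rfl
    obtain ⟨e, he⟩ := isInvertible_rightDeriv (E := E) (hol G ζ)
    rw [h6, ← he, ContinuousLinearMap.inverse_equiv]
    exact e.symm_apply_apply z
  have h7 : covector (cotangentOfPath φ p) (((leftDeriv E (hol G ζ)).comp D) v) =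
      (p.1.comp ((lieEquivL φ).symm : E →L[ℝ] 𝔤))
        (integralL E (adPathL G ζ (pathEquivL φ v.2))) :=
    congrArg (fun z => p.1 ((lieEquivL φ).symm z)) (h5 _)
  refine Eq.trans ?_ h7.symm
  rw [integralL_apply, ← ContinuousLinearMap.intervalIntegral_comp_comm _
    ((adPathL G ζ (pathEquivL φ v.2)).continuous_ext.intervalIntegrable _ _),
    constraintPotential_apply]
  congr 1
  funext s
  rw [solvePath_eq φ]
  rfl

/-- The potential ∫⟨X, δη⟩ is linear in X, so its derivative in the direction v replaces X by δX;
antisymmetrizing gives ω. -/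
theorem fderiv_constraintPotential (p v w : StrongDual ℝ 𝔤 × PathSpace 𝔤) :
    fderiv ℝ constraintPotential p v w - fderiv ℝ constraintPotential p w v =
      fieldForm (fderiv ℝ (fun p : StrongDual ℝ 𝔤 × PathSpace 𝔤 =>
          ((solvePath p.1 p.2, p.2) : FieldSpace 𝔤)) p v)
        (fderiv ℝ (fun p : StrongDual ℝ 𝔤 × PathSpace 𝔤 =>
          ((solvePath p.1 p.2, p.2) : FieldSpace 𝔤)) p w) := by
  have hX := ((contDiff_solvePath (𝔤 := 𝔤)).differentiable (by simp) p).hasFDerivAt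
  set DX := fderiv ℝ (fun p : StrongDual ℝ 𝔤 × PathSpace 𝔤 => solvePath p.1 p.2) p with hDX
  have h1 : fderiv ℝ (fun p : StrongDual ℝ 𝔤 × PathSpace 𝔤 =>
      ((solvePath p.1 p.2, p.2) : FieldSpace 𝔤)) p = DX.prod (ContinuousLinearMap.snd ℝ _ _) :=
    (hX.prodMk hasFDerivAt_snd).fderiv
  let B : PathSpace (StrongDual ℝ 𝔤) →L[ℝ] (StrongDual ℝ 𝔤 × PathSpace 𝔤) →L[ℝ] ℝ :=
    ((ContinuousLinearMap.compL ℝ (StrongDual ℝ 𝔤 × PathSpace 𝔤) (PathSpace 𝔤) ℝ).flip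
      (ContinuousLinearMap.snd ℝ (StrongDual ℝ 𝔤) (PathSpace 𝔤))).comp
      ((ContinuousLinearMap.compL ℝ (PathSpace 𝔤) (PathSpace ℝ) ℝ (integralL ℝ)).comp
        (PathSpace.bilinL (ContinuousLinearMap.id ℝ (StrongDual ℝ 𝔤))))
  have h2 : fderiv ℝ (constraintPotential (𝔤 := 𝔤)) p = B.comp DX :=
    ContinuousLinearMap.fderiv_comp_hasFDerivAt
      (W := (StrongDual ℝ 𝔤 × PathSpace 𝔤) →L[ℝ] ℝ) B hX
  rw [h1, h2]
  exact (map_sub (integralL ℝ) (PathSpace.bilinL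
    (ContinuousLinearMap.id ℝ (StrongDual ℝ 𝔤)) (DX v) w.2) (PathSpace.bilinL
    (ContinuousLinearMap.id ℝ (StrongDual ℝ 𝔤)) (DX w) v.2)).symm

/-- The global chart has the identity as its derivative, so derivatives on the constraint manifold
may be computed in the coordinates (X(0), η). -/
theorem hasMFDerivAt_constraintManifold {F H N : Type*} [NormedAddCommGroup F] [NormedSpace ℝ F]
    [TopologicalSpace H] {I : ModelWithCorners ℝ F H} [TopologicalSpace N] [ChartedSpace H N]
    {f : ConstraintManifold 𝔤 → N} {g : StrongDual ℝ 𝔤 × PathSpace 𝔤 → N}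
    (hfg : ∀ c, f c = g (c.X 0, c.η)) (c : ConstraintManifold 𝔤)
    {g' : (StrongDual ℝ 𝔤 × PathSpace 𝔤) →L[ℝ] F}
    (hg : HasMFDerivAt 𝓘(ℝ, StrongDual ℝ 𝔤 × PathSpace 𝔤) I g (c.X 0, c.η) g') :
    HasMFDerivAt 𝓘(ℝ, StrongDual ℝ 𝔤 × PathSpace 𝔤) I f c g' := by
  have h1 : HasMFDerivAt 𝓘(ℝ, StrongDual ℝ 𝔤 × PathSpace 𝔤) 𝓘(ℝ, StrongDual ℝ 𝔤 × PathSpace 𝔤)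
      (fun c : ConstraintManifold 𝔤 => (c.X 0, c.η)) c
      (ContinuousLinearMap.id ℝ (StrongDual ℝ 𝔤 × PathSpace 𝔤)) := by
    have h2 := (mdifferentiableAt_extChartAt (I := 𝓘(ℝ, StrongDual ℝ 𝔤 × PathSpace 𝔤))
      (mem_chart_source _ c)).hasMFDerivAt
    rw [mfderiv_extChartAt_self] at h2
    exact h2
  have h3 := HasMFDerivAt.comp c hg h1
  exact h3.congr_of_eventuallyEq (Filter.Eventually.of_forall hfg)

theorem cotangentForm_eq_constraintForm {f : ConstraintManifold 𝔤 → CotangentBundle E G}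
    (hf : f = fun c => cotangentOfPath φ (c.X 0, c.η)) (c : ConstraintManifold 𝔤)
    (v w : TangentSpace 𝓘(ℝ, StrongDual ℝ 𝔤 × PathSpace 𝔤) c) :
    cotangentForm (f c)
      (mfderiv 𝓘(ℝ, StrongDual ℝ 𝔤 × PathSpace 𝔤) (cotangentModel E) f c v)
      (mfderiv 𝓘(ℝ, StrongDual ℝ 𝔤 × PathSpace 𝔤) (cotangentModel E) f c w) =
        constraintForm c v w := by
  subst hf
  have h1 := (hasMFDerivAt_constraintManifold (fun c => rfl) c
    ((contMDiff_cotangentOfPath φ).mdifferentiable (by simp) (c.X 0, c.η)).hasMFDerivAt).mfderiv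
  have h2 := (hasMFDerivAt_constraintManifold (f := ConstraintManifold.incl)
    (g := fun p : StrongDual ℝ 𝔤 × PathSpace 𝔤 => ((solvePath p.1 p.2, p.2) : FieldSpace 𝔤))
    (fun c => (congrArg ConstraintManifold.incl (solveConstraint_eq c)).symm) c
    ((contDiff_solvePath.prodMk contDiff_snd).differentiable (by simp)
      (c.X 0, c.η)).hasFDerivAt.hasMFDerivAt).mfderiv
  unfold constraintForm
  rw [h1, h2]
  have hd : DifferentiableAt ℝ (fun y : E × (E →L[ℝ] ℝ) =>
      y.2.comp (ContinuousLinearMap.fst ℝ E (E →L[ℝ] ℝ)))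
      (extChartAt (cotangentModel E) (cotangentOfPath φ (c.X 0, c.η))
        (cotangentOfPath φ (c.X 0, c.η))) :=
    (differentiable_snd.clm_comp (differentiable_const _)) _
  refine (extDerivOneForm_mfderiv (liouvilleForm (E := E) (G := G)) (contMDiff_cotangentOfPath φ)
    (liouvilleForm_chart _) hd (Λ := constraintPotential)
    (fun p v => liouvilleForm_cotangentOfPath φ p v) v w).trans ?_
  exact fderiv_constraintPotential _ v w

end PullBack

/-! ### Transport of a manifold structure along a homeomorphism -/

section Transport

variable {F H M N : Type*} [NormedAddCommGroup F] [NormedSpace ℝ F] [TopologicalSpace H]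
  (I : ModelWithCorners ℝ F H) [TopologicalSpace M] [TopologicalSpace N] [ChartedSpace H N]

/-- The charted space structure transported along a homeomorphism. -/
abbrev Homeomorph.pullbackChartedSpace (h : M ≃ₜ N) : ChartedSpace H M where
  atlas := (fun e => h.toOpenPartialHomeomorph ≫ₕ e) '' atlas H N
  chartAt x := h.toOpenPartialHomeomorph ≫ₕ chartAt H (h x)
  mem_chart_source x := by simp
  chart_mem_atlas x := ⟨_, chart_mem_atlas H (h x), rfl⟩

/-- The homeomorphism cancels in the coordinate changes. -/
theorem Homeomorph.isManifold_pullback [IsManifold I ∞ N] (h : M ≃ₜ N) :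
    @IsManifold ℝ _ F _ _ H _ I ∞ M _ h.pullbackChartedSpace := by
  let := h.pullbackChartedSpace (H := H)
  refine @IsManifold.mk ℝ _ F _ _ H _ I ∞ M _ _ ⟨?_⟩
  rintro _ _ ⟨e, he, rfl⟩ ⟨e', he', rfl⟩
  have h1 : (h.toOpenPartialHomeomorph ≫ₕ e).symm ≫ₕ (h.toOpenPartialHomeomorph ≫ₕ e') =
      e.symm ≫ₕ e' := by
    rw [OpenPartialHomeomorph.trans_symm_eq_symm_trans_symm, OpenPartialHomeomorph.trans_assoc,
      ← OpenPartialHomeomorph.trans_assoc h.toOpenPartialHomeomorph.symm,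
      ← Homeomorph.symm_toOpenPartialHomeomorph, ← Homeomorph.trans_toOpenPartialHomeomorph]
    simp
  rw [h1]
  exact StructureGroupoid.compatible _ he he'

theorem Homeomorph.contMDiff_pullback (h : M ≃ₜ N) :
    letI := h.pullbackChartedSpace (H := H)
    ContMDiff I I ∞ h := by
  let := h.pullbackChartedSpace (H := H)
  intro x
  rw [contMDiffAt_iff]
  refine ⟨h.continuous.continuousAt, ?_⟩
  have h1 : ContDiffWithinAt ℝ ∞ id (range I) (extChartAt I x x) := contDiffWithinAt_id
  refine h1.congr_of_eventuallyEq_of_mem ?_ (mem_range_self _)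
  filter_upwards [extChartAt_target_mem_nhdsWithin (I := I) x] with y hy
  exact (extChartAt I x).right_inv hy

theorem Homeomorph.contMDiff_symm_pullback (h : M ≃ₜ N) :
    letI := h.pullbackChartedSpace (H := H)
    ContMDiff I I ∞ h.symm := by
  let := h.pullbackChartedSpace (H := H)
  intro x
  rw [contMDiffAt_iff]
  refine ⟨h.symm.continuous.continuousAt, ?_⟩
  have h1 : ContDiffWithinAt ℝ ∞ id (range I) (extChartAt I x x) := contDiffWithinAt_id
  refine h1.congr_of_eventuallyEq_of_mem ?_ (mem_range_self _)
  filter_upwards [extChartAt_target_mem_nhdsWithin (I := I) x] with y hy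
  have h2 : ∀ z : N, extChartAt I (h.symm x) (h.symm z) = extChartAt I x z := by
    intro z
    change extChartAt I (h (h.symm x)) (h (h.symm z)) = extChartAt I x z
    rw [h.apply_symm_apply, h.apply_symm_apply]
  exact (h2 _).trans ((extChartAt I x).right_inv hy)

end Transport

/-! ### Smooth maps with smooth local sections are submersions -/

section Submersion

variable {V : Type u} [NormedAddCommGroup V] [NormedSpace ℝ V] [CompleteSpace V]
  {M : Type*} [TopologicalSpace M] [ChartedSpace V M] [IsManifold 𝓘(ℝ, V) ∞ M]
  {F : Type*} {H N : Type*} [NormedAddCommGroup F] [NormedSpace ℝ F]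
  [TopologicalSpace H] {J : ModelWithCorners ℝ F H} [J.Boundaryless] [TopologicalSpace N]
  [ChartedSpace H N] [IsManifold J ∞ N]

theorem trans_mem_maximalAtlas {e : OpenPartialHomeomorph M V}
    (he : e ∈ IsManifold.maximalAtlas 𝓘(ℝ, V) ∞ M) {Θ : OpenPartialHomeomorph V V}
    (h1 : ContDiffOn ℝ ∞ Θ Θ.source) (h2 : ContDiffOn ℝ ∞ Θ.symm Θ.target) :
    e ≫ₕ Θ ∈ IsManifold.maximalAtlas 𝓘(ℝ, V) ∞ M := by
  have hΘ : Θ ∈ contDiffGroupoid ∞ 𝓘(ℝ, V) := by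
    rw [contDiffGroupoid, mem_groupoid_of_pregroupoid]
    simpa [contDiffPregroupoid] using And.intro h1 h2
  rw [IsManifold.mem_maximalAtlas_iff] at he ⊢
  rw [mem_maximalAtlas_iff] at he ⊢
  intro e' he'
  rw [OpenPartialHomeomorph.trans_symm_eq_symm_trans_symm, OpenPartialHomeomorph.trans_assoc,
    ← OpenPartialHomeomorph.trans_assoc e'.symm]
  exact ⟨(contDiffGroupoid ∞ 𝓘(ℝ, V)).trans ((contDiffGroupoid ∞ 𝓘(ℝ, V)).symm hΘ) (he e' he').1,
    (contDiffGroupoid ∞ 𝓘(ℝ, V)).trans (he e' he').2 hΘ⟩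

/-- A smooth map with a smooth local section is a submersion. -/
theorem isSubmersionAt_of_section {f : M → N} {x : M} (hf : ContMDiff 𝓘(ℝ, V) J ∞ f) {s : N → M}
    (hs : ContMDiffAt J 𝓘(ℝ, V) ∞ s (f x)) (hsx : s (f x) = x)
    (hfs : ∀ᶠ q in 𝓝 (f x), f (s q) = q) :
    Manifold.IsSubmersionAt 𝓘(ℝ, V) J ∞ f x := by
  set e := extChartAt 𝓘(ℝ, V) x with he
  set c := extChartAt J (f x) with hc
  set a : V := e x with ha
  set k : V → F := fun y => c (f (e.symm y)) with hk
  set σ : F → V := fun z => e (s (c.symm z)) with hσ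
  have hxe : x ∈ e.source := mem_extChartAt_source x
  have hxc : f x ∈ c.source := mem_extChartAt_source (f x)
  have hea : e.symm a = x := e.left_inv hxe
  set U : Set V := e.target ∩ e.symm ⁻¹' (f ⁻¹' c.source) with hU
  have hUo : IsOpen U :=
    (continuousOn_extChartAt_symm (I := 𝓘(ℝ, V)) x).isOpen_inter_preimage
      (isOpen_extChartAt_target (I := 𝓘(ℝ, V)) x)
      ((isOpen_extChartAt_source (I := J) (f x)).preimage hf.continuous)
  have haU : a ∈ U := ⟨e.map_source hxe, by
    simpa [hea] using hxc⟩
  have hkU : ContDiffOn ℝ ∞ k U := by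
    rw [← contMDiffOn_iff_contDiffOn]
    exact (contMDiffOn_extChartAt (I := J) (x := f x)).comp
      (hf.comp_contMDiffOn ((contMDiffOn_extChartAt_symm (I := 𝓘(ℝ, V)) x).mono inter_subset_left))
      fun y hy => by simpa [hc] using hy.2
  have hσ1 : DifferentiableAt ℝ σ (c (f x)) := by
    have h1 : ContMDiffAt 𝓘(ℝ, F) J ∞ c.symm (c (f x)) :=
      (contMDiffOn_extChartAt_symm (I := J) (f x)).contMDiffAt
        (extChartAt_target_mem_nhds (I := J) (f x))
    have h2 : c.symm (c (f x)) = f x := c.left_inv hxc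
    have h3 : ContMDiffAt 𝓘(ℝ, F) 𝓘(ℝ, V) ∞ (fun z => s (c.symm z)) (c (f x)) :=
      ContMDiffAt.comp (c (f x)) (by rw [h2]; exact hs) h1
    have h4 : ContMDiffAt 𝓘(ℝ, V) 𝓘(ℝ, V) ∞ e (s (c.symm (c (f x)))) := by
      rw [h2, hsx]
      exact contMDiffAt_extChartAt
    exact (ContMDiffAt.comp (c (f x)) h4 h3).contDiffAt.differentiableAt (by simp)
  have hσa : σ (c (f x)) = a := by
    simp only [hσ]
    rw [c.left_inv hxc, hsx]
  have hka : DifferentiableAt ℝ k (σ (c (f x))) := by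
    rw [hσa]
    exact (hkU.contDiffAt (hUo.mem_nhds haU)).differentiableAt (by simp)
  have hkσ : (fun z => k (σ z)) =ᶠ[𝓝 (c (f x))] id := by
    have h1 : Filter.Tendsto c.symm (𝓝 (c (f x))) (𝓝 (f x)) := by
      have := continuousAt_extChartAt_symm (I := J) (f x)
      rw [ContinuousAt, extChartAt_to_inv] at this
      exact this
    have h2 : ∀ᶠ q in 𝓝 (f x), s q ∈ e.source :=
      hs.continuousAt.preimage_mem_nhds (by
        rw [hsx]
        exact extChartAt_source_mem_nhds (I := 𝓘(ℝ, V)) x)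
    filter_upwards [h1.eventually hfs, h1.eventually h2,
      extChartAt_target_mem_nhds (I := J) (f x)] with z hz1 hz2 hz3
    simp only [hk, hσ, id]
    rw [e.left_inv hz2, hz1]
    exact c.right_inv hz3
  set k' := fderiv ℝ k a with hk'
  set σ' := fderiv ℝ σ (c (f x)) with hσ'
  -- The derivative of the section splits the derivative of the map, so `V` is the product of `F`
  -- and the kernel.
  have hinv : Function.RightInverse σ' k' := by
    intro z
    have h1 := (hka.hasFDerivAt.comp (c (f x)) hσ1.hasFDerivAt).congr_of_eventuallyEq hkσ.symm
    have h2 := h1.unique (hasFDerivAt_id (c (f x)))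
    rw [hσa] at h2
    exact congrArg (fun L : F →L[ℝ] F => L z) h2
  set q : V ≃L[ℝ] F × k'.ker := ContinuousLinearEquiv.equivOfRightInverse k' σ' hinv with hq
  -- `g` replaces the `F`-component of y by k(y). Its derivative at `a` is the identity, and in the
  -- chart corrected by it the map becomes the projection onto `F`.
  set g : V → V := fun y => q.symm (k y, (q y).2) with hg
  have hgU : ContDiffOn ℝ ∞ g U :=
    (q.symm : (F × k'.ker) →L[ℝ] V).contDiff.comp_contDiffOn
      (hkU.prodMk (contDiff_snd.comp (q : V →L[ℝ] F × k'.ker).contDiff).contDiffOn)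
  have hga : HasFDerivAt g ((ContinuousLinearEquiv.refl ℝ V : V ≃L[ℝ] V) : V →L[ℝ] V) a := by
    have h1 : HasFDerivAt k k' a := by
      have := hka.hasFDerivAt
      rwa [hσa] at this
    have h2 : HasFDerivAt (fun y => (q y).2)
        ((ContinuousLinearMap.snd ℝ F k'.ker).comp (q : V →L[ℝ] F × k'.ker)) a :=
      ((ContinuousLinearMap.snd ℝ F k'.ker).comp (q : V →L[ℝ] F × k'.ker)).hasFDerivAt
    have h3 := (q.symm : (F × k'.ker) →L[ℝ] V).hasFDerivAt.comp a (h1.prodMk h2)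
    refine h3.congr_fderiv (ContinuousLinearMap.ext fun v => ?_)
    exact q.symm_apply_apply v
  obtain ⟨Θ, haΘ, hΘU, hΘg, hΘ1, hΘ2⟩ := exists_openPartialHomeomorph_contDiffOn hUo haU hgU _ hga
  refine ⟨k'.ker, inferInstance, inferInstance, ?_⟩
  refine Manifold.IsSubmersionAtOfComplement.mk_of_continuousAt hf.continuous.continuousAt q
    (chartAt V x ≫ₕ Θ) (chartAt H (f x)) ?_ (mem_chart_source _ _)
    (trans_mem_maximalAtlas (IsManifold.chart_mem_maximalAtlas x) hΘ1 hΘ2)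
    (IsManifold.chart_mem_maximalAtlas (f x)) ?_
  · simpa [ha, he] using haΘ
  · intro y hy
    have hy' : y ∈ Θ.target := by
      simp at hy
      exact hy.1
    have h1 : g (Θ.symm y) = y := (hΘg _).symm.trans (Θ.right_inv hy')
    have h2 : q (g (Θ.symm y)) = (k (Θ.symm y), (q (Θ.symm y)).2) := q.apply_symm_apply _
    rw [h1] at h2
    exact (congrArg Prod.fst h2).symm

end Submersion

/-! ### The phase space as a manifold -/

section PhaseDiffeomorph

variable {𝔤 : Type u} [NormedLieRing 𝔤] [NormedLieAlgebra 𝔤] [FiniteDimensional ℝ 𝔤]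
  {E : Type v} {G : Type*} [NormedAddCommGroup E] [NormedSpace ℝ E] [FiniteDimensional ℝ E]
  [TopologicalSpace G] [ChartedSpace E G] [Group G] [LieGroup 𝓘(ℝ, E) ∞ G]
  (φ : 𝔤 ≃ₗ⁅ℝ⁆ GroupLieAlgebra 𝓘(ℝ, E) G)

/-- Local sections of the map from paths in the Lie algebra to the cotangent bundle. -/
theorem exists_section_cotangentOfPath (p : StrongDual ℝ 𝔤 × PathSpace 𝔤) :
    ∃ s : CotangentBundle E G → StrongDual ℝ 𝔤 × PathSpace 𝔤,
      ContMDiffAt (cotangentModel E) 𝓘(ℝ, StrongDual ℝ 𝔤 × PathSpace 𝔤) ∞ s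
        (cotangentOfPath φ p) ∧
      s (cotangentOfPath φ p) = p ∧
      ∀ᶠ q in 𝓝 (cotangentOfPath φ p), cotangentOfPath φ (s q) = q := by
  have := topologicalGroup_of_lieGroup 𝓘(ℝ, E) ∞ (G := G)
  obtain ⟨N, ℓ, hN, h1N, hℓ1, hℓ, hexp, -⟩ := exists_logG E G
  set ζ := pathEquivL φ p.2 with hζ
  -- Adding Ad(h)⁻¹ applied to the constant path v multiplies the holonomy on the left by exp v, so
  -- v = log(g hol⁻¹) reaches the group element g.
  set A : E →L[ℝ] PathSpace 𝔤 := ((pathEquivL φ).symm : PathSpace E →L[ℝ] PathSpace 𝔤).comp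
    ((adPathInvL G ζ).comp (PathSpace.constL E)) with hA
  set δ : CotangentBundle E G → G := fun q => q.1 * (hol G ζ)⁻¹ with hδ
  have hδC : ContMDiff (cotangentModel E) 𝓘(ℝ, E) ∞ δ :=
    (Bundle.contMDiff_proj (n := ∞) (IB := 𝓘(ℝ, E)) _).mul contMDiff_const
  have hδ1 : δ (cotangentOfPath φ p) = 1 := mul_inv_cancel _
  have hδN : ∀ᶠ q in 𝓝 (cotangentOfPath φ p), δ q ∈ N :=
    hδC.continuous.continuousAt.preimage_mem_nhds (by
      rw [hδ1]
      exact hN.mem_nhds h1N)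
  refine ⟨fun q => (cotangentLeft φ q, p.2 + A (ℓ (δ q))), ?_, ?_, ?_⟩
  · have h1 : ContMDiffAt (cotangentModel E) 𝓘(ℝ, E) ∞ (fun q => ℓ (δ q)) (cotangentOfPath φ p) :=
      ContMDiffAt.comp _ (by
        rw [hδ1]
        exact hℓ.contMDiffAt (hN.mem_nhds h1N)) (hδC _)
    have h2 : ContDiff ℝ ∞ fun z : E => p.2 + A z := contDiff_const.add A.contDiff
    exact ((contMDiff_cotangentLeft φ) _).prodMk_space (h2.contMDiff.contMDiffAt.comp _ h1)
  · refine Prod.ext (cotangentLeft_cotangentOf φ _ |>.trans rfl) ?_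
    simp only [hδ1, hℓ1, map_zero, add_zero]
  · filter_upwards [hδN] with q hq
    have h1 : holonomy φ (p.2 + A (ℓ (δ q))) = q.1 := by
      have h2 : pathEquivL φ (p.2 + A (ℓ (δ q))) =
          ζ + adPathInvL G ζ (PathSpace.constL E (ℓ (δ q))) := by
        rw [map_add]
        exact congrArg (ζ + ·) ((pathEquivL φ).apply_symm_apply _)
      change hol G (pathEquivL φ (p.2 + A (ℓ (δ q)))) = q.1
      rw [h2, hol_adPathInvL]
      change expG G (ℓ (δ q)) * _ = _
      rw [hexp _ hq]
      exact inv_mul_cancel_right _ _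
    change cotangentOf φ (cotangentLeft φ q, holonomy φ (p.2 + A (ℓ (δ q)))) = q
    rw [h1, cotangentOf_cotangentLeft]

variable [SimplyConnectedSpace G]

/-- The point of the cotangent bundle which corresponds to a gauge orbit. -/
def phaseToCotangent (x : PhaseSpace 𝔤) : CotangentBundle E G :=
  cotangentOf φ (phaseLeft x, phaseHol φ x)

theorem cotangentLeft_phaseToCotangent (x : PhaseSpace 𝔤) :
    cotangentLeft φ (phaseToCotangent φ x) = phaseLeft x := cotangentLeft_cotangentOf φ _

theorem phaseToCotangent_phaseClass (c : ConstraintManifold 𝔤) :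
    phaseToCotangent φ (phaseClass c) = cotangentOfPath φ (c.X 0, c.η) := by
  rw [phaseToCotangent, phaseLeft_phaseClass, phaseHol_phaseClass]
  rfl

theorem continuous_phaseClass : Continuous (phaseClass (𝔤 := 𝔤)) := continuous_quotient_mk'

theorem continuous_phaseToCotangent : Continuous (phaseToCotangent (𝔤 := 𝔤) φ) := by
  have h : Continuous fun c : ConstraintManifold 𝔤 => phaseToCotangent φ (phaseClass c) := by
    simp only [phaseToCotangent_phaseClass]
    exact (contMDiff_cotangentOfPath φ).continuous.comp continuous_coords
  exact isQuotientMap_quotient_mk'.continuous_iff.2 h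

theorem bijective_phaseToCotangent : Function.Bijective (phaseToCotangent (𝔤 := 𝔤) φ) := by
  constructor
  · intro x y h
    refine phaseSpace_ext φ ?_ (congrArg (fun q => q.1) h)
    rw [← cotangentLeft_phaseToCotangent φ, h, cotangentLeft_phaseToCotangent]
  · intro q
    obtain ⟨x, hx, hx'⟩ := exists_phaseSpace φ (cotangentLeft φ q) q.1
    exact ⟨x, by rw [phaseToCotangent, hx, hx', cotangentOf_cotangentLeft]⟩

/-- The homeomorphism between the phase space and the cotangent bundle of the group. -/
def phaseHomeomorph : PhaseSpace 𝔤 ≃ₜ CotangentBundle E G where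
  toEquiv := Equiv.ofBijective _ (bijective_phaseToCotangent φ)
  continuous_toFun := continuous_phaseToCotangent φ
  continuous_invFun := by
    rw [continuous_iff_continuousAt]
    intro q
    obtain ⟨x, rfl⟩ := (bijective_phaseToCotangent φ).2 q
    obtain ⟨c, rfl⟩ := Quotient.exists_rep x
    change ContinuousAt _ (phaseToCotangent φ (phaseClass c))
    rw [phaseToCotangent_phaseClass]
    -- Locally the inverse is a continuous section followed by the quotient map.
    obtain ⟨s, hs, -, hsq⟩ := exists_section_cotangentOfPath φ (c.X 0, c.η)
    have h1 : ContinuousAt (fun q => phaseClass (solveConstraint (s q)))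
        (cotangentOfPath φ (c.X 0, c.η)) :=
      (continuous_phaseClass.comp continuous_solveConstraint).continuousAt.comp hs.continuousAt
    refine h1.congr ?_
    filter_upwards [hsq] with q hq
    refine ((Equiv.ofBijective _ (bijective_phaseToCotangent φ)).symm_apply_eq.2 ?_).symm
    change q = phaseToCotangent φ (phaseClass (solveConstraint (s q)))
    rw [phaseToCotangent_phaseClass, solveConstraint_X_zero, solveConstraint_η]
    exact hq.symm

theorem phaseHomeomorph_apply (x : PhaseSpace 𝔤) :
    phaseHomeomorph φ x = phaseToCotangent φ x := rfl

theorem contMDiff_coords :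
    ContMDiff 𝓘(ℝ, StrongDual ℝ 𝔤 × PathSpace 𝔤) 𝓘(ℝ, StrongDual ℝ 𝔤 × PathSpace 𝔤) ∞
      fun c : ConstraintManifold 𝔤 => (c.X 0, c.η) := by
  intro c
  rw [contMDiffAt_iff]
  exact ⟨continuous_coords.continuousAt,
    (contDiffWithinAt_id.congr (fun y _ => (constraintChart 𝔤).right_inv y)
      ((constraintChart 𝔤).right_inv _))⟩

theorem contMDiff_solveConstraint :
    ContMDiff 𝓘(ℝ, StrongDual ℝ 𝔤 × PathSpace 𝔤) 𝓘(ℝ, StrongDual ℝ 𝔤 × PathSpace 𝔤) ∞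
      (solveConstraint (𝔤 := 𝔤)) := by
  intro p
  rw [contMDiffAt_iff]
  exact ⟨continuous_solveConstraint.continuousAt,
    (contDiffWithinAt_id.congr (fun y _ => (constraintChart 𝔤).right_inv y)
      ((constraintChart 𝔤).right_inv _))⟩

theorem isSubmersionAt_phaseClass (c : ConstraintManifold 𝔤) :
    letI := (phaseHomeomorph φ).pullbackChartedSpace (H := ModelProd E (E →L[ℝ] ℝ))
    Manifold.IsSubmersionAt 𝓘(ℝ, StrongDual ℝ 𝔤 × PathSpace 𝔤) (cotangentModel E) ∞
      (phaseClass (𝔤 := 𝔤)) c := by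
  let := (phaseHomeomorph φ).pullbackChartedSpace (H := ModelProd E (E →L[ℝ] ℝ))
  have := (phaseHomeomorph φ).isManifold_pullback (cotangentModel E)
  have hΦ := (phaseHomeomorph φ).contMDiff_pullback (cotangentModel E)
  have hΦ' := (phaseHomeomorph φ).contMDiff_symm_pullback (cotangentModel E)
  have hΦc : ∀ p, phaseHomeomorph φ (phaseClass (solveConstraint p)) = cotangentOfPath φ p := by
    intro p
    rw [phaseHomeomorph_apply, phaseToCotangent_phaseClass, solveConstraint_X_zero,
      solveConstraint_η]
  obtain ⟨s, hs, hsp, hsq⟩ := exists_section_cotangentOfPath φ (c.X 0, c.η)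
  have hc : phaseHomeomorph φ (phaseClass c) = cotangentOfPath φ (c.X 0, c.η) :=
    phaseToCotangent_phaseClass φ c
  rw [← hc] at hs hsp hsq
  refine isSubmersionAt_of_section (s := fun x => solveConstraint (s (phaseHomeomorph φ x)))
    ?_ ?_ ?_ ?_
  · have h1 : ContMDiff 𝓘(ℝ, StrongDual ℝ 𝔤 × PathSpace 𝔤) (cotangentModel E) ∞
        fun c : ConstraintManifold 𝔤 =>
          (phaseHomeomorph φ).symm (cotangentOfPath φ (c.X 0, c.η)) :=
      hΦ'.comp ((contMDiff_cotangentOfPath φ).comp contMDiff_coords)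
    convert h1 using 2 with c
    exact ((phaseHomeomorph φ).symm_apply_eq.2 (phaseToCotangent_phaseClass φ c).symm).symm
  · exact contMDiff_solveConstraint.contMDiffAt.comp _ (ContMDiffAt.comp _ hs (hΦ _))
  · rw [hsp]
    exact solveConstraint_eq c
  · filter_upwards [(phaseHomeomorph φ).continuous.continuousAt.eventually hsq] with x hx
    exact (phaseHomeomorph φ).injective ((hΦc _).trans hx)

end PhaseDiffeomorph

end

/-- Composition and inverse are relations between orbits, so each equivalence, with Φ bijective,
also yields the domain of the operation and its independence of representatives. The equality of
forms is stated after pull-back to the constraint manifold. Since the projection is a surjective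
submersion, this determines the form on the phase space. -/
theorem mainTheorem5
    {𝔤 : Type*} [NormedLieRing 𝔤] [NormedLieAlgebra 𝔤] [FiniteDimensional ℝ 𝔤]
    {E : Type*} [NormedAddCommGroup E] [NormedSpace ℝ E] [FiniteDimensional ℝ E]
    {G : Type*} [TopologicalSpace G] [ChartedSpace E G] [Group G] [LieGroup 𝓘(ℝ, E) ∞ G]
    [SimplyConnectedSpace G]
    (φ : 𝔤 ≃ₗ⁅ℝ⁆ GroupLieAlgebra 𝓘(ℝ, E) G) :
    -- the phase space is a manifold such that the projection is a smooth submersion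
    ∃ (_ : ChartedSpace (ModelProd E (E →L[ℝ] ℝ)) (PhaseSpace 𝔤))
      (_ : IsManifold (cotangentModel E) ∞ (PhaseSpace 𝔤)),
      (∀ c : ConstraintManifold 𝔤,
        Manifold.IsSubmersionAt 𝓘(ℝ, StrongDual ℝ 𝔤 × PathSpace 𝔤) (cotangentModel E) ∞
          phaseClass c) ∧
      -- (initial point, holonomy) is a diffeomorphism onto `𝔤* × G`
      ∃ (Ψ : Diffeomorph (cotangentModel E) (𝓘(ℝ, StrongDual ℝ 𝔤).prod 𝓘(ℝ, E))
            (PhaseSpace 𝔤) (StrongDual ℝ 𝔤 × G) ∞)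
        -- and, in the right trivialization, a diffeomorphism onto `T*G`
        (Φ : Diffeomorph (cotangentModel E) (cotangentModel E)
            (PhaseSpace 𝔤) (CotangentBundle E G) ∞),
        (∀ c : ConstraintManifold 𝔤, (Ψ (phaseClass c)).1 = c.X 0) ∧
        (∀ (c : ConstraintManifold 𝔤) (g : G),
          IsHolonomy φ c.η g ↔ (Ψ (phaseClass c)).2 = g) ∧
        (∀ x, Ψ x = (cotangentLeft φ (Φ x), (Φ x).1)) ∧
        -- it identifies the groupoid structures
        (∀ x, cotangentLeft φ (Φ x) = phaseLeft x) ∧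
        (∀ x, cotangentRight φ (Φ x) = phaseRight x) ∧
        (∀ ξ, Φ (phaseUnit ξ) = cotangentUnit φ ξ) ∧
        (∀ x y z, PhaseComp x y z ↔
          cotangentRight φ (Φ x) = cotangentLeft φ (Φ y) ∧
            Φ z = cotangentMul (Φ x) (Φ y)) ∧
        (∀ x y, PhaseInv x y ↔
          cotangentRight φ (Φ x) = cotangentLeft φ (Φ y) ∧
            cotangentMul (Φ x) (Φ y) = cotangentUnit φ (cotangentLeft φ (Φ x))) ∧
        -- and the symplectic structures: the pull-back of the canonical form of `T*G`
        -- is the form on the phase space induced by `ω`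
        (∀ (c : ConstraintManifold 𝔤)
          (v w : TangentSpace 𝓘(ℝ, StrongDual ℝ 𝔤 × PathSpace 𝔤) c),
          cotangentForm (Φ (phaseClass c))
              (mfderiv (cotangentModel E) (cotangentModel E) Φ (phaseClass c)
                (mfderiv 𝓘(ℝ, StrongDual ℝ 𝔤 × PathSpace 𝔤) (cotangentModel E) phaseClass c v))
              (mfderiv (cotangentModel E) (cotangentModel E) Φ (phaseClass c)
                (mfderiv 𝓘(ℝ, StrongDual ℝ 𝔤 × PathSpace 𝔤) (cotangentModel E) phaseClass c w)) =
            constraintForm c v w) := by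
  let := (phaseHomeomorph φ).pullbackChartedSpace (H := ModelProd E (E →L[ℝ] ℝ))
  have hM := (phaseHomeomorph φ).isManifold_pullback (cotangentModel E)
  have hsub := isSubmersionAt_phaseClass φ
  let Φ : Diffeomorph (cotangentModel E) (cotangentModel E)
      (PhaseSpace 𝔤) (CotangentBundle E G) ∞ :=
    { toEquiv := (phaseHomeomorph φ).toEquiv
      contMDiff_toFun := (phaseHomeomorph φ).contMDiff_pullback (cotangentModel E)
      contMDiff_invFun := (phaseHomeomorph φ).contMDiff_symm_pullback (cotangentModel E) }
  have hfst : ∀ x, (Φ x).1 = phaseHol φ x := fun x => rfl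
  have hleft : ∀ x, cotangentLeft φ (Φ x) = phaseLeft x := cotangentLeft_phaseToCotangent φ
  have hright : ∀ x, cotangentRight φ (Φ x) = phaseRight x := fun x => by
    rw [cotangentRight_eq_coadjoint, phaseRight_eq φ, hleft, hfst]
  have hunit : ∀ ξ, (cotangentUnit φ ξ : CotangentBundle E G).1 = 1 := fun ξ => rfl
  have hmul : ∀ p q : CotangentBundle E G, (cotangentMul p q).1 = p.1 * q.1 := fun p q => rfl
  refine ⟨_, hM, hsub, Φ.trans (cotangentDiffeomorph φ), Φ, fun c => ?_, fun c g => ?_,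
    fun x => rfl, hleft, hright, fun ξ => ?_, fun x y z => ?_, fun x y => ?_, fun c v w => ?_⟩
  · exact hleft _
  · rw [isHolonomy_iff, ← phaseHol_phaseClass φ]
    rfl
  · refine cotangentBundle_ext φ ?_ ?_
    · rw [hleft, cotangentLeft_cotangentUnit]
      rfl
    · rw [hfst, phaseHol_phaseUnit, hunit]
  · rw [phaseComp_iff φ, hright, hleft]
    refine and_congr_right fun _ => ⟨fun h => cotangentBundle_ext φ ?_ ?_, fun h => ⟨?_, ?_⟩⟩
    · rw [cotangentLeft_cotangentMul, hleft, hleft, h.1]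
    · rw [hmul, hfst, hfst, hfst, h.2]
    · rw [← hleft, h, cotangentLeft_cotangentMul, hleft]
    · rw [← hfst, h, hmul, hfst, hfst]
  · rw [phaseInv_iff φ, hright, hleft]
    refine and_congr_right fun _ => ⟨fun h => cotangentBundle_ext φ ?_ ?_, fun h => ?_⟩
    · rw [cotangentLeft_cotangentMul, cotangentLeft_cotangentUnit]
    · rw [hmul, hfst, hfst, h, hunit]
    · rw [← hfst, ← hfst, ← hmul, h, hunit]
  -- By the chain rule only Φ ∘ π matters, and in the global chart this is `cotangentOfPath`.
  · have h1 : mfderiv 𝓘(ℝ, StrongDual ℝ 𝔤 × PathSpace 𝔤) (cotangentModel E) (Φ ∘ phaseClass) c =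
        (mfderiv (cotangentModel E) (cotangentModel E) Φ (phaseClass c)).comp
          (mfderiv 𝓘(ℝ, StrongDual ℝ 𝔤 × PathSpace 𝔤) (cotangentModel E) phaseClass c) :=
      mfderiv_comp c (Φ.contMDiff.mdifferentiable (by simp) _)
        ((hsub c).contMDiffAt.mdifferentiableAt (by simp))
    have h2 := cotangentForm_eq_constraintForm φ (f := Φ ∘ phaseClass)
      (funext fun c => phaseToCotangent_phaseClass φ c) c v w
    rw [h1] at h2
    exact h2
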